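/- **Notation.** Let $n\in\mathbb N$, $1<p<\infty$, $1<q<\infty$, $-\frac np<r<0$, $r+\varrho=-n$, $\frac1p+\frac1{p'}=1$, $\frac1q+\frac1{q'}=1$. Functions are complex-valued, $D(\mathbb R^n)=C_0^\infty(\mathbb R^n)$, $C(\mathbb R^n)$ is the space of bounded continuous functions, and $Q_{J,M}=2^{-J}(M+[-1,1]^n)$ for $J\in\mathbb Z$, $M\in\mathbb Z^n$. * $L_p^r(\mathbb R^n)$ is the space of all $f\in L_p^{\rm loc}(\mathbb R^n)$ with $\|f|L_p^r(\mathbb R^n)\|=\sup_{J,M}2^{J(\frac np+r)}\|f|L_p(Q_{J,M})\|<\infty$, and $\mathring L_p^r(\mathbb R^n)$ is the closure of $D(\mathbb R^n)$ in it. * $L_p^r(\ell_q,\mathbb R^n)$ is the space of all sequences $\{f_j\}_{j\in\mathbb N_0}$ in $L_p^r(\mathbb R^n)$ with $\|\{f_j\}|L_p^r(\ell_q,\mathbb R^n)\|=\big\|(\sum_j|f_j|^q)^{1/q}\big|L_p^r(\mathbb R^n)\big\|<\infty$, and $\mathring L_p^r(\ell_q,\mathbb R^n)$ is the closure in it of the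 finite sequences of functions of $D(\mathbb R^n)$. The norm of $L_p(\ell_q,\mathbb R^n)$ is $\big\|(\sum_j|f_j|^q)^{1/q}\big|L_p(\mathbb R^n)\big\|$. * $H^\varrho L_{p'}(\mathbb R^n)$ is the space of all $h=\sum_{J,M}\lambda_{J,M}a_{J,M}$ (convergence in $S'(\mathbb R^n)$) with $\operatorname{supp}a_{J,M}\subset Q_{J,M}$, $\|a_{J,M}|L_{p'}(\mathbb R^n)\|\le2^{-J(\frac n{p'}+\varrho)}$ and $\sum|\lambda_{J,M}|<\infty$, normed by the infimum of $\sum|\lambda_{J,M}|$ over all such representations; its elements are functions. $H^\varrho L_{p'}(\ell_{q'},\mathbb R^n)$ is the space of all sequences $\{g_j\}$ in $H^\varrho L_{p'}(\mathbb R^n)$ such that $(\sum_j|g_j|^{q'})^{1/q'}$ belongs to $H^\varrho L_{p'}(\mathbb R^n)$, normed by the norm of this function. An operator acting in one of these spaces $X$ is bounded if it maps $X$ into $X$ and $\|Tx|X\|\le c\|x|X\|$ with $c$ independent of $x\in X$. It is an extension of an operator $T$ on $D(\mathbb R^n)$ if it coincides with $T$ on $D(\mathbb R^n)$. **Theorem.**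 Let $T_j:D(\mathbb R^n)\to C(\mathbb R^n)$, $j\in\mathbb N_0$, be operators such that 1. each $T_j$ is either linear, or real-valued with $T_j(f_1+f_2)\le T_jf_1+T_jf_2$ pointwise, $T_j(-f)=T_jf$ and $T_j0=0$ for all $f,f_1,f_2\in D(\mathbb R^n)$; 2. there is a constant $c_1$ with $|(T_jf)(y)|\le c_1\int_{\mathbb R^n}\frac{|f(z)|}{|y-z|^n}\,dz$ for all $j\in\mathbb N_0$, $f\in D(\mathbb R^n)$ and $y\notin\operatorname{supp}f$; 3. there is a constant $c_2$ with $\|\{T_jf_j\}|L_p(\ell_q,\mathbb R^n)\|\le c_2\|\{f_j\}|L_p(\ell_q,\mathbb R^n)\|$ for all $\{f_j\}_{j\in\mathbb N_0}\subset D(\mathbb R^n)$. Then the following holds. (i) For each $j$ there is a unique continuous and bounded extension $\widetilde T_j$ of $T_j$ acting in $\mathring L_p^r(\mathbb R^n)$, and $\{f_j\}\mapsto\{\widetilde T_jf_j\}$ is a continuous and bounded operator acting in $\mathring L_p^r(\ell_q,\mathbb R^n)$. (ii) If all $T_j$ are linear, then the $\widetilde T_j$ are linear and have unique dual operators $\widetilde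 T_j'$ acting in $H^\varrho L_{p'}(\mathbb R^n)$, that is, $\int(\widetilde T_jf)\,g\,dx=\int f\,(\widetilde T_j'g)\,dx$ for all $f\in\mathring L_p^r(\mathbb R^n)$ and $g\in H^\varrho L_{p'}(\mathbb R^n)$, where all integrals converge absolutely. The $\widetilde T_j'$ are linear and bounded, and $\{g_j\}\mapsto\{\widetilde T_j'g_j\}$ is a bounded operator acting in $H^\varrho L_{p'}(\ell_{q'},\mathbb R^n)$. If moreover all $T_j$ are formally self-adjoint in the sense that $\int(T_jf)\,g\,dx=\int f\,(T_jg)\,dx$ for all $f,g\in D(\mathbb R^n)$, then $\widetilde T_j'$ is the unique linear and bounded extension of $T_j$ acting in $H^\varrho L_{p'}(\mathbb R^n)$, for each $j$. (iii) If all $T_j$ are linear, then there are linear and bounded extensions $\widehat T_j$ of $T_j$ acting in $L_p^r(\mathbb R^n)$ such that $\{f_j\}\mapsto\{\widehat T_jf_j\}$ is a bounded operator acting in $L_p^r(\ell_q,\mathbb R^n)$. -/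

import Mathlib

open MeasureTheory Set Filter Topology TopologicalSpace
open scoped ENNReal NNReal Distributions SchwartzMap BoundedContinuousFunction

noncomputable section

namespace MorreyOp

/-! ### Functions on `ℝⁿ` -/

/-- Euclidean `n`-space. -/
abbrev Rn (n : ℕ) := EuclideanSpace ℝ (Fin n)

/-- Classes of a.e. coinciding measurable functions `ℝⁿ → ℂ`. -/
abbrev Fn (n : ℕ) := Rn n →ₘ[volume] ℂ

/-- The test functions `D(ℝⁿ) = C₀^∞(ℝⁿ)`. -/
abbrev D (n : ℕ) := 𝓓((⊤ : Opens (Rn n)), ℂ)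

/-- The bounded continuous functions `C(ℝⁿ)`. -/
abbrev Cb (n : ℕ) := Rn n →ᵇ ℂ

variable {n : ℕ}

/-- The class of a test function. -/
def ofD (φ : D n) : Fn n :=
  AEEqFun.mk φ φ.continuous.aestronglyMeasurable

/-- The class of a bounded continuous function. -/
def ofC (u : Cb n) : Fn n :=
  AEEqFun.mk u u.continuous.aestronglyMeasurable

/-- `x ↦ ‖{f_j(x)} | ℓ_q‖`, with values in `[0,∞]`. -/
def lqNorm (q : ℝ) (f : ℕ → Rn n → ℂ) (x : Rn n) : ℝ≥0∞ :=
  (∑' j, ‖f j x‖ₑ ^ q) ^ (1 / q)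

/-- `‖F | L_p(M)‖` for a function `F` with values in `[0,∞]`. -/
def lpNorm (p : ℝ) (M : Set (Rn n)) (F : Rn n → ℝ≥0∞) : ℝ≥0∞ :=
  (∫⁻ x in M, F x ^ p) ^ (1 / p)

/-- The dyadic cubes `Q_{J,M} = 2^{-J} (M + [-1,1]ⁿ)`. -/
def cube (J : ℤ) (M : Fin n → ℤ) : Set (Rn n) :=
  {x | ∀ i, |(2 : ℝ) ^ J * x i - M i| ≤ 1}

/-! ### Morrey spaces -/

/-- The Morrey norm `sup_{J,M} 2^{J(n/p+r)} ‖F | L_p(Q_{J,M})‖` of a function with values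
in `[0,∞]`. -/
def morreyNormAux (p r : ℝ) (F : Rn n → ℝ≥0∞) : ℝ≥0∞ :=
  ⨆ (M : Fin n → ℤ) (J : ℤ),
    ENNReal.ofReal ((2 : ℝ) ^ ((J : ℝ) * (n / p + r))) * lpNorm p (cube J M) F

/-- `‖f | L_p^r(ℝⁿ)‖`. -/
def morreyNorm (p r : ℝ) (f : Fn n) : ℝ≥0∞ :=
  morreyNormAux p r (fun x => ‖f x‖ₑ)

/-- The Morrey space `L_p^r(ℝⁿ)`. (A finite norm makes `f` locally `p`-integrable.) -/
def morrey (n : ℕ) (p r : ℝ) : Set (Fn n) := {f | morreyNorm p r f < ∞}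

/-- The closure of `D(ℝⁿ)` in `L_p^r(ℝⁿ)`. -/
def morreyCirc (n : ℕ) (p r : ℝ) : Set (Fn n) :=
  {f | f ∈ morrey n p r ∧ ∀ ε : ℝ≥0∞, 0 < ε → ∃ φ : D n, morreyNorm p r (f - ofD φ) < ε}

/-- `‖{f_j} | L_p^r(ℓ_q,ℝⁿ)‖`. -/
def vecMorreyNorm (p r q : ℝ) (f : ℕ → Fn n) : ℝ≥0∞ :=
  morreyNormAux p r (lqNorm q (fun j => f j))

/-- The vector-valued Morrey space `L_p^r(ℓ_q,ℝⁿ)`. -/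
def vecMorrey (n : ℕ) (p r q : ℝ) : Set (ℕ → Fn n) :=
  {f | (∀ j, f j ∈ morrey n p r) ∧ vecMorreyNorm p r q f < ∞}

/-- The closure in `L_p^r(ℓ_q,ℝⁿ)` of the finite sequences of test functions. -/
def vecMorreyCirc (n : ℕ) (p r q : ℝ) : Set (ℕ → Fn n) :=
  {f | f ∈ vecMorrey n p r q ∧ ∃ φ : ℕ → ℕ → D n, (∀ k j, k < j → φ k j = 0) ∧
    Tendsto (fun k => vecMorreyNorm p r q (fun j => f j - ofD (φ k j))) atTop (𝓝 0)}

/-! ### Predual Morrey spaces -/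

/-- `h = ∑_{J,M} λ_{J,M} a_{J,M}` in `S'(ℝⁿ)` with `supp a_{J,M} ⊆ Q_{J,M}` and
`‖a_{J,M} | L_p(ℝⁿ)‖ ≤ 2^{-J(n/p+ϱ)}`. Convergence in `S'(ℝⁿ)` is convergence when tested with
Schwartz functions; the functions are identified with the distributions they induce. -/
structure IsAtomicRep (p ϱ : ℝ) (h : Rn n → ℂ) (lam : ℤ × (Fin n → ℤ) → ℂ)
    (a : ℤ × (Fin n → ℤ) → Rn n → ℂ) : Prop where
  memLp : ∀ i, MemLp (a i) (ENNReal.ofReal p) volume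
  supp : ∀ i, ∀ᵐ x : Rn n, x ∉ cube i.1 i.2 → a i x = 0
  norm_le : ∀ i, eLpNorm (a i) (ENNReal.ofReal p) volume
    ≤ ENNReal.ofReal ((2 : ℝ) ^ (-(i.1 : ℝ) * (n / p + ϱ)))
  integrable : ∀ ψ : 𝓢(Rn n, ℂ), Integrable (fun x => h x * ψ x)
  hasSum : ∀ ψ : 𝓢(Rn n, ℂ),
    HasSum (fun i => lam i * ∫ x, a i x * ψ x) (∫ x, h x * ψ x)

/-- `‖h | H^ϱ L_p(ℝⁿ)‖`, the infimum of `∑ |λ_{J,M}|` over all representations of `h`; it is finite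
exactly if there is a representation with `∑ |λ_{J,M}| < ∞`. -/
def predualNormAux (p ϱ : ℝ) (h : Rn n → ℂ) : ℝ≥0∞ :=
  ⨅ (lam : ℤ × (Fin n → ℤ) → ℂ) (a : ℤ × (Fin n → ℤ) → Rn n → ℂ)
    (_ : IsAtomicRep p ϱ h lam a), ∑' i, ‖lam i‖ₑ

/-- `‖h | H^ϱ L_p(ℝⁿ)‖`. -/
def predualNorm (p ϱ : ℝ) (h : Fn n) : ℝ≥0∞ := predualNormAux p ϱ h

/-- The predual Morrey space `H^ϱ L_p(ℝⁿ)`. -/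
def predual (n : ℕ) (p ϱ : ℝ) : Set (Fn n) := {h | predualNorm p ϱ h < ∞}

/-- `‖{g_j} | H^ϱ L_p(ℓ_q,ℝⁿ)‖`, the norm in `H^ϱ L_p(ℝⁿ)` of the function
`x ↦ ‖{g_j(x)} | ℓ_q‖`, and `∞` unless that function is finite a.e. -/
def vecPredualNorm (p ϱ q : ℝ) (g : ℕ → Fn n) : ℝ≥0∞ :=
  ⨅ (_ : ∀ᵐ x : Rn n, lqNorm q (fun j => g j) x < ∞),
    predualNormAux p ϱ (fun x => ((lqNorm q (fun j => g j) x).toReal : ℂ))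

/-- The vector-valued predual Morrey space `H^ϱ L_p(ℓ_q,ℝⁿ)`. -/
def vecPredual (n : ℕ) (p ϱ q : ℝ) : Set (ℕ → Fn n) :=
  {g | (∀ j, g j ∈ predual n p ϱ) ∧ vecPredualNorm p ϱ q g < ∞}

/-! ### Operators. `X` is the ambient vector space, `N` a norm that may take the value `∞`, and `S`
a set of elements of finite norm; an operator acting in `S` is given by a map on `X` of which only
the values on `S` matter. -/

section Operators

variable {X : Type*}

/-- `A` is a bounded operator acting in `S`. -/
def IsBddOn (N : X → ℝ≥0∞) (S : Set X) (A : X → X) : Prop :=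
  MapsTo A S S ∧ ∃ C : ℝ≥0, ∀ f ∈ S, N (A f) ≤ C * N f

/-- `A` is continuous on `S` with respect to the norm. -/
def IsContOn [AddGroup X] (N : X → ℝ≥0∞) (S : Set X) (A : X → X) : Prop :=
  ∀ f ∈ S, ∀ ε : ℝ≥0∞, 0 < ε → ∃ δ : ℝ≥0∞, 0 < δ ∧
    ∀ g ∈ S, N (g - f) < δ → N (A g - A f) < ε

/-- `A` is (complex) linear on `S`. -/
def IsLinearOn [AddCommGroup X] [Module ℂ X] (S : Set X) (A : X → X) : Prop :=
  ∀ f ∈ S, ∀ g ∈ S, ∀ a b : ℂ, A (a • f + b • g) = a • A f + b • A g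

end Operators

/-- `A` coincides with `T` on `D(ℝⁿ)`. -/
def Extends (T : D n → Cb n) (A : Fn n → Fn n) : Prop :=
  ∀ φ : D n, A (ofD φ) = ofC (T φ)

/-- `T` is sublinear: its values are real functions, `T(f₁+f₂) ≤ T f₁ + T f₂`, `T(-f) = T f` and
`T 0 = 0`. -/
structure IsSublinear (T : D n → Cb n) : Prop where
  real : ∀ f y, (T f y).im = 0
  add_le : ∀ f₁ f₂ y, (T (f₁ + f₂) y).re ≤ (T f₁ y).re + (T f₂ y).re
  neg : ∀ f, T (-f) = T f
  zero : T 0 = 0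

/-- `∫ (T f) g = ∫ f (T g)` for all test functions (no complex conjugation). -/
def IsFormallySelfAdjoint (T : D n → Cb n) : Prop :=
  ∀ f g : D n, ∫ x, T f x * g x = ∫ x, f x * T g x

/-- `B`, acting in `H`, is the dual operator of `A`, acting in `L`, where `g ∈ H` is identified with
the functional `f ↦ ∫ f g` on `L`: the functional of `B g` is that of `g` composed with `A`. -/
structure IsDualOperator (L H : Set (Fn n)) (A B : Fn n → Fn n) : Prop where
  mapsTo : MapsTo B H H
  integrable : ∀ f ∈ L, ∀ g ∈ H, Integrable (fun x => f x * g x)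
  integral_eq : ∀ f ∈ L, ∀ g ∈ H, ∫ x, A f x * g x = ∫ x, f x * B g x

end MorreyOp

end

/-!
The theorem rests on one localization argument, applied three times. Let `Q` be a dyadic cube and
let `f` be split into its part near `Q` and its part away from `Q`. The image of the near part is
controlled on `Q` by the `L_p(ℓ_q)` bound. The image of the far part is controlled on `Q` pointwise
by the size condition: for `y ∈ Q` the function `z ↦ |y-z|^{-n}` is dominated away from `Q` by a
multiple of the kernel `ker Q`, a weighted sum of indicator functions of concentric balls with radii
proportional to `2^k |Q|^{1/n}`, and this kernel belongs to the predual of the Morrey space (`pn_ker_le`, where `r < 0` is used), so that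
its pairing with `f` is bounded by the Morrey norm of `f`.

*Extension.* `T_j` is first extended to `L_p` (`lpExt`); sublinearity enters only through
`|T_j φ - T_j ψ| ≤ |T_j (φ - ψ)|`, which turns the bounds into Lipschitz estimates. Localization
gives the Morrey estimate on `L_p` functions (`Adm.mn_lq_lpExt_le`). A function `f` of the Morrey
space is the limit of its restrictions to the balls of radius `2^K`, and the images of these
converge almost everywhere, since the increments have absolutely convergent far parts on each cube;
the limit defines the operator `mext` on the whole Morrey space (`Adm.mext_spec`,
`Adm.mn_lq_mext_sub_le`). Its values are independent of any choice, hence it is linear if `T_j` is,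
and it serves both for the closure of `D(ℝⁿ)` and for the full space. It preserves the closure of
`D(ℝⁿ)` because `T_j φ` is continuous, belongs to `L_p` and vanishes at infinity, and such functions
are approximated by test functions in the Morrey norm (`exists_D_mn_lt`).

*Predual.* The norm of the predual Morrey space depends only on `|h|`: it equals the infimum `pn` of
`∑_Q 2^{-Js} ‖u_Q | L_{p'}(Q)‖` over all nonnegative families with `|h| ≤ ∑_Q 1_Q u_Q`, where
`s = n/p + r` (`predualNormAux_eq_pn`). This makes it a lattice norm with a countable triangle
inequality, and Hölder's inequality on the cubes gives the pairing with the Morrey space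
(`lintegral_mul_le_mn_mul_pn`).

*Duality.* A linear `T_j` on `L_p` has a dual on `L_{p'}`; the representation of functionals is
proved from the Radon–Nikodym theorem (`IsLpFunctional.exists_repr`). The dual operators inherit the
`L_{p'}(ℓ_{q'})` bound and the size estimate, so that for a sequence supported in one cube the
localization argument bounds the predual norm of its image (`Adm.pn_lq_dual_le`). A general sequence
is split into pieces supported in the cubes, and the images are added up
(`Setting.exists_dual_of_le_qsum`). The image `h` of `g` is characterized by
`∫ (T_j φ) g = ∫ φ h` for all test functions `φ`, which gives linearity, uniqueness and, in the
self-adjoint case, the extension property; the density of `D(ℝⁿ)` in the predual space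
(`exists_D_pn_le`) gives the uniqueness of the bounded extension.
-/

namespace MorreyOp

section

/-! ### `L_p` norms of functions with values in `[0,∞]` -/

section Nrm

variable {α : Type*} [MeasurableSpace α] {μ : Measure α} {p p' : ℝ}

/-- The `L_p(μ)` norm of a function with values in `[0,∞]`. With the counting measure on `ℕ` it is
the `ℓ_p` norm, so that `lpNorm` and `lqNorm` are both instances of it. -/
noncomputable def nrm (p : ℝ) (μ : Measure α) (F : α → ℝ≥0∞) : ℝ≥0∞ :=
  (∫⁻ x, F x ^ p ∂μ) ^ (1 / p)

theorem nrm_mono_ae (hp : 0 < p) {F G : α → ℝ≥0∞} (h : F ≤ᵐ[μ] G) : nrm p μ F ≤ nrm p μ G := by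
  unfold nrm
  refine ENNReal.rpow_le_rpow (lintegral_mono_ae ?_) (by positivity)
  filter_upwards [h] with x hx using ENNReal.rpow_le_rpow hx hp.le

theorem nrm_mono (hp : 0 < p) {F G : α → ℝ≥0∞} (h : ∀ x, F x ≤ G x) : nrm p μ F ≤ nrm p μ G :=
  nrm_mono_ae hp (.of_forall h)

theorem nrm_congr_ae {F G : α → ℝ≥0∞} (h : F =ᵐ[μ] G) : nrm p μ F = nrm p μ G := by
  unfold nrm
  congr 1
  refine lintegral_congr_ae ?_
  filter_upwards [h] with x hx
  rw [hx]

theorem nrm_mono_measure (hp : 0 < p) {ν : Measure α} (h : μ ≤ ν) (F : α → ℝ≥0∞) :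
    nrm p μ F ≤ nrm p ν F := by
  unfold nrm
  exact ENNReal.rpow_le_rpow (lintegral_mono' h le_rfl) (by positivity)

theorem nrm_add_le (hp : 1 ≤ p) {F G : α → ℝ≥0∞} (hF : AEMeasurable F μ) (hG : AEMeasurable G μ) :
    nrm p μ (fun x => F x + G x) ≤ nrm p μ F + nrm p μ G :=
  ENNReal.lintegral_Lp_add_le hF hG hp

theorem nrm_zero (hp : 0 < p) : nrm p μ (fun _ => 0) = 0 := by
  simp [nrm, hp]

theorem nrm_const_mul (hp : 0 < p) (c : ℝ≥0∞) {F : α → ℝ≥0∞} (hF : Measurable F) :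
    nrm p μ (fun x => c * F x) = c * nrm p μ F := by
  unfold nrm
  simp_rw [ENNReal.mul_rpow_of_nonneg _ _ hp.le]
  rw [lintegral_const_mul _ (hF.pow_const p),
    ENNReal.mul_rpow_of_nonneg _ _ (by positivity : 0 ≤ 1 / p), ← ENNReal.rpow_mul,
    mul_one_div_cancel hp.ne', ENNReal.rpow_one]

theorem nrm_const (hp : 0 < p) (c : ℝ≥0∞) :
    nrm p μ (fun _ => c) = c * μ univ ^ (1 / p) := by
  unfold nrm
  rw [lintegral_const, ENNReal.mul_rpow_of_nonneg _ _ (by positivity : 0 ≤ 1 / p),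
    ← ENNReal.rpow_mul, mul_one_div_cancel hp.ne', ENNReal.rpow_one]

theorem nrm_rpow (hp : 0 < p) (F : α → ℝ≥0∞) : nrm p μ F ^ p = ∫⁻ x, F x ^ p ∂μ := by
  unfold nrm
  rw [← ENNReal.rpow_mul, one_div_mul_cancel hp.ne', ENNReal.rpow_one]

theorem nrm_restrict (hp : 0 < p) {s : Set α} (hs : MeasurableSet s) (F : α → ℝ≥0∞) :
    nrm p (μ.restrict s) F = nrm p μ (s.indicator F) := by
  unfold nrm
  rw [← lintegral_indicator hs]
  congr 2
  funext x
  by_cases hx : x ∈ s <;> simp [hx, hp]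

theorem nrm_sum_le (hp : 1 ≤ p) {ι : Type*} (s : Finset ι) {F : ι → α → ℝ≥0∞}
    (hF : ∀ i, AEMeasurable (F i) μ) :
    nrm p μ (fun x => ∑ i ∈ s, F i x) ≤ ∑ i ∈ s, nrm p μ (F i) := by
  classical
  induction s using Finset.induction_on with
  | empty => simp [nrm_zero (μ := μ) (zero_lt_one.trans_le hp)]
  | insert a s ha ih =>
    simp_rw [Finset.sum_insert ha]
    refine (nrm_add_le hp (hF a) (Finset.aemeasurable_fun_sum s fun i _ => hF i)).trans ?_
    gcongr

/-- Fatou's lemma for `nrm`. -/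
theorem nrm_liminf_le (hp : 0 < p) {ι : Type*} {u : Filter ι} [u.IsCountablyGenerated]
    {F : ι → α → ℝ≥0∞} (hF : ∀ i, Measurable (F i)) :
    nrm p μ (fun x => liminf (fun i => F i x) u) ≤ liminf (fun i => nrm p μ (F i)) u := by
  unfold nrm
  have h1 : 0 < 1 / p := by positivity
  have e1 : ∀ v : ι → ℝ≥0∞, (liminf v u) ^ p = liminf (fun i => v i ^ p) u := fun v =>
    (ENNReal.orderIsoRpow p hp).liminf_apply
  have e2 : ∀ v : ι → ℝ≥0∞, (liminf v u) ^ (1 / p) = liminf (fun i => v i ^ (1 / p)) u := fun v =>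
    (ENNReal.orderIsoRpow (1 / p) h1).liminf_apply
  rw [← e2]
  refine ENNReal.rpow_le_rpow ?_ h1.le
  simp_rw [e1]
  exact lintegral_liminf_le fun i => (hF i).pow_const p

theorem nrm_le_of_le_liminf (hp : 0 < p) {ι : Type*} {u : Filter ι} [u.IsCountablyGenerated]
    [u.NeBot] {F : ι → α → ℝ≥0∞} (hF : ∀ i, Measurable (F i)) {G : α → ℝ≥0∞}
    (hG : ∀ᵐ x ∂μ, G x ≤ liminf (fun i => F i x) u) {c : ℝ≥0∞} (hc : ∀ i, nrm p μ (F i) ≤ c) :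
    nrm p μ G ≤ c :=
  (nrm_mono_ae hp hG).trans <| (nrm_liminf_le hp hF).trans <|
    (liminf_le_liminf (.of_forall hc)).trans_eq (liminf_const c)

theorem nrm_tsum_le (hp : 1 ≤ p) {ι : Type*} [Countable ι] {F : ι → α → ℝ≥0∞}
    (hF : ∀ i, Measurable (F i)) :
    nrm p μ (fun x => ∑' i, F i x) ≤ ∑' i, nrm p μ (F i) := by
  refine nrm_le_of_le_liminf (zero_lt_one.trans_le hp) (u := (atTop : Filter (Finset ι)))
    (F := fun s x => ∑ i ∈ s, F i x) (fun s => Finset.measurable_fun_sum s fun i _ => hF i) ?_ ?_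
  · exact .of_forall fun x => (ENNReal.summable.hasSum (f := fun i => F i x)).liminf_eq.ge
  · exact fun s => (nrm_sum_le hp s fun i => (hF i).aemeasurable).trans (ENNReal.sum_le_tsum s)

theorem nrm_holder (h : p.HolderConjugate p') {F G : α → ℝ≥0∞} (hF : AEMeasurable F μ)
    (hG : AEMeasurable G μ) : ∫⁻ x, F x * G x ∂μ ≤ nrm p μ F * nrm p' μ G :=
  ENNReal.lintegral_mul_le_Lp_mul_Lq μ h hF hG

theorem ae_eq_zero_of_nrm_eq_zero (hp : 0 < p) {F : α → ℝ≥0∞} (hF : Measurable F)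
    (h : nrm p μ F = 0) : ∀ᵐ x ∂μ, F x = 0 := by
  rw [nrm, ENNReal.rpow_eq_zero_iff_of_pos (by positivity),
    lintegral_eq_zero_iff (hF.pow_const p)] at h
  filter_upwards [h] with x hx
  exact (ENNReal.rpow_eq_zero_iff_of_pos hp).1 hx

theorem ae_lt_top_of_nrm_ne_top (hp : 0 < p) {F : α → ℝ≥0∞} (hF : Measurable F)
    (h : nrm p μ F ≠ ∞) : ∀ᵐ x ∂μ, F x < ∞ := by
  have h2 : ∫⁻ x, F x ^ p ∂μ ≠ ∞ := by
    rw [← nrm_rpow hp]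
    exact ENNReal.rpow_ne_top_of_nonneg hp.le h
  filter_upwards [ae_lt_top (hF.pow_const p) h2] with x hx
  by_contra hx'
  rw [not_lt, top_le_iff] at hx'
  simp [hx', hp] at hx

theorem eLpNorm_eq_nrm (hp : 0 < p) {E : Type*} [NormedAddCommGroup E] (f : α → E) :
    eLpNorm f (ENNReal.ofReal p) μ = nrm p μ (fun x => ‖f x‖ₑ) := by
  rw [eLpNorm_eq_lintegral_rpow_enorm_toReal (by simpa using hp) ENNReal.ofReal_ne_top,
    ENNReal.toReal_ofReal hp.le, nrm]

end Nrm

/-! ### The `ℓ_q` norm -/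

section Lq

variable {q q' : ℝ}

/-- The `ℓ_q` norm of a sequence in `[0,∞]`. -/
noncomputable abbrev lq (q : ℝ) (a : ℕ → ℝ≥0∞) : ℝ≥0∞ := nrm q Measure.count a

theorem lq_eq (q : ℝ) (a : ℕ → ℝ≥0∞) : lq q a = (∑' j, a j ^ q) ^ (1 / q) := by
  rw [lq, nrm, lintegral_count]

theorem lq_mono (hq : 0 < q) {a b : ℕ → ℝ≥0∞} (h : ∀ j, a j ≤ b j) : lq q a ≤ lq q b :=
  nrm_mono hq h

theorem lq_add_le (hq : 1 ≤ q) (a b : ℕ → ℝ≥0∞) : lq q (fun j => a j + b j) ≤ lq q a + lq q b :=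
  nrm_add_le hq .of_discrete .of_discrete

theorem lq_const_mul (hq : 0 < q) (c : ℝ≥0∞) (a : ℕ → ℝ≥0∞) :
    lq q (fun j => c * a j) = c * lq q a :=
  nrm_const_mul hq c .of_discrete

theorem lq_mul_const (hq : 0 < q) (c : ℝ≥0∞) (a : ℕ → ℝ≥0∞) :
    lq q (fun j => a j * c) = lq q a * c := by
  simp_rw [mul_comm _ c]
  exact lq_const_mul hq c a

theorem lq_rpow (hq : 0 < q) (a : ℕ → ℝ≥0∞) : lq q a ^ q = ∑' j, a j ^ q := by
  rw [lq, nrm_rpow hq, lintegral_count]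

theorem le_lq (hq : 0 < q) (a : ℕ → ℝ≥0∞) (j : ℕ) : a j ≤ lq q a := by
  rw [← ENNReal.rpow_le_rpow_iff hq, lq_rpow hq]
  exact ENNReal.le_tsum j

theorem lq_single (hq : 0 < q) (a : ℕ → ℝ≥0∞) (j : ℕ) (h : ∀ k, k ≠ j → a k = 0) :
    lq q a = a j := by
  rw [lq_eq, tsum_eq_single j fun k hk => by rw [h k hk, ENNReal.zero_rpow_of_pos hq],
    ← ENNReal.rpow_mul, mul_one_div_cancel hq.ne', ENNReal.rpow_one]

theorem measurable_lq {β : Type*} [MeasurableSpace β] {F : ℕ → β → ℝ≥0∞}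
    (hF : ∀ j, Measurable (F j)) : Measurable fun x => lq q (fun j => F j x) := by
  simp_rw [lq_eq]
  exact (Measurable.tsum fun j => (hF j).pow_const q).pow_const _

theorem sum_mul_le_lq (h : q.HolderConjugate q') (a b : ℕ → ℝ≥0∞) :
    ∑' j, a j * b j ≤ lq q a * lq q' b := by
  rw [← lintegral_count]
  exact nrm_holder h .of_discrete .of_discrete

/-- The truncation of a sequence to the indices `j < N`. -/
def trunc {X : Type*} [Zero X] (N : ℕ) (a : ℕ → X) (j : ℕ) : X := if j < N then a j else 0

theorem trunc_of_lt {X : Type*} [Zero X] {N j : ℕ} (h : j < N) (a : ℕ → X) :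
    trunc N a j = a j := if_pos h

theorem trunc_of_le {X : Type*} [Zero X] {N j : ℕ} (h : N ≤ j) (a : ℕ → X) :
    trunc N a j = 0 := if_neg (not_lt.2 h)

theorem trunc_le (N : ℕ) (a : ℕ → ℝ≥0∞) (j : ℕ) : trunc N a j ≤ a j := by
  unfold trunc; split_ifs <;> simp

theorem lq_trunc_rpow (hq : 0 < q) (N : ℕ) (a : ℕ → ℝ≥0∞) :
    lq q (trunc N a) ^ q = ∑ j ∈ Finset.range N, a j ^ q := by
  rw [lq_rpow hq, tsum_eq_sum (s := Finset.range N)]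
  · exact Finset.sum_congr rfl fun j hj => by rw [trunc_of_lt (Finset.mem_range.1 hj)]
  · intro j hj
    rw [trunc_of_le (by simpa using hj), ENNReal.zero_rpow_of_pos hq]

theorem lq_trunc_eq (hq : 0 < q) (N : ℕ) (a : ℕ → ℝ≥0∞) :
    lq q (trunc N a) = (∑ j ∈ Finset.range N, a j ^ q) ^ (1 / q) := by
  rw [← lq_trunc_rpow hq, ← ENNReal.rpow_mul, mul_one_div_cancel hq.ne', ENNReal.rpow_one]

theorem lq_le_of_trunc (hq : 0 < q) {a : ℕ → ℝ≥0∞} {c : ℝ≥0∞}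
    (h : ∀ N, lq q (trunc N a) ≤ c) : lq q a ≤ c := by
  rw [← ENNReal.rpow_le_rpow_iff hq, lq_rpow hq, ENNReal.tsum_eq_iSup_nat]
  refine iSup_le fun N => ?_
  rw [← lq_trunc_rpow hq]
  exact ENNReal.rpow_le_rpow (h N) hq.le

theorem lq_le_iSup_trunc (hq : 0 < q) (a : ℕ → ℝ≥0∞) :
    lq q a ≤ liminf (fun N => lq q (trunc N a)) atTop := by
  have hmono : Monotone fun N => lq q (trunc N a) := fun M N h => lq_mono hq fun j => by
    unfold trunc
    split_ifs with h1 h2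
    · rfl
    · exact absurd (h1.trans_le h) h2
    · simp
    · rfl
  rw [(tendsto_atTop_iSup hmono).liminf_eq]
  exact lq_le_of_trunc hq fun N => le_iSup (fun N => lq q (trunc N a)) N

theorem lq_trunc_le_sum (hq : 1 ≤ q) (N : ℕ) (a : ℕ → ℝ≥0∞) :
    lq q (trunc N a) ≤ ∑ j ∈ Finset.range N, a j := by
  have hq0 : 0 < q := zero_lt_one.trans_le hq
  have := nrm_sum_le (μ := (Measure.count : Measure ℕ)) hq (Finset.range N)
    (F := fun i j => if j = i then a i else 0) fun i => .of_discrete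
  calc lq q (trunc N a)
      = nrm q Measure.count (fun j => ∑ i ∈ Finset.range N, if j = i then a i else 0) := by
        congr 1
        funext j
        rw [Finset.sum_ite_eq]
        simp [trunc]
    _ ≤ _ := this
    _ = _ := Finset.sum_congr rfl fun i _ => by
        rw [show nrm q Measure.count (fun j : ℕ => if j = i then a i else 0) =
          lq q (fun j => if j = i then a i else 0) from rfl, lq_single hq0 _ i]
        · simp
        · intro k hk
          simp [hk]

/-- Minkowski's integral inequality for the `ℓ_q` norm. -/
theorem lq_lintegral_le (h : q.HolderConjugate q') {β : Type*} [MeasurableSpace β] {μ : Measure β}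
    {F : ℕ → β → ℝ≥0∞} (hF : ∀ j, Measurable (F j)) :
    lq q (fun j => ∫⁻ x, F j x ∂μ) ≤ ∫⁻ x, lq q (fun j => F j x) ∂μ := by
  have hq0 : 0 < q := h.pos
  set a : ℕ → ℝ≥0∞ := fun j => ∫⁻ x, F j x ∂μ with ha
  set I := ∫⁻ x, lq q (fun j => F j x) ∂μ with hI
  have haI : ∀ j, a j ≤ I := fun j => lintegral_mono fun x => le_lq hq0 (fun j => F j x) j
  rcases eq_or_ne I ∞ with htop | htop
  · rw [htop]; exact le_top
  refine lq_le_of_trunc hq0 fun N => ?_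
  set A := lq q (trunc N a) with hA
  have hAtop : A ≠ ∞ := by
    refine ((lq_trunc_le_sum h.lt.le N a).trans_lt ?_).ne
    exact ENNReal.sum_lt_top.2 fun j _ => (haI j).trans_lt (lt_top_iff_ne_top.2 htop)
  rcases eq_or_ne A 0 with h0 | h0
  · rw [h0]; exact zero_le
  -- test the sequence `a` with `a^(q-1)`
  have key : A ^ q ≤ A ^ (q - 1) * I := by
    calc A ^ q = ∑ j ∈ Finset.range N, a j ^ (q - 1) * a j := by
          rw [hA, lq_trunc_rpow hq0]
          refine Finset.sum_congr rfl fun j _ => ?_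
          conv_lhs => rw [show q = (q - 1) + 1 by ring]
          rw [ENNReal.rpow_add_of_nonneg _ _ h.sub_one_pos.le zero_le_one, ENNReal.rpow_one]
      _ = ∫⁻ x, ∑ j ∈ Finset.range N, a j ^ (q - 1) * F j x ∂μ := by
          rw [lintegral_finsetSum _ fun j _ => (hF j).const_mul _]
          exact Finset.sum_congr rfl fun j _ => (lintegral_const_mul _ (hF j)).symm
      _ ≤ ∫⁻ x, A ^ (q - 1) * lq q (fun j => F j x) ∂μ := by
          refine lintegral_mono fun x => ?_
          refine (ENNReal.inner_le_Lp_mul_Lq (Finset.range N) (fun j => a j ^ (q - 1))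
            (fun j => F j x) h.symm).trans ?_
          gcongr
          · apply le_of_eq
            simp_rw [← ENNReal.rpow_mul]
            rw [h.sub_one_mul_conj, hA, lq_trunc_eq hq0, ← ENNReal.rpow_mul]
            congr 1
            have := h.sub_one_mul_conj
            have := h.symm.pos
            field_simp
            linarith
          · rw [← lq_trunc_eq hq0]
            exact lq_mono hq0 (trunc_le N _)
      _ = A ^ (q - 1) * I := lintegral_const_mul _ (measurable_lq hF)
  have hpos : A ^ (q - 1) ≠ 0 := by
    simp [ENNReal.rpow_eq_zero_iff, h0, hAtop]
  have hfin : A ^ (q - 1) ≠ ∞ := ENNReal.rpow_ne_top_of_nonneg h.sub_one_pos.le hAtop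
  have e : A ^ q = A ^ (q - 1) * A := by
    conv_lhs => rw [show q = (q - 1) + 1 by ring]
    rw [ENNReal.rpow_add_of_nonneg _ _ h.sub_one_pos.le zero_le_one, ENNReal.rpow_one]
  rw [e] at key
  exact (ENNReal.mul_le_mul_iff_right hpos hfin).1 key

end Lq

end

section

/-! ### Bounded linear functionals on `L_p` -/

section Riesz

variable {α : Type*} [MeasurableSpace α] {μ : Measure α} {p p' : ℝ}

theorem tendsto_nrm_of_dominated (hp : 0 < p) {F : ℕ → α → ℝ≥0∞} {G : α → ℝ≥0∞}
    (hF : ∀ k, Measurable (F k)) (hG : nrm p μ G ≠ ∞) (hle : ∀ k, ∀ᵐ x ∂μ, F k x ≤ G x)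
    (hlim : ∀ᵐ x ∂μ, Tendsto (fun k => F k x) atTop (𝓝 0)) :
    Tendsto (fun k => nrm p μ (F k)) atTop (𝓝 0) := by
  have h1 : Tendsto (fun k => ∫⁻ x, F k x ^ p ∂μ) atTop (𝓝 (∫⁻ _, 0 ∂μ)) := by
    refine tendsto_lintegral_of_dominated_convergence (fun x => G x ^ p)
      (fun k => (hF k).pow_const p) (fun k => ?_) ?_ ?_
    · filter_upwards [hle k] with x hx using ENNReal.rpow_le_rpow hx hp.le
    · rw [← nrm_rpow hp]
      exact ENNReal.rpow_ne_top_of_nonneg hp.le hG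
    · filter_upwards [hlim] with x hx
      have := (ENNReal.continuous_rpow_const (y := p)).continuousAt.tendsto.comp hx
      simpa [Function.comp_def, ENNReal.zero_rpow_of_pos hp] using this
  have h2 := (ENNReal.continuous_rpow_const (y := 1 / p)).continuousAt.tendsto.comp h1
  simpa [Function.comp_def, nrm, hp] using h2

/-- A bounded linear functional on `L_p(μ)`, given on measurable functions. -/
structure IsLpFunctional (p : ℝ) (μ : Measure α) (C : ℝ≥0∞) (Λ : (α → ℂ) → ℂ) : Prop where
  add : ∀ f g, Measurable f → Measurable g → nrm p μ (fun x => ‖f x‖ₑ) < ∞ →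
    nrm p μ (fun x => ‖g x‖ₑ) < ∞ → Λ (fun x => f x + g x) = Λ f + Λ g
  smul : ∀ f (c : ℂ), Measurable f → nrm p μ (fun x => ‖f x‖ₑ) < ∞ →
    Λ (fun x => c * f x) = c * Λ f
  le : ∀ f, Measurable f → nrm p μ (fun x => ‖f x‖ₑ) < ∞ →
    ‖Λ f‖ₑ ≤ C * nrm p μ (fun x => ‖f x‖ₑ)
  ne_top : C ≠ ∞

namespace IsLpFunctional

variable {C : ℝ≥0∞} {Λ : (α → ℂ) → ℂ}

theorem sub (h : IsLpFunctional p μ C Λ) {f g : α → ℂ} (hf : Measurable f)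
    (hg : Measurable g) (hfp : nrm p μ (fun x => ‖f x‖ₑ) < ∞)
    (hgp : nrm p μ (fun x => ‖g x‖ₑ) < ∞) : Λ (fun x => f x - g x) = Λ f - Λ g := by
  have h1 := h.smul g (-1) hg hgp
  have h2 := h.add f (fun x => -1 * g x) hf (hg.const_mul _) hfp (by simpa using hgp)
  rw [h1] at h2
  rw [sub_eq_add_neg, ← neg_one_mul, ← h2]
  congr 1
  funext x
  ring

theorem tendsto (h : IsLpFunctional p μ C Λ) (hp : 1 ≤ p) {f : ℕ → α → ℂ} {g : α → ℂ}
    {G : α → ℝ≥0∞} (hf : ∀ k, Measurable (f k)) (hg : Measurable g) (hGm : Measurable G)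
    (hG : nrm p μ G ≠ ∞) (hfG : ∀ k x, ‖f k x‖ₑ ≤ G x) (hgG : ∀ x, ‖g x‖ₑ ≤ G x)
    (hlim : ∀ x, Tendsto (fun k => f k x) atTop (𝓝 (g x))) :
    Tendsto (fun k => Λ (f k)) atTop (𝓝 (Λ g)) := by
  have hp0 : 0 < p := zero_lt_one.trans_le hp
  have hfp : ∀ k, nrm p μ (fun x => ‖f k x‖ₑ) < ∞ := fun k =>
    (nrm_mono hp0 (hfG k)).trans_lt hG.lt_top
  have hgp : nrm p μ (fun x => ‖g x‖ₑ) < ∞ := (nrm_mono hp0 hgG).trans_lt hG.lt_top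
  have hdle : ∀ k x, ‖f k x - g x‖ₑ ≤ 2 * G x := fun k x => by
    rw [two_mul]
    exact enorm_sub_le.trans (add_le_add (hfG k x) (hgG x))
  have h2G : nrm p μ (fun x => 2 * G x) ≠ ∞ := by
    rw [nrm_const_mul hp0 _ hGm]
    finiteness
  have h0 : Tendsto (fun k => C * nrm p μ (fun x => ‖f k x - g x‖ₑ)) atTop (𝓝 (C * 0)) := by
    refine ENNReal.Tendsto.const_mul (tendsto_nrm_of_dominated hp0
      (fun k => ((hf k).sub hg).enorm) h2G (fun k => .of_forall (hdle k)) (.of_forall fun x => ?_))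
      (Or.inr h.ne_top)
    have := ((hlim x).sub (tendsto_const_nhds (x := g x))).enorm
    simpa using this
  rw [mul_zero] at h0
  rw [tendsto_iff_edist_tendsto_0]
  refine tendsto_of_tendsto_of_tendsto_of_le_of_le tendsto_const_nhds h0 (fun _ => zero_le)
    fun k => ?_
  rw [edist_eq_enorm_sub, ← h.sub (hf k) hg (hfp k) hgp]
  exact h.le _ ((hf k).sub hg) ((nrm_mono hp0 (hdle k)).trans_lt h2G.lt_top)

/-- The value of the functional at `1_E v`. -/
theorem sum_indicator (h : IsLpFunctional p μ C Λ) (hp : 1 ≤ p) {v : α → ℂ} (hv : Measurable v)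
    (hvp : nrm p μ (fun x => ‖v x‖ₑ) < ∞) {f : ℕ → Set α} (hf : ∀ i, MeasurableSet (f i))
    (hd : Pairwise (Function.onFun Disjoint f)) (s : Finset ℕ) :
    ∑ i ∈ s, Λ ((f i).indicator v) = Λ ((⋃ i ∈ s, f i).indicator v) := by
  classical
  have hp0 : 0 < p := zero_lt_one.trans_le hp
  have hfin : ∀ E : Set α, nrm p μ (fun x => ‖E.indicator v x‖ₑ) < ∞ := fun E =>
    (nrm_mono hp0 fun x => by by_cases hx : x ∈ E <;> simp [hx]).trans_lt hvp
  induction s using Finset.induction_on with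
  | empty =>
    have := h.smul v 0 hv hvp
    simp only [zero_mul] at this
    simp only [Finset.sum_empty, Finset.notMem_empty, iUnion_of_empty, iUnion_empty,
      indicator_empty]
    exact this.symm
  | insert a s ha ih =>
    rw [Finset.sum_insert ha, ih, Finset.set_biUnion_insert]
    have hdisj : Disjoint (f a) (⋃ i ∈ s, f i) := by
      simp only [disjoint_iUnion_right]
      exact fun i hi => hd fun hai => ha (hai ▸ hi)
    rw [indicator_union_of_disjoint hdisj]
    exact (h.add _ _ (hv.indicator (hf a)) (hv.indicator (Finset.measurableSet_biUnion s
      fun i _ => hf i)) (hfin _) (hfin _)).symm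

/-- The complex measure `E ↦ Λ(1_E v)`. -/
theorem exists_complexMeasure (h : IsLpFunctional p μ C Λ) (hp : 1 ≤ p) {v : α → ℂ}
    (hv : Measurable v) (hvp : nrm p μ (fun x => ‖v x‖ₑ) < ∞) :
    ∃ m : ComplexMeasure α, ∀ E, MeasurableSet E → m E = Λ (E.indicator v) := by
  classical
  have hp0 : 0 < p := zero_lt_one.trans_le hp
  have hfin : ∀ E : Set α, nrm p μ (fun x => ‖E.indicator v x‖ₑ) < ∞ := fun E =>
    (nrm_mono hp0 fun x => by by_cases hx : x ∈ E <;> simp [hx]).trans_lt hvp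
  have h0 : Λ (fun _ => 0) = 0 := by
    have := h.smul v 0 hv hvp
    simpa only [zero_mul] using this
  refine ⟨⟨fun E => if MeasurableSet E then Λ (E.indicator v) else 0, ?_, fun E hE => if_neg hE,
    fun f hf hd => ?_⟩, fun E hE => if_pos hE⟩
  · simp only [MeasurableSet.empty, if_true, indicator_empty]
    exact h0
  · simp only [hf, MeasurableSet.iUnion hf, if_true]
    -- the values on finite unions converge since `|v|^p` is integrable
    have htend : Tendsto (fun s : Finset ℕ => C * nrm p μ (fun x =>
        ‖((⋃ i, f i) \ ⋃ i ∈ s, f i).indicator v x‖ₑ)) atTop (𝓝 (C * 0)) := by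
      refine ENNReal.Tendsto.const_mul ?_ (Or.inr h.ne_top)
      set ν := μ.withDensity fun x => ‖v x‖ₑ ^ p with hν
      have hνE : ∀ E, MeasurableSet E → nrm p μ (fun x => ‖E.indicator v x‖ₑ) =
          ν E ^ (1 / p) := fun E hE => by
        rw [nrm, hν, withDensity_apply _ hE, ← lintegral_indicator hE]
        congr 2
        funext x
        by_cases hx : x ∈ E <;> simp [hx, hp0]
      have hνU : ν (⋃ i, f i) ≠ ∞ := by
        rw [hν, withDensity_apply _ (MeasurableSet.iUnion hf)]
        refine ne_top_of_le_ne_top ?_ (setLIntegral_le_lintegral _ _)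
        rw [← nrm_rpow hp0]
        exact ENNReal.rpow_ne_top_of_nonneg hp0.le hvp.ne
      have hsum : ∑' i, ν (f i) ≠ ∞ := by rwa [← measure_iUnion hd hf]
      have ht := ENNReal.tendsto_tsum_compl_atTop_zero hsum
      have ht' := (ENNReal.continuous_rpow_const (y := 1 / p)).continuousAt.tendsto.comp ht
      rw [ENNReal.zero_rpow_of_pos (by positivity)] at ht'
      refine tendsto_of_tendsto_of_tendsto_of_le_of_le tendsto_const_nhds ht'
        (fun _ => zero_le) fun s => ?_
      dsimp only
      rw [hνE _ ((MeasurableSet.iUnion hf).diff (Finset.measurableSet_biUnion s fun i _ => hf i))]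
      refine ENNReal.rpow_le_rpow ?_ (by positivity)
      refine (measure_mono ?_).trans (measure_iUnion_le fun b : {x // x ∉ s} => f b)
      rintro x ⟨hx1, hx2⟩
      obtain ⟨i, hi⟩ := mem_iUnion.1 hx1
      refine mem_iUnion.2 ⟨⟨i, fun his => hx2 (mem_iUnion₂.2 ⟨i, his, hi⟩)⟩, hi⟩
    rw [mul_zero] at htend
    rw [HasSum, SummationFilter.unconditional_filter, tendsto_iff_edist_tendsto_0]
    refine tendsto_of_tendsto_of_tendsto_of_le_of_le tendsto_const_nhds htend
      (fun _ => zero_le) fun s => ?_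
    have hms : MeasurableSet (⋃ i ∈ s, f i) := Finset.measurableSet_biUnion s fun i _ => hf i
    have hmU := MeasurableSet.iUnion hf
    rw [h.sum_indicator hp hv hvp hf hd, edist_comm, edist_eq_enorm_sub,
      ← h.sub (hv.indicator hmU) (hv.indicator hms) (hfin _) (hfin _)]
    have e : (fun x => (⋃ i, f i).indicator v x - (⋃ i ∈ s, f i).indicator v x) =
        ((⋃ i, f i) \ ⋃ i ∈ s, f i).indicator v := by
      funext x
      by_cases h1 : x ∈ ⋃ i ∈ s, f i
      · have h2 : x ∈ ⋃ i, f i := iUnion₂_subset (fun i _ => subset_iUnion f i) h1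
        rw [indicator_of_mem h1, indicator_of_mem h2, indicator_of_notMem (fun h => h.2 h1),
          sub_self]
      · rw [indicator_of_notMem h1, sub_zero]
        by_cases h2 : x ∈ ⋃ i, f i
        · rw [indicator_of_mem h2, indicator_of_mem (mem_sdiff_of_mem h2 h1)]
        · rw [indicator_of_notMem h2, indicator_of_notMem fun h => h2 h.1]
    rw [e]
    exact h.le _ (hv.indicator (hmU.diff hms)) (hfin _)

/-- The Radon–Nikodym density of `E ↦ Λ(1_E v)`. -/
theorem exists_density [SigmaFinite μ] (h : IsLpFunctional p μ C Λ) (hp : 1 ≤ p) {v : α → ℂ}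
    (hv : Measurable v) (hvp : nrm p μ (fun x => ‖v x‖ₑ) < ∞) :
    ∃ k : α → ℂ, Measurable k ∧ Integrable k μ ∧
      ∀ E, MeasurableSet E → Λ (E.indicator v) = ∫ x in E, k x ∂μ := by
  have hp0 : 0 < p := zero_lt_one.trans_le hp
  obtain ⟨m, hm⟩ := h.exists_complexMeasure hp hv hvp
  have hac : ∀ E, μ E = 0 → m E = 0 := fun E hE => by
    by_cases hmE : MeasurableSet E
    · rw [hm E hmE, ← enorm_eq_zero]
      have h0 : nrm p μ (fun x => ‖E.indicator v x‖ₑ) = 0 := by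
        rw [nrm_congr_ae (G := fun _ => 0), nrm_zero hp0]
        have : ∀ᵐ x ∂μ, x ∉ E := measure_eq_zero_iff_ae_notMem.1 hE
        filter_upwards [this] with x hx
        simp [hx]
      have := h.le _ (hv.indicator hmE) (by rw [h0]; exact ENNReal.zero_lt_top)
      rw [h0, mul_zero] at this
      exact le_antisymm this zero_le
    · exact m.not_measurable hmE
  have hre : ComplexMeasure.re m ≪ᵥ μ.toENNRealVectorMeasure := by
    refine VectorMeasure.AbsolutelyContinuous.mk fun E hE h0 => ?_
    rw [Measure.toENNRealVectorMeasure_apply_measurable hE] at h0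
    change (m E).re = 0
    rw [hac E h0]
    rfl
  have him : ComplexMeasure.im m ≪ᵥ μ.toENNRealVectorMeasure := by
    refine VectorMeasure.AbsolutelyContinuous.mk fun E hE h0 => ?_
    rw [Measure.toENNRealVectorMeasure_apply_measurable hE] at h0
    change (m E).im = 0
    rw [hac E h0]
    rfl
  have hre' := SignedMeasure.withDensityᵥ_rnDeriv_eq _ μ hre
  have him' := SignedMeasure.withDensityᵥ_rnDeriv_eq _ μ him
  refine ⟨m.rnDeriv μ, ?_, m.integrable_rnDeriv μ, fun E hE => ?_⟩
  · have e : m.rnDeriv μ = fun x => ((m.re.rnDeriv μ x : ℝ) : ℂ) + (m.im.rnDeriv μ x : ℝ) *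
        Complex.I := by
      funext x
      apply Complex.ext <;> simp [ComplexMeasure.rnDeriv]
    rw [e]
    exact (Complex.measurable_ofReal.comp (SignedMeasure.measurable_rnDeriv _ _)).add
      ((Complex.measurable_ofReal.comp (SignedMeasure.measurable_rnDeriv _ _)).mul_const _)
  · rw [← hm E hE]
    apply Complex.ext
    · have h1 := congrArg (fun s : SignedMeasure α => s E) hre'
      simp only [withDensityᵥ_apply (SignedMeasure.integrable_rnDeriv _ _) hE] at h1
      rw [← RCLike.re_eq_complex_re,
        ← integral_re (m.integrable_rnDeriv μ).integrableOn]
      exact h1.symm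
    · have h1 := congrArg (fun s : SignedMeasure α => s E) him'
      simp only [withDensityᵥ_apply (SignedMeasure.integrable_rnDeriv _ _) hE] at h1
      rw [← RCLike.im_eq_complex_im,
        ← integral_im (m.integrable_rnDeriv μ).integrableOn]
      exact h1.symm

theorem eq_integral_of_bounded (h : IsLpFunctional p μ C Λ) (hp : 1 ≤ p) {v k : α → ℂ}
    (hv : Measurable v) (hvp : nrm p μ (fun x => ‖v x‖ₑ) < ∞) (hk : Integrable k μ)
    (hE : ∀ E, MeasurableSet E → Λ (E.indicator v) = ∫ x in E, k x ∂μ) {φ : α → ℂ}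
    (hφ : Measurable φ) {M : ℝ} (hM : ∀ x, ‖φ x‖ ≤ M) :
    Λ (fun x => φ x * v x) = ∫ x, φ x * k x ∂μ := by
  have hp0 : 0 < p := zero_lt_one.trans_le hp
  have hbd : ∀ (ψ : α → ℂ) (M : ℝ), (∀ x, ‖ψ x‖ ≤ M) →
      nrm p μ (fun x => ‖ψ x * v x‖ₑ) < ∞ := fun ψ M hψ => by
    refine (nrm_mono hp0 (G := fun x => ENNReal.ofReal M * ‖v x‖ₑ) fun x => ?_).trans_lt ?_
    · rw [enorm_mul]
      gcongr
      rw [← ofReal_norm]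
      exact ENNReal.ofReal_le_ofReal (hψ x)
    · rw [nrm_const_mul hp0 _ hv.enorm]
      exact ENNReal.mul_lt_top ENNReal.ofReal_lt_top hvp
  have hsimple : ∀ ψ : SimpleFunc α ℂ, Λ (fun x => ψ x * v x) = ∫ x, ψ x * k x ∂μ := by
    intro ψ
    induction ψ using SimpleFunc.induction with
    | const c hs =>
      rename_i s
      have e1 : (fun x => (SimpleFunc.piecewise s hs (SimpleFunc.const α c)
          (SimpleFunc.const α 0)) x * v x) = fun x => c * s.indicator v x := by
        funext x
        by_cases hx : x ∈ s <;> simp [hx]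
      have e2 : (fun x => (SimpleFunc.piecewise s hs (SimpleFunc.const α c)
          (SimpleFunc.const α 0)) x * k x) = fun x => c * s.indicator k x := by
        funext x
        by_cases hx : x ∈ s <;> simp [hx]
      rw [e1, e2, integral_const_mul, integral_indicator hs, ← hE s hs]
      refine h.smul _ c (hv.indicator hs) (lt_of_le_of_lt (nrm_mono hp0 fun x => ?_) hvp)
      by_cases hx : x ∈ s <;> simp [hx]
    | add hd h1 h2 =>
      rename_i f g
      have hfb : ∀ f : SimpleFunc α ℂ, ∃ M, ∀ x, ‖f x‖ ≤ M := fun f => f.exists_forall_norm_le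
      obtain ⟨Mf, hMf⟩ := hfb f
      obtain ⟨Mg, hMg⟩ := hfb g
      simp only [SimpleFunc.coe_add, Pi.add_apply, add_mul]
      rw [h.add (fun x => f x * v x) (fun x => g x * v x) (f.measurable.mul hv) (g.measurable.mul hv) (hbd _ _ hMf) (hbd _ _ hMg),
        integral_add (hk.bdd_mul f.measurable.aestronglyMeasurable (.of_forall hMf))
          (hk.bdd_mul g.measurable.aestronglyMeasurable (.of_forall hMg)), h1, h2]
  have hφs : StronglyMeasurable φ := hφ.stronglyMeasurable
  set φk : ℕ → SimpleFunc α ℂ := fun j => hφs.approxBounded M j with hφk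
  rcases isEmpty_or_nonempty α with he | ⟨⟨x₀⟩⟩
  · have := h.le _ (hφ.mul hv) (hbd φ M hM)
    have h0 : nrm p μ (fun x => ‖(φ * v) x‖ₑ) = 0 := by
      rw [show (fun x => ‖(φ * v) x‖ₑ) = fun _ => 0 from funext fun x => (he.false x).elim,
        nrm_zero hp0]
    rw [h0, mul_zero, nonpos_iff_eq_zero, enorm_eq_zero] at this
    simp only [integral_of_isEmpty]
    exact this
  have hM0 : 0 ≤ M := (norm_nonneg _).trans (hM x₀)
  have hφkM : ∀ j x, ‖φk j x‖ ≤ M := fun j x => hφs.norm_approxBounded_le hM0 j x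
  have hφklim : ∀ x, Tendsto (fun j => φk j x) atTop (𝓝 (φ x)) := fun x =>
    hφs.tendsto_approxBounded_of_norm_le (hM x)
  have hle : ∀ ψ : α → ℂ, (∀ x, ‖ψ x‖ ≤ M) → ∀ x, ‖ψ x * v x‖ₑ ≤ ENNReal.ofReal M * ‖v x‖ₑ :=
    fun ψ hψ x => by
      rw [enorm_mul]
      gcongr
      rw [← ofReal_norm]
      exact ENNReal.ofReal_le_ofReal (hψ x)
  have hlim1 : Tendsto (fun j => Λ (fun x => φk j x * v x)) atTop
      (𝓝 (Λ (fun x => φ x * v x))) := by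
    refine h.tendsto hp (G := fun x => ENNReal.ofReal M * ‖v x‖ₑ)
      (fun j => (φk j).measurable.mul hv) (hφ.mul hv) (hv.enorm.const_mul _) ?_
      (fun j => hle _ (hφkM j)) (hle _ hM) fun x => (hφklim x).mul_const _
    rw [nrm_const_mul hp0 _ hv.enorm]
    exact (ENNReal.mul_lt_top ENNReal.ofReal_lt_top hvp).ne
  have hlim2 : Tendsto (fun j => ∫ x, φk j x * k x ∂μ) atTop (𝓝 (∫ x, φ x * k x ∂μ)) := by
    refine tendsto_integral_of_dominated_convergence (fun x => M * ‖k x‖)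
      (fun j => (φk j).measurable.aestronglyMeasurable.mul hk.1) (hk.norm.const_mul M)
      (fun j => .of_forall fun x => ?_) (.of_forall fun x => (hφklim x).mul_const _)
    rw [norm_mul]
    gcongr
    exact hφkM j x
  simp_rw [hsimple] at hlim1
  exact tendsto_nhds_unique hlim1 hlim2

/-- The dual of `L_p` is `L_{p'}`: a bounded linear functional on `L_p` is integration against a
function of `L_{p'}`. -/
theorem exists_repr [SigmaFinite μ] (h : IsLpFunctional p μ C Λ) (hpp : p.HolderConjugate p') :
    ∃ g : α → ℂ, Measurable g ∧ nrm p' μ (fun x => ‖g x‖ₑ) ≤ C ∧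
      ∀ f, Measurable f → nrm p μ (fun x => ‖f x‖ₑ) < ∞ → Λ f = ∫ x, f x * g x ∂μ := by
  have hp := hpp.lt.le
  have hp0 : 0 < p := hpp.pos
  have hp'0 : 0 < p' := hpp.symm.pos
  -- a strictly positive function of `L_p`
  obtain ⟨w, hw0, hwm, hw⟩ := exists_pos_lintegral_lt_of_sigmaFinite μ (ε := 1) one_ne_zero
  set v₀ : α → ℝ := fun x => (w x : ℝ) ^ (1 / p) with hv₀
  have hv₀pos : ∀ x, 0 < v₀ x := fun x => Real.rpow_pos_of_pos (NNReal.coe_pos.2 (hw0 x)) _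
  have hv₀m : Measurable v₀ := hwm.coe_nnreal_real.pow_const _
  set v : α → ℂ := fun x => (v₀ x : ℂ) with hv
  have hvm : Measurable v := Complex.measurable_ofReal.comp hv₀m
  have hvn : ∀ x, ‖v x‖ = v₀ x := fun x => by
    rw [hv, Complex.norm_real, Real.norm_of_nonneg (hv₀pos x).le]
  have hv0 : ∀ x, v x ≠ 0 := fun x => by
    rw [← norm_ne_zero_iff, hvn]
    exact (hv₀pos x).ne'
  have hvp : nrm p μ (fun x => ‖v x‖ₑ) < ∞ := by
    refine ENNReal.rpow_lt_top_of_nonneg (by positivity) (ne_of_lt (lt_of_le_of_lt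
      (le_of_eq (lintegral_congr fun x => ?_)) (hw.trans ENNReal.one_lt_top)))
    change ‖v x‖ₑ ^ p = (w x : ℝ≥0∞)
    rw [← ofReal_norm, hvn, ENNReal.ofReal_rpow_of_pos (hv₀pos x), hv₀, ← Real.rpow_mul
      (by positivity), one_div_mul_cancel hp0.ne', Real.rpow_one, ENNReal.ofReal_coe_nnreal]
  obtain ⟨k, hkm, hk, hE⟩ := h.exists_density hp hvm hvp
  set g : α → ℂ := fun x => k x / v x with hg
  have hgm : Measurable g := hkm.div hvm
  -- the formula on functions with `|f| ≤ N v`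
  have hrep : ∀ (f : α → ℂ) (N : ℝ), Measurable f → (∀ x, ‖f x‖ ≤ N * v₀ x) →
      Λ f = ∫ x, f x * g x ∂μ := fun f N hf hN => by
    have h1 := h.eq_integral_of_bounded hp hvm hvp hk hE (φ := fun x => f x / v x)
      (hf.div hvm) (M := N) fun x => by
        rw [norm_div, hvn, div_le_iff₀ (hv₀pos x)]
        exact hN x
    have e1 : (fun x => f x / v x * v x) = f := funext fun x => div_mul_cancel₀ _ (hv0 x)
    have e2 : (fun x => f x / v x * k x) = fun x => f x * g x := funext fun x => by
      rw [hg]; ring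
    rwa [e1, e2] at h1
  clear_value g
  have hle : nrm p' μ (fun x => ‖g x‖ₑ) ≤ C := by
    -- test with `conj(sgn g) |g|^{p'-1}`, truncated to the sets `A N`
    set A : ℕ → Set α := fun N => {x | ‖g x‖ ≤ N ∧ 1 ≤ N * v₀ x} with hA
    have hAm : ∀ N, MeasurableSet (A N) := fun N =>
      (measurableSet_le hgm.norm measurable_const).inter
        (measurableSet_le measurable_const (hv₀m.const_mul _))
    refine nrm_le_of_le_liminf hp'0 (u := atTop) (F := fun N x => (A N).indicator
      (fun x => ‖g x‖ₑ) x) (fun N => hgm.enorm.indicator (hAm N)) (.of_forall fun x => ?_)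
      fun N => ?_
    · have hev : ∀ᶠ N : ℕ in atTop, x ∈ A N := by
        have t1 := tendsto_natCast_atTop_atTop (R := ℝ) |>.eventually_ge_atTop ‖g x‖
        have t2 := tendsto_natCast_atTop_atTop (R := ℝ) |>.eventually_ge_atTop (1 / v₀ x)
        filter_upwards [t1, t2] with N h1 h2
        exact ⟨h1, (div_le_iff₀ (hv₀pos x)).1 h2⟩
      rw [liminf_congr (v := fun _ => ‖g x‖ₑ) (by
        filter_upwards [hev] with N hN
        rw [indicator_of_mem hN]), liminf_const]
    set f : α → ℂ := (A N).indicator fun x =>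
      ((‖g x‖ ^ (p' - 1) : ℝ) : ℂ) * ((starRingEnd ℂ) (g x) / (‖g x‖ : ℝ)) with hf
    have hfm : Measurable f := by
      refine Measurable.indicator ?_ (hAm N)
      exact (Complex.measurable_ofReal.comp (hgm.norm.pow_const _)).mul
        ((Complex.continuous_conj.measurable.comp hgm).div
          (Complex.measurable_ofReal.comp hgm.norm))
    have hfn : ∀ x, ‖f x‖ₑ = (A N).indicator (fun x => ‖g x‖ₑ ^ (p' - 1)) x := fun x => by
      by_cases hx : x ∈ A N
      · rw [hf, indicator_of_mem hx, indicator_of_mem hx]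
        rcases eq_or_ne (g x) 0 with h0 | h0
        · simp [h0, hpp.symm.sub_one_pos]
        · rw [enorm_mul, ← ofReal_norm, ← ofReal_norm, norm_div, Complex.norm_real,
            Complex.norm_real, RCLike.norm_conj, Real.norm_of_nonneg (norm_nonneg (g x)),
            div_self (norm_ne_zero_iff.2 h0), ENNReal.ofReal_one, mul_one,
            Real.norm_of_nonneg (by positivity), ← ENNReal.ofReal_rpow_of_nonneg (norm_nonneg _)
              hpp.symm.sub_one_pos.le, ofReal_norm]
      · rw [hf, indicator_of_notMem hx, indicator_of_notMem hx, enorm_zero]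
    have hfb : ∀ x, ‖f x‖ ≤ ((N : ℝ) ^ (p' - 1) * N) * v₀ x := fun x => by
      by_cases hx : x ∈ A N
      · have h1 : ‖f x‖ ≤ (N : ℝ) ^ (p' - 1) := by
          have h2 := hfn x
          rw [indicator_of_mem hx, ← ofReal_norm, ← ofReal_norm, ENNReal.ofReal_rpow_of_nonneg
            (norm_nonneg _) hpp.symm.sub_one_pos.le, ENNReal.ofReal_eq_ofReal_iff (norm_nonneg _)
            (by positivity)] at h2
          rw [h2]
          exact Real.rpow_le_rpow (norm_nonneg _) hx.1 hpp.symm.sub_one_pos.le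
        calc ‖f x‖ ≤ (N : ℝ) ^ (p' - 1) * 1 := by rwa [mul_one]
          _ ≤ (N : ℝ) ^ (p' - 1) * (N * v₀ x) := by gcongr; exact hx.2
          _ = _ := by ring
      · rw [hf, indicator_of_notMem hx, norm_zero]
        have := (hv₀pos x).le
        positivity
    set X := ∫⁻ x, (A N).indicator (fun x => ‖g x‖ₑ) x ^ p' ∂μ with hX
    have hfX : nrm p μ (fun x => ‖f x‖ₑ) = X ^ (1 / p) := by
      rw [nrm, hX]
      congr 1
      refine lintegral_congr fun x => ?_
      rw [hfn]
      by_cases hx : x ∈ A N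
      · rw [indicator_of_mem hx, indicator_of_mem hx, ← ENNReal.rpow_mul,
          hpp.symm.sub_one_mul_conj]
      · simp [hx, hp0, hp'0]
    have hfp : nrm p μ (fun x => ‖f x‖ₑ) < ∞ := by
      refine (nrm_mono hp0 (G := fun x => ENNReal.ofReal ((N : ℝ) ^ (p' - 1) * N) * ‖v x‖ₑ)
        fun x => ?_).trans_lt ?_
      · rw [← ofReal_norm, ← ofReal_norm, hvn, ← ENNReal.ofReal_mul (by positivity)]
        exact ENNReal.ofReal_le_ofReal (hfb x)
      · rw [nrm_const_mul hp0 _ hvm.enorm]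
        exact ENNReal.mul_lt_top ENNReal.ofReal_lt_top hvp
    have hXtop : X ≠ ∞ := by
      intro hcon
      rw [hfX, hcon, ENNReal.top_rpow_of_pos (by positivity)] at hfp
      exact lt_irrefl _ hfp
    have hfg : ∀ x, f x * g x =
        (((A N).indicator (fun x => ‖g x‖ₑ) x ^ p').toReal : ℂ) := fun x => by
      by_cases hx : x ∈ A N
      · rw [hf, indicator_of_mem hx, indicator_of_mem hx, ← ENNReal.toReal_rpow, toReal_enorm]
        rcases eq_or_ne (g x) 0 with h0 | h0
        · simp [h0, hp'0.ne']
        · have hn0 : (‖g x‖ : ℂ) ≠ 0 := by exact_mod_cast norm_ne_zero_iff.2 h0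
          have e1 : (starRingEnd ℂ) (g x) * g x = (‖g x‖ : ℂ) * ‖g x‖ := by
            rw [mul_comm, Complex.mul_conj, Complex.normSq_eq_norm_sq]
            push_cast; ring
          have e2 : (‖g x‖ ^ p' : ℝ) = ‖g x‖ ^ (p' - 1) * ‖g x‖ := by
            conv_lhs => rw [show p' = (p' - 1) + 1 by ring]
            rw [Real.rpow_add (norm_pos_iff.2 h0), Real.rpow_one]
          rw [e2, Complex.ofReal_mul, mul_assoc, div_mul_eq_mul_div, e1, mul_div_assoc,
            div_self hn0, mul_one]
      · simp [hf, hx, hp'0]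
    have hΛ : ‖Λ f‖ₑ = X := by
      rw [hrep f _ hfm hfb]
      simp_rw [hfg]
      rw [integral_complex_ofReal, integral_toReal, ← ofReal_norm, Complex.norm_real,
        Real.norm_of_nonneg ENNReal.toReal_nonneg, ENNReal.ofReal_toReal hXtop]
      · exact ((hgm.enorm.indicator (hAm N)).pow_const _).aemeasurable
      · refine .of_forall fun x => ENNReal.rpow_lt_top_of_nonneg hp'0.le ?_
        by_cases hx : x ∈ A N <;> simp [hx]
    have hmain := h.le f hfm hfp
    rw [hΛ, hfX] at hmain
    rcases eq_or_ne X 0 with h0 | h0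
    · rw [nrm, ← hX, h0, ENNReal.zero_rpow_of_pos (by positivity)]
      exact zero_le
    · have e : X = X ^ (1 / p') * X ^ (1 / p) := by
        rw [← ENNReal.rpow_add _ _ h0 hXtop, one_div, one_div, hpp.symm.inv_add_inv_eq_one,
          ENNReal.rpow_one]
      have hX1 : X ^ (1 / p) ≠ 0 := by simp [ENNReal.rpow_eq_zero_iff, h0, hXtop]
      have hX2 : X ^ (1 / p) ≠ ∞ := ENNReal.rpow_ne_top_of_nonneg (by positivity) hXtop
      conv_lhs at hmain => rw [e]
      exact (ENNReal.mul_le_mul_iff_left hX1 hX2).1 hmain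
  refine ⟨g, hgm, hle, fun f hfm hfp => ?_⟩
  set B : ℕ → Set α := fun N => {x | ‖f x‖ ≤ N * v₀ x} with hB
  have hBm : ∀ N, MeasurableSet (B N) := fun N =>
    measurableSet_le hfm.norm (hv₀m.const_mul _)
  have hBlim : ∀ x, Tendsto (fun N => (B N).indicator f x) atTop (𝓝 (f x)) := fun x => by
    refine tendsto_const_nhds.congr' ?_
    have t2 := tendsto_natCast_atTop_atTop (R := ℝ) |>.eventually_ge_atTop (‖f x‖ / v₀ x)
    filter_upwards [t2] with N hN
    rw [indicator_of_mem]
    exact (div_le_iff₀ (hv₀pos x)).1 hN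
  have hBle : ∀ N x, ‖(B N).indicator f x‖ ≤ ‖f x‖ := fun N x => norm_indicator_le_norm_self f x
  have hlim1 : Tendsto (fun N => Λ ((B N).indicator f)) atTop (𝓝 (Λ f)) :=
    h.tendsto hp (fun N => hfm.indicator (hBm N)) hfm hfm.enorm hfp.ne
      (fun N x => enorm_le_iff_norm_le.2 (hBle N x)) (fun x => le_rfl) hBlim
  have hfgint : Integrable (fun x => f x * g x) μ := by
    refine ⟨(hfm.mul hgm).aestronglyMeasurable, lt_of_le_of_lt ?_
      (ENNReal.mul_lt_top hfp (hle.trans_lt h.ne_top.lt_top))⟩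
    refine le_trans (le_of_eq (lintegral_congr fun x => enorm_mul _ _)) ?_
    exact nrm_holder hpp hfm.enorm.aemeasurable hgm.enorm.aemeasurable
  have hlim2 : Tendsto (fun N => ∫ x, (B N).indicator f x * g x ∂μ) atTop
      (𝓝 (∫ x, f x * g x ∂μ)) := by
    refine tendsto_integral_of_dominated_convergence (fun x => ‖f x * g x‖)
      (fun N => ((hfm.indicator (hBm N)).mul hgm).aestronglyMeasurable) hfgint.norm
      (fun N => .of_forall fun x => ?_) (.of_forall fun x => (hBlim x).mul_const _)
    rw [norm_mul, norm_mul]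
    gcongr
    exact hBle N x
  refine tendsto_nhds_unique hlim1 (hlim2.congr fun N => ?_)
  refine (hrep _ N (hfm.indicator (hBm N)) fun x => ?_).symm
  by_cases hx : x ∈ B N
  · rw [indicator_of_mem hx]; exact hx
  · rw [indicator_of_notMem hx, norm_zero]
    have := (hv₀pos x).le
    positivity

end IsLpFunctional

end Riesz

end

section

variable {n : ℕ}

/-! ### Powers of two in `[0,∞]` -/

/-- `2^x` in `[0,∞]`. -/
noncomputable abbrev two (x : ℝ) : ℝ≥0∞ := (2 : ℝ≥0∞) ^ x

theorem two_add (x y : ℝ) : two (x + y) = two x * two y :=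
  ENNReal.rpow_add _ _ (by norm_num) (by norm_num)

theorem two_ne_zero' (x : ℝ) : two x ≠ 0 := by
  simp [two, ENNReal.rpow_eq_zero_iff]

theorem two_ne_top (x : ℝ) : two x ≠ ∞ := by
  simp [two, ENNReal.rpow_eq_top_iff]

theorem two_rpow (x y : ℝ) : two x ^ y = two (x * y) := (ENNReal.rpow_mul _ _ _).symm

theorem two_zero : two 0 = 1 := ENNReal.rpow_zero

theorem two_neg_mul_self (x : ℝ) : two (-x) * two x = 1 := by
  rw [← two_add, neg_add_cancel, two_zero]

theorem two_le_one {x : ℝ} (hx : x ≤ 0) : two x ≤ 1 :=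
  (ENNReal.rpow_le_rpow_of_exponent_le (by norm_num) hx).trans_eq ENNReal.rpow_zero

theorem ofReal_two_rpow (x : ℝ) : ENNReal.ofReal ((2 : ℝ) ^ x) = two x := by
  rw [← ENNReal.ofReal_rpow_of_pos (by norm_num)]
  norm_num

theorem ofReal_two_zpow (J : ℤ) : ENNReal.ofReal ((2 : ℝ) ^ J) = two J := by
  rw [← ofReal_two_rpow, Real.rpow_intCast]

theorem two_lt_top (x : ℝ) : two x < ∞ := (two_ne_top x).lt_top

theorem tsum_two_lt_top {a : ℝ} (ha : 0 < a) : ∑' k : ℕ, two (-((k : ℝ) * a)) < ∞ := by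
  have : ∀ k : ℕ, two (-((k : ℝ) * a)) = two (-a) ^ k := fun k => by
    rw [← ENNReal.rpow_natCast, two_rpow]
    congr 1
    ring
  simp_rw [this]
  rw [ENNReal.tsum_geometric, ENNReal.inv_lt_top, tsub_pos_iff_lt]
  exact ENNReal.rpow_lt_one_of_one_lt_of_neg (by norm_num) (by linarith)

/-! ### Dyadic cubes -/

/-- The index set of the dyadic cubes. -/
abbrev Idx (n : ℕ) := ℤ × (Fin n → ℤ)

/-- The dyadic cube with a given index. -/
abbrev Q (i : Idx n) : Set (Rn n) := cube i.1 i.2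

theorem measurableSet_Q (i : Idx n) : MeasurableSet (Q i) := by
  have : Q i = ⋂ k, {x : Rn n | |(2 : ℝ) ^ i.1 * x k - i.2 k| ≤ 1} := by
    ext x; simp [cube]
  rw [this]
  refine MeasurableSet.iInter fun k => (isClosed_le ?_ continuous_const).measurableSet
  fun_prop

/-- The centre of a dyadic cube. -/
noncomputable def ctr (i : Idx n) : Rn n := WithLp.toLp 2 fun k => (2 : ℝ) ^ (-i.1) * i.2 k

/-- The radius of a ball around the centre that contains the dyadic cube. -/
noncomputable def rad (i : Idx n) : ℝ := n * (2 : ℝ) ^ (-i.1)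

theorem norm_le_of_coord_le {x : Rn n} {a : ℝ} (ha : 0 ≤ a) (h : ∀ k, |x k| ≤ a) :
    ‖x‖ ≤ n * a := by
  rw [EuclideanSpace.norm_eq]
  apply Real.sqrt_le_iff.2 ⟨by positivity, ?_⟩
  calc ∑ k, ‖x k‖ ^ 2 ≤ ∑ k : Fin n, a ^ 2 := by
        refine Finset.sum_le_sum fun k _ => ?_
        exact pow_le_pow_left₀ (norm_nonneg _) (h k) 2
    _ = n * a ^ 2 := by simp
    _ ≤ (n * a) ^ 2 := by
        have : (n : ℝ) ≤ n ^ 2 := by exact_mod_cast Nat.le_self_pow (by norm_num) n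
        nlinarith [sq_nonneg a]

theorem abs_coord_le_norm (x : Rn n) (k : Fin n) : |x k| ≤ ‖x‖ := by
  simpa using PiLp.norm_apply_le x k

theorem Q_subset_closedBall (i : Idx n) : Q i ⊆ Metric.closedBall (ctr i) (rad i) := by
  intro x hx
  rw [Metric.mem_closedBall, dist_eq_norm, rad]
  refine norm_le_of_coord_le (by positivity) fun k => ?_
  have h := hx k
  have e : (x - ctr i) k = (2 : ℝ) ^ (-i.1) * ((2 : ℝ) ^ i.1 * x k - i.2 k) := by
    simp only [ctr, PiLp.sub_apply, mul_sub, ← mul_assoc]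
    rw [← zpow_add₀ (by norm_num)]
    simp
  rw [e, abs_mul, abs_of_pos (by positivity)]
  exact mul_le_of_le_one_right (by positivity) h

theorem exists_closedBall_subset_Q (c : Rn n) (J : ℤ) {R : ℝ} (hR : 2 * R ≤ (2 : ℝ) ^ (-J)) :
    ∃ M, Metric.closedBall c R ⊆ Q (J, M) := by
  -- rounding costs at most `1/2` in each coordinate, which leaves `1/2` for the scaled radius
  refine ⟨fun k => round ((2 : ℝ) ^ J * c k), fun x hx k => ?_⟩
  rw [Metric.mem_closedBall, dist_eq_norm] at hx
  have h1 : |x k - c k| ≤ R := (abs_coord_le_norm (x - c) k).trans hx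
  have h2 := abs_sub_round ((2 : ℝ) ^ J * c k)
  have h3 : (2 : ℝ) ^ J * |x k - c k| ≤ 1 / 2 := by
    have : (2 : ℝ) ^ J * (2 * R) ≤ 1 := by
      refine (mul_le_mul_of_nonneg_left hR (by positivity)).trans_eq ?_
      rw [← zpow_add₀ (by norm_num)]; simp
    have := mul_le_mul_of_nonneg_left h1 (by positivity : (0 : ℝ) ≤ (2 : ℝ) ^ J)
    linarith
  have h4 : |(2 : ℝ) ^ J * x k - (2 : ℝ) ^ J * c k| ≤ 1 / 2 := by
    rw [← mul_sub, abs_mul, abs_of_pos (by positivity : (0 : ℝ) < (2 : ℝ) ^ J)]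
    exact h3
  calc |(2 : ℝ) ^ J * x k - round ((2 : ℝ) ^ J * c k)|
      ≤ |(2 : ℝ) ^ J * x k - (2 : ℝ) ^ J * c k| +
        |(2 : ℝ) ^ J * c k - round ((2 : ℝ) ^ J * c k)| := abs_sub_le _ _ _
    _ ≤ 1 := by linarith

/-- The ball with the centre of a dyadic cube and `2^k` times its radius. -/
noncomputable def kball (i : Idx n) (k : ℕ) : Set (Rn n) := Metric.ball (ctr i) (2 ^ k * rad i)

theorem measurableSet_kball (i : Idx n) (k : ℕ) : MeasurableSet (kball i k) :=
  Metric.isOpen_ball.measurableSet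

theorem rad_pos (hn : 0 < n) (i : Idx n) : 0 < rad i := by
  have : (0 : ℝ) < n := by exact_mod_cast hn
  unfold rad; positivity

theorem exists_kball_subset_Q (i : Idx n) (k : ℕ) :
    ∃ M, kball i k ⊆ Q (i.1 - k - (n + 1), M) := by
  obtain ⟨M, hM⟩ := exists_closedBall_subset_Q (ctr i) (i.1 - k - (n + 1)) (R := 2 ^ k * rad i) (by
    have h : (n : ℝ) ≤ 2 ^ n := by exact_mod_cast Nat.lt_two_pow_self.le
    have e : (2 : ℝ) ^ (-(i.1 - k - (n + 1))) = 2 * (2 ^ k * (2 ^ n * 2 ^ (-i.1))) := by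
      rw [show -(i.1 - k - (n + 1)) = 1 + (k + (n + -i.1)) by ring]
      rw [zpow_add₀ (by norm_num), zpow_add₀ (by norm_num), zpow_add₀ (by norm_num)]
      simp
    rw [e, rad]
    gcongr)
  exact ⟨M, Metric.ball_subset_closedBall.trans hM⟩

/-- A dyadic cube of comparable size that contains `kball i k`. -/
noncomputable def enl (i : Idx n) (k : ℕ) : Idx n :=
  (i.1 - k - (n + 1), (exists_kball_subset_Q i k).choose)

theorem kball_subset_enl (i : Idx n) (k : ℕ) : kball i k ⊆ Q (enl i k) :=
  (exists_kball_subset_Q i k).choose_spec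

theorem enl_fst (i : Idx n) (k : ℕ) : ((enl i k).1 : ℝ) = i.1 - k - (n + 1) := by
  simp [enl]

theorem Q_subset_kball (hn : 0 < n) (i : Idx n) {k : ℕ} (hk : 1 ≤ k) : Q i ⊆ kball i k := by
  refine (Q_subset_closedBall i).trans (Metric.closedBall_subset_ball ?_)
  have := rad_pos hn i
  have h2 : (2 : ℝ) ^ 1 ≤ 2 ^ k := pow_le_pow_right₀ (by norm_num) hk
  nlinarith

/-- The volume of the dyadic cubes of level `0` is at most this constant. -/
noncomputable def volC (n : ℕ) : ℝ≥0∞ :=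
  ENNReal.ofReal ((n : ℝ) ^ n) * volume (Metric.ball (0 : Rn n) 1)

theorem volC_ne_top : volC n ≠ ∞ :=
  ENNReal.mul_ne_top ENNReal.ofReal_ne_top measure_ball_lt_top.ne

theorem volume_Q_le (i : Idx n) : volume (Q i) ≤ volC n * two (-(i.1 * n)) := by
  refine (measure_mono (Q_subset_closedBall i)).trans ?_
  rw [Measure.addHaar_closedBall _ _ (by unfold rad; positivity), finrank_euclideanSpace_fin, rad,
    mul_pow, ENNReal.ofReal_mul (by positivity), volC]
  apply le_of_eq
  rw [ENNReal.ofReal_pow (n := n) (by positivity : (0 : ℝ) ≤ 2 ^ (-i.1)), ofReal_two_zpow, ← ENNReal.rpow_natCast, two_rpow]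
  push_cast
  rw [neg_mul]
  ring

theorem volume_Q_lt_top (i : Idx n) : volume (Q i) < ∞ :=
  (volume_Q_le i).trans_lt (ENNReal.mul_lt_top volC_ne_top.lt_top (two_lt_top _))

theorem volume_Q_rpow_le {a : ℝ} (ha : 0 ≤ a) (i : Idx n) :
    volume (Q i) ^ a ≤ volC n ^ a * two (-(i.1 * (n * a))) := by
  refine (ENNReal.rpow_le_rpow (volume_Q_le i) ha).trans_eq ?_
  rw [ENNReal.mul_rpow_of_nonneg _ _ ha, two_rpow]
  congr 2
  ring

theorem exists_ball_subset_Q (R : ℝ) : ∃ i : Idx n, Metric.closedBall 0 R ⊆ Q i := by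
  obtain ⟨m, hm⟩ := pow_unbounded_of_one_lt (2 * R) (one_lt_two : (1 : ℝ) < 2)
  obtain ⟨M, hM⟩ := exists_closedBall_subset_Q (0 : Rn n) (-(m : ℤ)) (R := R) (by simpa using hm.le)
  exact ⟨_, hM⟩

/-! ### The Morrey norm -/

section Morrey

variable {p p' r s : ℝ}

/-- The Morrey norm, written with the exponent `s = n/p + r` of its weight. -/
noncomputable def mn (p s : ℝ) (F : Rn n → ℝ≥0∞) : ℝ≥0∞ :=
  ⨆ i : Idx n, two (i.1 * s) * lpNorm p (Q i) F

theorem lpNorm_eq_nrm (p : ℝ) (M : Set (Rn n)) (F : Rn n → ℝ≥0∞) :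
    lpNorm p M F = nrm p (volume.restrict M) F := rfl

theorem lpNorm_univ (p : ℝ) (F : Rn n → ℝ≥0∞) : lpNorm p univ F = nrm p volume F := by
  rw [lpNorm_eq_nrm, Measure.restrict_univ]

theorem lqNorm_eq_lq (q : ℝ) (f : ℕ → Rn n → ℂ) (x : Rn n) :
    lqNorm q f x = lq q (fun j => ‖f j x‖ₑ) := by
  rw [lq_eq, lqNorm]

theorem morreyNormAux_eq_mn (p r : ℝ) (F : Rn n → ℝ≥0∞) :
    morreyNormAux p r F = mn p (n / p + r) F := by
  unfold morreyNormAux mn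
  rw [iSup_comm, iSup_prod]
  simp_rw [ofReal_two_rpow]

theorem mn_mono_ae (hp : 0 < p) {F G : Rn n → ℝ≥0∞} (h : F ≤ᵐ[volume] G) :
    mn p s F ≤ mn p s G :=
  iSup_mono fun _ => mul_le_mul_right (nrm_mono_ae hp (ae_restrict_of_ae h)) _

theorem mn_mono (hp : 0 < p) {F G : Rn n → ℝ≥0∞} (h : ∀ x, F x ≤ G x) :
    mn p s F ≤ mn p s G :=
  mn_mono_ae hp (.of_forall h)

theorem mn_congr_ae (hp : 0 < p) {F G : Rn n → ℝ≥0∞} (h : F =ᵐ[volume] G) :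
    mn p s F = mn p s G :=
  le_antisymm (mn_mono_ae hp h.le) (mn_mono_ae hp h.symm.le)

theorem mn_add_le (hp : 1 ≤ p) {F G : Rn n → ℝ≥0∞} (hF : Measurable F) (hG : Measurable G) :
    mn p s (fun x => F x + G x) ≤ mn p s F + mn p s G := by
  refine iSup_le fun i => ?_
  refine (mul_le_mul_right (nrm_add_le hp hF.aemeasurable hG.aemeasurable) _).trans ?_
  rw [mul_add]
  gcongr
  · exact le_iSup (fun i : Idx n => two (i.1 * s) * lpNorm p (Q i) F) i
  · exact le_iSup (fun i : Idx n => two (i.1 * s) * lpNorm p (Q i) G) i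

theorem mn_sum_le (hp : 1 ≤ p) {ι : Type*} (t : Finset ι) {F : ι → Rn n → ℝ≥0∞}
    (hF : ∀ i, Measurable (F i)) :
    mn p s (fun x => ∑ i ∈ t, F i x) ≤ ∑ i ∈ t, mn p s (F i) := by
  refine iSup_le fun i => ?_
  refine (mul_le_mul_right (nrm_sum_le hp t fun i => (hF i).aemeasurable) _).trans ?_
  rw [Finset.mul_sum]
  gcongr with j
  exact le_iSup (fun i : Idx n => two (i.1 * s) * lpNorm p (Q i) (F j)) i

theorem mn_const_mul (hp : 0 < p) (c : ℝ≥0∞) {F : Rn n → ℝ≥0∞} (hF : Measurable F) :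
    mn p s (fun x => c * F x) = c * mn p s F := by
  unfold mn
  rw [ENNReal.mul_iSup]
  refine iSup_congr fun i => ?_
  rw [lpNorm_eq_nrm, nrm_const_mul hp c hF, lpNorm_eq_nrm]
  ring

theorem lpNorm_Q_le_mn (i : Idx n) (F : Rn n → ℝ≥0∞) :
    lpNorm p (Q i) F ≤ two (-(i.1 * s)) * mn p s F := by
  have h := le_iSup (fun i : Idx n => two (i.1 * s) * lpNorm p (Q i) F) i
  calc lpNorm p (Q i) F = two (-(i.1 * s)) * (two (i.1 * s) * lpNorm p (Q i) F) := by
        rw [← mul_assoc, two_neg_mul_self, one_mul]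
    _ ≤ _ := mul_le_mul_right h _

theorem mn_le_iff {F : Rn n → ℝ≥0∞} {c : ℝ≥0∞} :
    mn p s F ≤ c ↔ ∀ i : Idx n, two (i.1 * s) * lpNorm p (Q i) F ≤ c := iSup_le_iff

theorem mn_le_of_le_liminf (hp : 0 < p) {F : ℕ → Rn n → ℝ≥0∞} (hF : ∀ k, Measurable (F k))
    {G : Rn n → ℝ≥0∞} (hG : ∀ᵐ x, G x ≤ liminf (fun k => F k x) atTop) {c : ℝ≥0∞}
    (hc : ∀ k, mn p s (F k) ≤ c) : mn p s G ≤ c := by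
  rw [mn_le_iff]
  intro i
  have h : lpNorm p (Q i) G ≤ two (-(i.1 * s)) * c :=
    nrm_le_of_le_liminf hp hF (ae_restrict_of_ae hG) fun k =>
      (lpNorm_Q_le_mn (s := s) i (F k)).trans (mul_le_mul_right (hc k) _)
  calc _ ≤ two (i.1 * s) * (two (-(i.1 * s)) * c) := mul_le_mul_right h _
    _ = c := by rw [← mul_assoc, mul_comm (two _) (two _), two_neg_mul_self, one_mul]

/-- `L_p ∩ L_∞` embeds into the Morrey space. -/
theorem mn_le_of_bdd (hp : 1 ≤ p) (hs : 0 ≤ s) (hsn : s ≤ n / p) {F : Rn n → ℝ≥0∞} {M : ℝ≥0∞}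
    (hM : ∀ x, F x ≤ M) :
    mn p s F ≤ M * volC n ^ (1 / p) + nrm p volume F := by
  have hp0 : 0 < p := zero_lt_one.trans_le hp
  rw [mn_le_iff]
  intro i
  -- small cubes use the uniform bound and `s ≤ n/p`, large cubes the `L_p` norm and `0 ≤ s`
  rcases le_total 0 i.1 with hi | hi
  · refine le_add_right ?_
    have h1 : lpNorm p (Q i) F ≤ M * (volC n ^ (1 / p) * two (-(i.1 * (n * (1 / p))))) := by
      refine (nrm_mono hp0 hM).trans ?_
      rw [nrm_const hp0, Measure.restrict_apply_univ]
      gcongr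
      exact volume_Q_rpow_le (by positivity) i
    refine (mul_le_mul_right h1 _).trans ?_
    have h2 : two (i.1 * s) * two (-(i.1 * (n * (1 / p)))) ≤ 1 := by
      rw [← two_add]
      apply two_le_one
      have : (0 : ℝ) ≤ i.1 := by exact_mod_cast hi
      have : (n : ℝ) * (1 / p) = n / p := by ring
      nlinarith
    calc _ = (two (i.1 * s) * two (-(i.1 * (n * (1 / p))))) * (M * volC n ^ (1 / p)) := by ring
      _ ≤ _ := mul_le_of_le_one_left' h2
  · refine le_add_left ?_
    refine (mul_le_of_le_one_left' (two_le_one ?_)).trans ?_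
    · have : (i.1 : ℝ) ≤ 0 := by exact_mod_cast hi
      nlinarith
    · exact nrm_mono_measure hp0 Measure.restrict_le_self F

end Morrey

/-! ### The predual norm as a norm on functions with values in `[0,∞]` -/

section Predual

variable {p p' r s : ℝ}

/-- The predual norm of a function `F` with values in `[0,∞]`, with `s = n/p + r = -(n/p' + ϱ)`: the
infimum of `∑_Q 2^{-Js} ‖u_Q | L_{p'}(Q)‖` over all families with `F ≤ ∑_Q u_Q` a.e., where `u_Q` is
restricted to the cube `Q`. -/
noncomputable def pn (p' s : ℝ) (F : Rn n → ℝ≥0∞) : ℝ≥0∞ :=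
  ⨅ (u : Idx n → Rn n → ℝ≥0∞) (_ : ∀ i, Measurable (u i))
    (_ : ∀ᵐ x, F x ≤ ∑' i, (Q i).indicator (u i) x),
    ∑' i, two (-(i.1 * s)) * lpNorm p' (Q i) (u i)

theorem pn_le {F : Rn n → ℝ≥0∞} (u : Idx n → Rn n → ℝ≥0∞) (hu : ∀ i, Measurable (u i))
    (h : ∀ᵐ x, F x ≤ ∑' i, (Q i).indicator (u i) x) :
    pn p' s F ≤ ∑' i, two (-(i.1 * s)) * lpNorm p' (Q i) (u i) :=
  iInf_le_of_le u <| iInf_le_of_le hu <| iInf_le_of_le h le_rfl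

theorem le_pn {F : Rn n → ℝ≥0∞} {c : ℝ≥0∞}
    (h : ∀ u : Idx n → Rn n → ℝ≥0∞, (∀ i, Measurable (u i)) →
      (∀ᵐ x, F x ≤ ∑' i, (Q i).indicator (u i) x) →
      c ≤ ∑' i, two (-(i.1 * s)) * lpNorm p' (Q i) (u i)) : c ≤ pn p' s F :=
  le_iInf fun u => le_iInf fun hu => le_iInf fun hF => h u hu hF

theorem exists_of_pn_lt {F : Rn n → ℝ≥0∞} {c : ℝ≥0∞} (h : pn p' s F < c) :
    ∃ u : Idx n → Rn n → ℝ≥0∞, (∀ i, Measurable (u i)) ∧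
      (∀ᵐ x, F x ≤ ∑' i, (Q i).indicator (u i) x) ∧
      ∑' i, two (-(i.1 * s)) * lpNorm p' (Q i) (u i) < c := by
  by_contra! hcon
  exact absurd (le_pn hcon) (not_le.2 h)

theorem pn_mono_ae {F G : Rn n → ℝ≥0∞} (h : F ≤ᵐ[volume] G) : pn p' s F ≤ pn p' s G :=
  le_pn fun u hu hG => pn_le u hu (by filter_upwards [h, hG] with x h1 h2 using h1.trans h2)

theorem pn_mono {F G : Rn n → ℝ≥0∞} (h : ∀ x, F x ≤ G x) : pn p' s F ≤ pn p' s G :=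
  pn_mono_ae (.of_forall h)

theorem pn_congr_ae {F G : Rn n → ℝ≥0∞} (h : F =ᵐ[volume] G) : pn p' s F = pn p' s G :=
  le_antisymm (pn_mono_ae h.le) (pn_mono_ae h.symm.le)

/-- The countable triangle inequality: near-optimal families for the summands are added up. -/
theorem pn_tsum_le (hp : 1 ≤ p') {ι : Type*} [Countable ι] (F : ι → Rn n → ℝ≥0∞) :
    pn p' s (fun x => ∑' k, F k x) ≤ ∑' k, pn p' s (F k) := by
  rcases eq_or_ne (∑' k, pn p' s (F k)) ∞ with htop | htop
  · rw [htop]; exact le_top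
  refine ENNReal.le_of_forall_pos_le_add fun ε hε _ => ?_
  obtain ⟨δ, hδ, hsum⟩ := ENNReal.exists_pos_sum_of_countable' (ENNReal.coe_pos.2 hε).ne' ι
  choose u hu huF hc using fun k => exists_of_pn_lt (p' := p') (s := s) (F := F k)
    (c := pn p' s (F k) + δ k)
    (ENNReal.lt_add_right (ne_top_of_le_ne_top htop (ENNReal.le_tsum k)) (hδ k).ne')
  calc pn p' s (fun x => ∑' k, F k x)
      ≤ ∑' i : Idx n, two (-(i.1 * s)) * lpNorm p' (Q i) (fun x => ∑' k, u k i x) := by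
        refine pn_le _ (fun i => Measurable.tsum fun k => hu k i) ?_
        filter_upwards [ae_all_iff.2 huF] with x hx
        refine (ENNReal.tsum_le_tsum hx).trans_eq ?_
        rw [ENNReal.tsum_comm]
        refine tsum_congr fun i => ?_
        by_cases hxi : x ∈ Q i <;> simp [hxi]
    _ ≤ ∑' i : Idx n, ∑' k, two (-(i.1 * s)) * lpNorm p' (Q i) (u k i) := by
        refine ENNReal.tsum_le_tsum fun i => ?_
        rw [ENNReal.tsum_mul_left]
        exact mul_le_mul_right (nrm_tsum_le hp fun k => hu k i) _
    _ = ∑' k, ∑' i : Idx n, two (-(i.1 * s)) * lpNorm p' (Q i) (u k i) := ENNReal.tsum_comm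
    _ ≤ ∑' k, (pn p' s (F k) + δ k) := ENNReal.tsum_le_tsum fun k => (hc k).le
    _ = ∑' k, pn p' s (F k) + ∑' k, δ k := ENNReal.tsum_add
    _ ≤ _ := by gcongr

theorem pn_add_le (hp : 1 ≤ p') (F G : Rn n → ℝ≥0∞) :
    pn p' s (fun x => F x + G x) ≤ pn p' s F + pn p' s G := by
  have h := pn_tsum_le (s := s) hp (fun b : Bool => if b then F else G)
  simp only [tsum_bool] at h
  simpa [add_comm] using h

theorem pn_const_mul_le (hp : 0 < p') {c : ℝ≥0∞} (hc : c ≠ ∞) (F : Rn n → ℝ≥0∞) :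
    pn p' s (fun x => c * F x) ≤ c * pn p' s F := by
  rcases eq_or_ne c 0 with rfl | h0
  · have h : pn p' s (fun _ : Rn n => (0 : ℝ≥0∞)) ≤ 0 := by
      refine (pn_le (fun _ _ => 0) (fun _ => measurable_const) (by simp)).trans ?_
      simp [lpNorm_eq_nrm, nrm_zero hp]
    simpa using h
  rw [mul_comm, ← ENNReal.div_le_iff h0 hc]
  refine le_pn fun u hu hF => ?_
  rw [ENNReal.div_le_iff h0 hc]
  refine (pn_le (fun i x => c * u i x) (fun i => (hu i).const_mul c) ?_).trans_eq ?_
  · filter_upwards [hF] with x hx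
    refine (mul_le_mul_right hx c).trans_eq ?_
    rw [← ENNReal.tsum_mul_left]
    refine tsum_congr fun i => ?_
    by_cases hxi : x ∈ Q i <;> simp [hxi]
  · rw [← ENNReal.tsum_mul_right]
    refine tsum_congr fun i => ?_
    rw [lpNorm_eq_nrm, nrm_const_mul hp c (hu i), lpNorm_eq_nrm]
    ring

theorem pn_indicator_le (hp : 0 < p') (i : Idx n) {F : Rn n → ℝ≥0∞} (hF : Measurable F) :
    pn p' s ((Q i).indicator F) ≤ two (-(i.1 * s)) * lpNorm p' (Q i) F := by
  classical
  refine (pn_le (fun k => if k = i then F else 0) (fun k => ?_) ?_).trans_eq ?_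
  · split_ifs
    exacts [hF, measurable_const]
  · refine .of_forall fun x => ?_
    refine le_trans ?_ (ENNReal.le_tsum i)
    simp
  · rw [tsum_eq_single i]
    · simp
    · intro k hk
      simp only [hk, if_false]
      rw [lpNorm_eq_nrm, show (0 : Rn n → ℝ≥0∞) = fun _ => 0 from rfl, nrm_zero hp, mul_zero]

/-- The pairing of the Morrey norm and the predual norm. -/
theorem lintegral_mul_le_mn_mul_pn (h : p.HolderConjugate p') {F G : Rn n → ℝ≥0∞}
    (hF : Measurable F) (htop : mn p s F ≠ ∞) :
    ∫⁻ x, F x * G x ≤ mn p s F * pn p' s G := by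
  rcases eq_or_ne (mn p s F) 0 with h0 | h0
  · -- a vanishing Morrey norm forces `F = 0` almost everywhere
    have hz : ∀ᵐ x, F x = 0 := by
      have hcube : ∀ i : Idx n, ∀ᵐ x, x ∈ Q i → F x = 0 := fun i => by
        rw [← ae_restrict_iff' (measurableSet_Q i)]
        refine ae_eq_zero_of_nrm_eq_zero h.pos hF ?_
        have := lpNorm_Q_le_mn (p := p) (s := s) i F
        rw [h0, mul_zero] at this
        exact le_antisymm this zero_le
      filter_upwards [ae_all_iff.2 hcube] with x hx
      obtain ⟨i, hi⟩ := exists_ball_subset_Q (n := n) ‖x‖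
      exact hx i (hi (by simp))
    rw [lintegral_congr_ae (g := fun _ => 0) (by filter_upwards [hz] with x hx; simp [hx])]
    simp
  rw [mul_comm, ← ENNReal.div_le_iff h0 htop]
  refine le_pn fun u hu hG => ?_
  rw [ENNReal.div_le_iff h0 htop]
  calc ∫⁻ x, F x * G x ≤ ∫⁻ x, F x * ∑' i, (Q i).indicator (u i) x := by
        refine lintegral_mono_ae ?_
        filter_upwards [hG] with x hx using mul_le_mul_right hx _
    _ = ∫⁻ x, ∑' i, (Q i).indicator (fun x => F x * u i x) x := by
        refine lintegral_congr fun x => ?_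
        rw [← ENNReal.tsum_mul_left]
        refine tsum_congr fun i => ?_
        by_cases hxi : x ∈ Q i <;> simp [hxi]
    _ = ∑' i, ∫⁻ x in Q i, F x * u i x := by
        have hm : ∀ i, Measurable ((Q i).indicator fun x => F x * u i x) := fun i =>
          (hF.mul (hu i)).indicator (measurableSet_Q i)
        rw [lintegral_tsum fun i => (hm i).aemeasurable]
        exact tsum_congr fun i => lintegral_indicator (measurableSet_Q i) _
    _ ≤ ∑' i, two (-(i.1 * s)) * lpNorm p' (Q i) (u i) * mn p s F := by
        refine ENNReal.tsum_le_tsum fun i => ?_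
        refine (nrm_holder h hF.aemeasurable (hu i).aemeasurable).trans ?_
        refine (mul_le_mul_left (lpNorm_Q_le_mn (p := p) (s := s) i F) _).trans_eq ?_
        rw [lpNorm_eq_nrm]
        ring
    _ = _ := by rw [ENNReal.tsum_mul_right]

theorem mn_indicator_one_ne_top (hp : 1 ≤ p) (hs : 0 ≤ s) (hsn : s ≤ n / p) (i : Idx n) :
    mn p s ((Q i).indicator fun _ => (1 : ℝ≥0∞)) ≠ ∞ := by
  have hp0 : 0 < p := zero_lt_one.trans_le hp
  refine ((mn_le_of_bdd hp hs hsn (M := 1) fun x => ?_).trans_lt ?_).ne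
  · exact indicator_le_self' (fun _ _ => zero_le) x
  · rw [← nrm_restrict hp0 (measurableSet_Q i), nrm_const hp0, Measure.restrict_apply_univ, one_mul,
      one_mul]
    exact ENNReal.add_lt_top.2 ⟨ENNReal.rpow_lt_top_of_nonneg (by positivity) volC_ne_top,
      ENNReal.rpow_lt_top_of_nonneg (by positivity) (volume_Q_lt_top i).ne⟩

theorem lintegral_Q_le_pn (h : p.HolderConjugate p') (hs : 0 ≤ s) (hsn : s ≤ n / p) (i : Idx n)
    (G : Rn n → ℝ≥0∞) :
    ∫⁻ x in Q i, G x ≤ mn p s ((Q i).indicator fun _ => (1 : ℝ≥0∞)) * pn p' s G := by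
  refine le_trans (le_of_eq ?_) (lintegral_mul_le_mn_mul_pn h
    (measurable_const.indicator (measurableSet_Q i)) (mn_indicator_one_ne_top h.lt.le hs hsn i))
  rw [← lintegral_indicator (measurableSet_Q i)]
  refine lintegral_congr fun x => ?_
  by_cases hx : x ∈ Q i <;> simp [hx]

theorem lintegral_Q_lt_top_of_pn (h : p.HolderConjugate p') (hs : 0 ≤ s) (hsn : s ≤ n / p)
    (i : Idx n) {G : Rn n → ℝ≥0∞} (hG : pn p' s G < ∞) : ∫⁻ x in Q i, G x < ∞ :=
  (lintegral_Q_le_pn h hs hsn i G).trans_lt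
    (ENNReal.mul_lt_top (mn_indicator_one_ne_top h.lt.le hs hsn i).lt_top hG)

/-- A property that holds almost everywhere on each dyadic cube holds almost everywhere. -/
theorem ae_of_ae_Q {P : Rn n → Prop} (h : ∀ i : Idx n, ∀ᵐ x, x ∈ Q i → P x) : ∀ᵐ x, P x := by
  filter_upwards [ae_all_iff.2 h] with x hx
  obtain ⟨i, hi⟩ := exists_ball_subset_Q (n := n) ‖x‖
  exact hx i (hi (by simp))

theorem ae_lt_top_of_pn (h : p.HolderConjugate p') (hs : 0 ≤ s) (hsn : s ≤ n / p)
    {G : Rn n → ℝ≥0∞} (hGm : Measurable G) (hG : pn p' s G < ∞) : ∀ᵐ x, G x < ∞ :=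
  ae_of_ae_Q fun i => (ae_restrict_iff' (measurableSet_Q i)).1
    (ae_lt_top hGm (lintegral_Q_lt_top_of_pn h hs hsn i hG).ne)

theorem ae_eq_zero_of_pn (h : p.HolderConjugate p') (hs : 0 ≤ s) (hsn : s ≤ n / p)
    {G : Rn n → ℝ≥0∞} (hGm : Measurable G) (hG : pn p' s G = 0) : ∀ᵐ x, G x = 0 :=
  ae_of_ae_Q fun i => (ae_restrict_iff' (measurableSet_Q i)).1 <| by
    have := lintegral_Q_le_pn h hs hsn i G
    rw [hG, mul_zero, nonpos_iff_eq_zero, lintegral_eq_zero_iff hGm] at this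
    exact this

theorem ae_eq_zero_of_mn (hp : 0 < p) {F : Rn n → ℝ≥0∞} (hFm : Measurable F)
    (hF : mn p s F = 0) : ∀ᵐ x, F x = 0 :=
  ae_of_ae_Q fun i => (ae_restrict_iff' (measurableSet_Q i)).1 <| by
    refine ae_eq_zero_of_nrm_eq_zero hp hFm ?_
    have := lpNorm_Q_le_mn (p := p) (s := s) i F
    rw [hF, mul_zero] at this
    exact le_antisymm this zero_le

end Predual

/-! ### The kernel of a dyadic cube -/

section Kernel

variable {p p' s : ℝ}

/-- A majorant, up to a constant, of `z ↦ |y-z|^{-n}` for `y` in a dyadic cube and `z` away from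
it. The weight of the ball `kball i (k + 1)` is comparable to the value `|y-z|^{-n}` near its boundary,
and the sum replaces a decomposition into dyadic annuli. -/
noncomputable def ker (i : Idx n) (z : Rn n) : ℝ≥0∞ :=
  ∑' k : ℕ, (kball i (k + 1)).indicator (fun _ => two ((i.1 - k) * n)) z

theorem measurable_ker (i : Idx n) : Measurable (ker i) :=
  Measurable.tsum fun _ => measurable_const.indicator (measurableSet_kball _ _)

theorem inv_norm_pow_le_ker (hn : 0 < n) (i : Idx n) {y z : Rn n} (hy : y ∈ Q i)
    (hz : z ∉ kball i 1) : ENNReal.ofReal (1 / ‖y - z‖ ^ n) ≤ 2 ^ n * ker i z := by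
  have hr := rad_pos hn i
  have hyc : ‖y - ctr i‖ ≤ rad i := by simpa [dist_eq_norm] using Q_subset_closedBall i hy
  have hzc : 2 * rad i ≤ ‖z - ctr i‖ := by simpa [kball, dist_eq_norm] using hz
  -- only the term of the smallest ball containing `z` is needed
  obtain ⟨k, hk1, hk2⟩ := exists_nat_pow_near (x := ‖z - ctr i‖ / rad i) (y := (2 : ℝ))
    (by rw [le_div_iff₀ hr]; linarith) one_lt_two
  rw [le_div_iff₀ hr] at hk1
  rw [div_lt_iff₀ hr] at hk2
  have hmem : z ∈ kball i (k + 1) := by simpa [kball, dist_eq_norm] using hk2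
  have hyz : 2 ^ k * rad i / 2 ≤ ‖y - z‖ := by
    have : ‖z - ctr i‖ ≤ ‖y - z‖ + ‖y - ctr i‖ := by
      rw [norm_sub_rev y z]
      exact (norm_sub_le_norm_sub_add_norm_sub z y (ctr i))
    linarith
  have hlow : (2 : ℝ) ^ (-(i.1 - k)) / 2 ≤ ‖y - z‖ := by
    refine le_trans ?_ hyz
    have h1 : (1 : ℝ) ≤ n := by exact_mod_cast hn
    have e : (2 : ℝ) ^ (-(i.1 - k)) = 2 ^ k * 2 ^ (-i.1) := by
      rw [show -(i.1 - (k : ℤ)) = k + -i.1 by ring, zpow_add₀ (by norm_num)]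
      simp
    rw [e, rad]
    gcongr
    exact le_mul_of_one_le_left (by positivity) h1
  have hker : two ((i.1 - k) * n) ≤ ker i z := by
    refine le_trans (le_of_eq ?_) (ENNReal.le_tsum k)
    rw [indicator_of_mem hmem]
  calc ENNReal.ofReal (1 / ‖y - z‖ ^ n)
      ≤ ENNReal.ofReal (1 / ((2 : ℝ) ^ (-(i.1 - k)) / 2) ^ n) := by
        gcongr
    _ = 2 ^ n * two ((i.1 - k) * n) := by
        rw [show 1 / ((2 : ℝ) ^ (-(i.1 - k)) / 2) ^ n = 2 ^ n * ((2 : ℝ) ^ (i.1 - (k : ℤ))) ^ n by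
          rw [zpow_neg, div_pow, inv_pow]; field_simp]
        rw [ENNReal.ofReal_mul (by positivity), ENNReal.ofReal_pow (by norm_num),
          ENNReal.ofReal_pow (by positivity), ofReal_two_zpow, ← ENNReal.rpow_natCast (two _),
          two_rpow]
        norm_num
    _ ≤ _ := mul_le_mul_right hker _

/-- The constant in the norm estimates for the kernel. -/
noncomputable def kerC (n : ℕ) (p' s a : ℝ) : ℝ≥0∞ :=
  volC n ^ (1 / p') * two ((n + 2) * (n / p' + s)) * ∑' k : ℕ, two (-((k : ℝ) * a))

theorem kerC_lt_top {a : ℝ} (hp : 0 < p') (ha : 0 < a) : kerC n p' s a < ∞ :=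
  ENNReal.mul_lt_top (ENNReal.mul_lt_top
    (ENNReal.rpow_lt_top_of_nonneg (by positivity) volC_ne_top) (two_lt_top _)) (tsum_two_lt_top ha)

theorem nrm_kball_le (hp : 0 < p') (i : Idx n) (k : ℕ) :
    nrm p' (volume.restrict (Q (enl i (k + 1)))) ((kball i (k + 1)).indicator
      fun _ => two ((i.1 - k) * n)) ≤
      volC n ^ (1 / p') * two ((n + 2) * (n / p') + (i.1 - k) * (n - n / p')) := by
  calc _ ≤ nrm p' (volume.restrict (Q (enl i (k + 1)))) (fun _ => two ((i.1 - k) * n)) :=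
        nrm_mono hp fun x => indicator_le_self' (fun _ _ => zero_le) x
    _ ≤ two ((i.1 - k) * n) *
        (volC n ^ (1 / p') * two (-((enl i (k + 1)).1 * (n * (1 / p'))))) := by
        rw [nrm_const hp, Measure.restrict_apply_univ]
        gcongr
        exact volume_Q_rpow_le (by positivity) _
    _ = volC n ^ (1 / p') * (two ((i.1 - k) * n) *
        two (-((enl i (k + 1)).1 * (n * (1 / p'))))) := by ring
    _ = _ := by
        rw [← two_add, enl_fst]
        congr 2
        push_cast
        ring

/-- The norm of the kernel in the predual space. Each ball lies in a cube of comparable size, and the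
norms of the terms form a geometric series, which converges if `s < n/p`. -/
theorem pn_ker_le (h : p.HolderConjugate p') (i : Idx n) :
    pn p' s (ker i) ≤ kerC n p' s (n / p - s) * two (i.1 * (n / p - s)) := by
  have hp0 : 0 < p' := h.symm.pos
  have hnp : (n : ℝ) - n / p' = n / p := by
    have := h.inv_add_inv_eq_one
    rw [div_eq_mul_inv, div_eq_mul_inv]
    linear_combination (-(n : ℝ)) * this
  refine (pn_tsum_le h.symm.lt.le _).trans ?_
  rw [kerC, mul_right_comm, ← ENNReal.tsum_mul_left]
  refine ENNReal.tsum_le_tsum fun k => ?_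
  have hsub : (kball i (k + 1)).indicator (fun _ => two ((i.1 - k) * n)) =
      (Q (enl i (k + 1))).indicator
        ((kball i (k + 1)).indicator fun _ => two ((i.1 - k) * n)) := by
    rw [indicator_indicator, inter_eq_self_of_subset_right (kball_subset_enl i (k + 1))]
  rw [hsub]
  refine (pn_indicator_le hp0 _ (measurable_const.indicator (measurableSet_kball _ _))).trans ?_
  refine (mul_le_mul_right (nrm_kball_le hp0 i k) _).trans_eq ?_
  rw [mul_left_comm, ← two_add, mul_assoc, mul_assoc, ← two_add, ← two_add, enl_fst, hnp]
  congr 2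
  push_cast
  ring

/-- The kernel belongs to `L_{p'}`. -/
theorem nrm_ker_lt_top (hn : 0 < n) (h : p.HolderConjugate p') (i : Idx n) :
    nrm p' volume (ker i) < ∞ := by
  have hp0 : 0 < p' := h.symm.pos
  have hnp : (n : ℝ) - n / p' = n / p := by
    have := h.inv_add_inv_eq_one
    rw [div_eq_mul_inv, div_eq_mul_inv]
    linear_combination (-(n : ℝ)) * this
  have hn' : (0 : ℝ) < n := by exact_mod_cast hn
  have key : nrm p' volume (ker i) ≤
      kerC n p' 0 (n / p) * two (i.1 * (n / p)) := by
    refine (nrm_tsum_le h.symm.lt.le fun k =>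
      measurable_const.indicator (measurableSet_kball _ _)).trans ?_
    rw [kerC, mul_right_comm, ← ENNReal.tsum_mul_left]
    refine ENNReal.tsum_le_tsum fun k => ?_
    have hsub : (kball i (k + 1)).indicator (fun _ => two ((i.1 - k) * n)) =
        (Q (enl i (k + 1))).indicator
          ((kball i (k + 1)).indicator fun _ => two ((i.1 - k) * n)) := by
      rw [indicator_indicator, inter_eq_self_of_subset_right (kball_subset_enl i (k + 1))]
    rw [hsub, ← nrm_restrict hp0 (measurableSet_Q _)]
    refine (nrm_kball_le hp0 i k).trans_eq ?_
    rw [mul_assoc, mul_assoc, ← two_add, ← two_add, hnp]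
    congr 2
    ring
  exact key.trans_lt (ENNReal.mul_lt_top (kerC_lt_top hp0 (div_pos hn' h.pos)) (two_lt_top _))

end Kernel

end

section

variable {n : ℕ} {p p' r ϱ s : ℝ}

/-! ### Partition of a function along a family on the cubes -/

/-- The sum `∑_Q 1_Q u_Q`. -/
noncomputable def qsum (u : Idx n → Rn n → ℝ≥0∞) (x : Rn n) : ℝ≥0∞ :=
  ∑' i, (Q i).indicator (u i) x

theorem measurable_qsum {u : Idx n → Rn n → ℝ≥0∞} (hu : ∀ i, Measurable (u i)) :
    Measurable (qsum u) :=
  Measurable.tsum fun i => (hu i).indicator (measurableSet_Q i)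

theorem pn_qsum_le {u : Idx n → Rn n → ℝ≥0∞} (hu : ∀ i, Measurable (u i)) :
    pn p' s (qsum u) ≤ ∑' i, two (-(i.1 * s)) * lpNorm p' (Q i) (u i) :=
  pn_le u hu (.of_forall fun _ => le_rfl)

/-- The weight `1_Q u_Q / ∑_Q 1_Q u_Q`. These weights split a function dominated by
`∑_Q 1_Q u_Q` into pieces supported in the cubes and dominated by the `u_Q`. -/
noncomputable def wgt (u : Idx n → Rn n → ℝ≥0∞) (i : Idx n) (x : Rn n) : ℂ :=
  (((Q i).indicator (u i) x / qsum u x).toReal : ℝ)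

theorem measurable_wgt {u : Idx n → Rn n → ℝ≥0∞} (hu : ∀ i, Measurable (u i)) (i : Idx n) :
    Measurable (wgt u i) :=
  Complex.measurable_ofReal.comp
    (((hu i).indicator (measurableSet_Q i)).div (measurable_qsum hu)).ennreal_toReal

theorem wgt_of_notMem (u : Idx n → Rn n → ℝ≥0∞) {i : Idx n} {x : Rn n} (hx : x ∉ Q i) :
    wgt u i x = 0 := by
  simp [wgt, hx]

theorem enorm_wgt_le (u : Idx n → Rn n → ℝ≥0∞) (i : Idx n) (x : Rn n) :
    ‖wgt u i x‖ₑ ≤ (Q i).indicator (u i) x / qsum u x := by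
  rw [wgt, ← ofReal_norm, Complex.norm_real, Real.norm_of_nonneg ENNReal.toReal_nonneg]
  exact ENNReal.ofReal_toReal_le

theorem enorm_wgt_mul_le (u : Idx n → Rn n → ℝ≥0∞) (i : Idx n) (x : Rn n) {c : ℝ≥0∞}
    (hc : c ≤ qsum u x) : ‖wgt u i x‖ₑ * c ≤ (Q i).indicator (u i) x := by
  calc ‖wgt u i x‖ₑ * c ≤ (Q i).indicator (u i) x / qsum u x * qsum u x := by
        gcongr; exact enorm_wgt_le u i x
    _ ≤ _ := by rw [mul_comm]; exact ENNReal.mul_div_le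

theorem hasSum_wgt_mul {u : Idx n → Rn n → ℝ≥0∞} {x : Rn n} (hx : qsum u x ≠ ∞) {z : ℂ}
    (hz : ‖z‖ₑ ≤ qsum u x) : HasSum (fun i => wgt u i x * z) z := by
  rcases eq_or_ne (qsum u x) 0 with h0 | h0
  · rw [h0, nonpos_iff_eq_zero, enorm_eq_zero] at hz
    simp [hz, hasSum_zero]
  have h1 : ∑' i, (Q i).indicator (u i) x / qsum u x = 1 := by
    simp_rw [div_eq_mul_inv]
    rw [ENNReal.tsum_mul_right]
    exact ENNReal.mul_inv_cancel h0 hx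
  have h2 : HasSum (fun i => ((Q i).indicator (u i) x / qsum u x).toReal) 1 := by
    have := ENNReal.hasSum_toReal (f := fun i => (Q i).indicator (u i) x / qsum u x)
      (by rw [h1]; exact ENNReal.one_ne_top)
    rwa [← ENNReal.tsum_toReal_eq, h1, ENNReal.toReal_one] at this
    intro i
    exact ne_top_of_le_ne_top (h1.trans_ne ENNReal.one_ne_top) (ENNReal.le_tsum i)
  have h3 : HasSum (fun i => wgt u i x) ((1 : ℝ) : ℂ) := by
    exact Complex.hasSum_ofReal.2 h2
  simpa using h3.mul_right z

/-! ### The predual norm as an atomic norm -/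

theorem locallyIntegrable_of_pn (h : p.HolderConjugate p') (hs : 0 ≤ s) (hsn : s ≤ n / p)
    {g : Rn n → ℂ} (hgm : AEStronglyMeasurable g volume) (hg : pn p' s (fun x => ‖g x‖ₑ) < ∞) :
    LocallyIntegrable g := by
  refine (locallyIntegrable_iff).2 fun K hK => ?_
  obtain ⟨R, hR⟩ := hK.isBounded.subset_closedBall 0
  obtain ⟨i, hi⟩ := exists_ball_subset_Q (n := n) R
  refine IntegrableOn.mono_set ⟨hgm.restrict, ?_⟩ (hR.trans hi)
  exact lintegral_Q_lt_top_of_pn h hs hsn i hg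

theorem mn_schwartz_lt_top (hp : 1 ≤ p) (hs : 0 ≤ s) (hsn : s ≤ n / p) (ψ : 𝓢(Rn n, ℂ)) :
    mn p s (fun x => ‖ψ x‖ₑ) < ∞ := by
  have hp0 : 0 < p := zero_lt_one.trans_le hp
  obtain ⟨C, hC⟩ := (isBounded_iff_forall_norm_le.1
    (BoundedContinuousFunction.isBounded_range ψ.toBoundedContinuousFunction))
  refine (mn_le_of_bdd hp hs hsn (M := ENNReal.ofReal C) fun x => ?_).trans_lt ?_
  · rw [← ofReal_norm]
    exact ENNReal.ofReal_le_ofReal (hC _ ⟨x, rfl⟩)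
  · refine ENNReal.add_lt_top.2 ⟨ENNReal.mul_lt_top ENNReal.ofReal_lt_top
      (ENNReal.rpow_lt_top_of_nonneg (by positivity) volC_ne_top), ?_⟩
    rw [← eLpNorm_eq_nrm hp0]
    exact (ψ.memLp (ENNReal.ofReal p) volume).2

theorem lintegral_mul_enorm_lt_top {G : Rn n → ℝ≥0∞} (hG : ∀ i : Idx n, ∫⁻ x in Q i, G x < ∞)
    {ψ : Rn n → ℂ} (hψ : Continuous ψ) (hc : HasCompactSupport ψ) :
    ∫⁻ x, G x * ‖ψ x‖ₑ < ∞ := by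
  obtain ⟨C, hC⟩ := hψ.bounded_above_of_compact_support hc
  obtain ⟨R, hR⟩ := hc.isCompact.isBounded.subset_closedBall 0
  obtain ⟨i, hi⟩ := exists_ball_subset_Q (n := n) R
  calc ∫⁻ x, G x * ‖ψ x‖ₑ ≤ ∫⁻ x, ENNReal.ofReal C * (Q i).indicator G x := by
        refine lintegral_mono fun x => ?_
        by_cases hx : x ∈ Q i
        · rw [indicator_of_mem hx, mul_comm]
          gcongr
          rw [← ofReal_norm]
          exact ENNReal.ofReal_le_ofReal (hC x)
        · rw [image_eq_zero_of_notMem_tsupport fun hx' => hx (hi (hR hx'))]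
          simp
    _ = ENNReal.ofReal C * ∫⁻ x in Q i, G x := by
        rw [lintegral_const_mul' _ _ ENNReal.ofReal_ne_top, lintegral_indicator (measurableSet_Q i)]
    _ < ∞ := ENNReal.mul_lt_top ENNReal.ofReal_lt_top (hG i)

/-- In an atomic representation with absolutely summable coefficients the series converges almost
everywhere, and it represents the function pointwise. -/
theorem pn_le_of_isAtomicRep (h : p.HolderConjugate p') (hs : 0 ≤ s) (hsn : s ≤ n / p)
    (hsϱ : n / p' + ϱ = -s) {g : Rn n → ℂ} {lam : Idx n → ℂ}
    {a : Idx n → Rn n → ℂ} (hr : IsAtomicRep p' ϱ g lam a) :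
    pn p' s (fun x => ‖g x‖ₑ) ≤ ∑' i, ‖lam i‖ₑ := by
  have hp0 : 0 < p' := h.symm.pos
  rcases eq_or_ne (∑' i, ‖lam i‖ₑ) ∞ with htop | htop
  · rw [htop]; exact le_top
  set b : Idx n → Rn n → ℂ := fun i => (hr.memLp i).1.mk (a i) with hb
  have hbm : ∀ i, Measurable (b i) := fun i => (hr.memLp i).1.stronglyMeasurable_mk.measurable
  have hba : ∀ i, a i =ᵐ[volume] b i := fun i => (hr.memLp i).1.ae_eq_mk
  set u : Idx n → Rn n → ℝ≥0∞ := fun i x => ‖lam i‖ₑ * ‖b i x‖ₑ with hu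
  have hum : ∀ i, Measurable (u i) := fun i => (hbm i).enorm.const_mul _
  have hcost : ∑' i, two (-(i.1 * s)) * lpNorm p' (Q i) (u i) ≤ ∑' i, ‖lam i‖ₑ := by
    refine ENNReal.tsum_le_tsum fun i => ?_
    have h1 : lpNorm p' (Q i) (u i) ≤ ‖lam i‖ₑ * two (i.1 * s) := by
      rw [lpNorm_eq_nrm, nrm_const_mul hp0 _ (hbm i).enorm]
      gcongr
      refine (nrm_mono_measure hp0 Measure.restrict_le_self _).trans ?_
      rw [← eLpNorm_eq_nrm hp0, ← eLpNorm_congr_ae (hba i)]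
      refine (hr.norm_le i).trans_eq ?_
      rw [ofReal_two_rpow, hsϱ, neg_mul_neg]
    calc _ ≤ two (-(i.1 * s)) * (‖lam i‖ₑ * two (i.1 * s)) := mul_le_mul_right h1 _
      _ = ‖lam i‖ₑ * (two (-(i.1 * s)) * two (i.1 * s)) := by ring
      _ = ‖lam i‖ₑ := by rw [two_neg_mul_self, mul_one]
  have hG : pn p' s (qsum u) < ∞ :=
    ((pn_qsum_le hum).trans hcost).trans_lt (lt_top_iff_ne_top.2 htop)
  have hGfin := ae_lt_top_of_pn h hs hsn (measurable_qsum hum) hG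
  -- almost everywhere the terms of the series are the values of `u` restricted to the cubes
  have hterm : ∀ᵐ x, ∀ i, ‖lam i * a i x‖ₑ = (Q i).indicator (u i) x := by
    filter_upwards [ae_all_iff.2 hba, ae_all_iff.2 hr.supp] with x h1 h2 i
    by_cases hx : x ∈ Q i
    · rw [indicator_of_mem hx, enorm_mul, h1 i]
    · rw [indicator_of_notMem hx, h2 i hx]
      simp
  set H : Rn n → ℂ := fun x => ∑' i, lam i * a i x with hH
  have hHle : ∀ᵐ x, ‖H x‖ₑ ≤ qsum u x := by
    filter_upwards [hterm] with x hx
    refine enorm_tsum_le_tsum_enorm.trans_eq ?_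
    exact tsum_congr hx
  have hHm : AEStronglyMeasurable H volume := by
    have hH' : H =ᵐ[volume] fun x => ∑' i, lam i * b i x := by
      filter_upwards [ae_all_iff.2 hba] with x hx
      exact tsum_congr fun i => by rw [hx i]
    refine AEStronglyMeasurable.congr (Measurable.aestronglyMeasurable ?_) hH'.symm
    exact Measurable.tsum fun i => (hbm i).const_mul _
  have hHint : LocallyIntegrable H :=
    locallyIntegrable_of_pn h hs hsn hHm ((pn_mono_ae hHle).trans_lt hG)
  have hsch : ∀ (f : Rn n → ℝ), ContDiff ℝ (⊤ : ℕ∞) f → HasCompactSupport f →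
      ∃ ψ : 𝓢(Rn n, ℂ), ∀ x, ψ x = f x := by
    intro f hf hfc
    have h1 : HasCompactSupport fun x => (f x : ℂ) := hfc.comp_left (g := Complex.ofReal) (by simp)
    have h2 : ContDiff ℝ (⊤ : ℕ∞) fun x => (f x : ℂ) := Complex.ofRealCLM.contDiff.comp hf
    exact ⟨h1.toSchwartzMap h2, fun x => rfl⟩
  have hgint : LocallyIntegrable g := by
    refine (locallyIntegrable_iff).2 fun K hK => ?_
    obtain ⟨R, hR0, hR⟩ := hK.isBounded.subset_closedBall_lt 0 0
    let χ : ContDiffBump (0 : Rn n) := ⟨R, R + 1, hR0, by linarith⟩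
    obtain ⟨ψ, hψ⟩ := hsch χ χ.contDiff χ.hasCompactSupport
    refine ((hr.integrable ψ).integrableOn (s := K)).congr_fun (fun x hx => ?_)
      hK.isClosed.measurableSet
    beta_reduce
    rw [hψ, χ.one_of_mem_closedBall (hR hx)]
    simp
  have hgH : ∀ᵐ x, g x = H x := by
    refine ae_eq_of_integral_contDiff_smul_eq hgint hHint fun f hf hfc => ?_
    obtain ⟨ψ, hψ⟩ := hsch f hf hfc
    have hψc : HasCompactSupport ψ := by
      have h1 : HasCompactSupport fun x => (f x : ℂ) :=
        hfc.comp_left (g := Complex.ofReal) (by simp)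
      rwa [show (ψ : Rn n → ℂ) = fun x => (f x : ℂ) from funext hψ]
    have e1 : ∫ x, f x • g x = ∫ x, g x * ψ x := by
      congr 1; funext x; rw [hψ, mul_comm, Complex.real_smul]
    have e2 : ∫ x, f x • H x = ∫ x, ∑' i, lam i * (a i x * ψ x) := by
      congr 1; funext x
      rw [hH, Complex.real_smul, ← hψ, mul_comm, ← tsum_mul_right]
      exact tsum_congr fun i => by ring
    rw [e1, e2, integral_tsum]
    · rw [← (hr.hasSum ψ).tsum_eq]
      exact tsum_congr fun i => (integral_const_mul _ _).symm
    · exact fun i => ((hr.memLp i).1.mul ψ.continuous.aestronglyMeasurable).const_mul _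
    · rw [← lintegral_tsum]
      · refine ne_of_lt (lt_of_le_of_lt (le_of_eq ?_) (lintegral_mul_enorm_lt_top
          (fun i => lintegral_Q_lt_top_of_pn h hs hsn i hG) ψ.continuous hψc))
        refine lintegral_congr_ae ?_
        filter_upwards [hterm] with x hx
        rw [qsum, ← ENNReal.tsum_mul_right]
        refine tsum_congr fun i => ?_
        rw [← hx i, ← mul_assoc, enorm_mul]
      · exact fun i => (((hr.memLp i).1.mul ψ.continuous.aestronglyMeasurable).const_mul _).enorm
  refine (pn_le u hum ?_).trans hcost
  filter_upwards [hgH, hHle] with x h1 h2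
  rw [h1]
  exact h2

/-- A domination by functions on the cubes yields an atomic representation. -/
theorem exists_isAtomicRep (h : p.HolderConjugate p') (hs : 0 ≤ s) (hsn : s ≤ n / p)
    (hsϱ : n / p' + ϱ = -s) {g : Rn n → ℂ} (hgm : Measurable g) {u : Idx n → Rn n → ℝ≥0∞}
    (hu : ∀ i, Measurable (u i)) (hgu : ∀ᵐ x, ‖g x‖ₑ ≤ qsum u x)
    (hcost : ∑' i, two (-(i.1 * s)) * lpNorm p' (Q i) (u i) ≠ ∞) :
    ∃ lam a, IsAtomicRep p' ϱ g lam a ∧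
      ∑' i, ‖lam i‖ₑ ≤ ∑' i, two (-(i.1 * s)) * lpNorm p' (Q i) (u i) := by
  have hp0 : 0 < p' := h.symm.pos
  set c : Idx n → ℝ≥0∞ := fun i => two (-(i.1 * s)) * lpNorm p' (Q i) (u i) with hc
  have hcfin : ∀ i, c i ≠ ∞ := fun i => ne_top_of_le_ne_top hcost (ENNReal.le_tsum i)
  have hG : pn p' s (qsum u) < ∞ := (pn_qsum_le hu).trans_lt (lt_top_iff_ne_top.2 hcost)
  have hGfin := ae_lt_top_of_pn h hs hsn (measurable_qsum hu) hG
  have hpng : pn p' s (fun x => ‖g x‖ₑ) < ∞ := (pn_mono_ae hgu).trans_lt hG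
  have hnu : ∀ i, nrm p' volume ((Q i).indicator (u i)) = c i * two (i.1 * s) := fun i => by
    rw [← nrm_restrict hp0 (measurableSet_Q i), hc, mul_right_comm, two_neg_mul_self, one_mul,
      lpNorm_eq_nrm]
  set lam : Idx n → ℂ := fun i => ((c i).toReal : ℂ) with hlam
  have hlam' : ∀ i, ‖lam i‖ₑ = c i := fun i => by
    rw [hlam, ← ofReal_norm, Complex.norm_real,
      Real.norm_of_nonneg ENNReal.toReal_nonneg, ENNReal.ofReal_toReal (hcfin i)]
  have hlam0 : ∀ i, lam i = 0 ↔ c i = 0 := fun i => by rw [← enorm_eq_zero, hlam']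
  set a : Idx n → Rn n → ℂ := fun i x => (lam i)⁻¹ * (wgt u i x * g x) with ha
  have ham : ∀ i, Measurable (a i) := fun i => ((measurable_wgt hu i).mul hgm).const_mul _
  have hwg : ∀ i, ∀ᵐ x, ‖wgt u i x * g x‖ₑ ≤ (Q i).indicator (u i) x := fun i => by
    filter_upwards [hgu] with x hx
    rw [enorm_mul]
    exact enorm_wgt_mul_le u i x hx
  have hnorm : ∀ i, eLpNorm (a i) (ENNReal.ofReal p') volume ≤ two (i.1 * s) := fun i => by
    rw [eLpNorm_eq_nrm hp0]
    simp_rw [ha, enorm_mul (lam i)⁻¹]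
    rw [nrm_const_mul hp0 _ (F := fun x => ‖wgt u i x * g x‖ₑ)
      ((measurable_wgt hu i).mul hgm).enorm]
    rcases eq_or_ne (c i) 0 with h0 | h0
    · simp [(hlam0 i).2 h0]
    · rw [enorm_inv (by rwa [Ne, hlam0]), hlam']
      refine (mul_le_mul_right (nrm_mono_ae hp0 (hwg i)) _).trans_eq ?_
      rw [hnu, ← mul_assoc, ENNReal.inv_mul_cancel h0 (hcfin i), one_mul]
  -- the products of coefficients and atoms are the pieces of the partition of `g`
  have hla : ∀ i, ∀ᵐ x, lam i * a i x = wgt u i x * g x := fun i => by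
    rcases eq_or_ne (c i) 0 with h0 | h0
    · have hz := ae_eq_zero_of_nrm_eq_zero hp0 ((hu i).indicator (measurableSet_Q i))
        ((hnu i).trans (by rw [h0, zero_mul]))
      filter_upwards [hwg i, hz] with x h1 h2
      rw [h2, nonpos_iff_eq_zero, enorm_eq_zero] at h1
      rw [h1, (hlam0 i).2 h0, zero_mul]
    · refine .of_forall fun x => ?_
      rw [ha, mul_inv_cancel_left₀ (by rwa [Ne, hlam0])]
  have hmem : ∀ i, MemLp (a i) (ENNReal.ofReal p') volume := fun i =>
    ⟨(ham i).aestronglyMeasurable, (hnorm i).trans_lt (two_lt_top _)⟩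
  have hfinψ : ∀ ψ : 𝓢(Rn n, ℂ), ∀ G : Rn n → ℝ≥0∞, pn p' s G < ∞ →
      ∫⁻ x, ‖ψ x‖ₑ * G x < ∞ := fun ψ G hG => by
    have := mn_schwartz_lt_top h.lt.le hs hsn ψ
    exact (lintegral_mul_le_mn_mul_pn h ψ.continuous.measurable.enorm this.ne).trans_lt
      (ENNReal.mul_lt_top this hG)
  refine ⟨lam, a, ⟨hmem, ?_, ?_, ?_, ?_⟩, ?_⟩
  · refine fun i => .of_forall fun x hx => ?_
    simp [ha, wgt_of_notMem u hx]
  · intro i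
    rw [hsϱ, neg_mul_neg, ofReal_two_rpow]
    exact hnorm i
  · intro ψ
    refine ⟨(hgm.mul ψ.continuous.measurable).aestronglyMeasurable, ?_⟩
    refine lt_of_le_of_lt (le_of_eq ?_) (hfinψ ψ _ hpng)
    exact lintegral_congr fun x => by rw [enorm_mul, mul_comm]
  · intro ψ
    have hle : ∫⁻ x, ∑' i, ‖lam i * (a i x * ψ x)‖ₑ ≤ ∫⁻ x, ‖ψ x‖ₑ * qsum u x := by
      refine lintegral_mono_ae ?_
      filter_upwards [ae_all_iff.2 hla, ae_all_iff.2 hwg] with x h1 h2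
      rw [qsum, ← ENNReal.tsum_mul_left]
      refine ENNReal.tsum_le_tsum fun i => ?_
      rw [← mul_assoc, h1 i, enorm_mul, mul_comm]
      exact mul_le_mul_right (h2 i) _
    have hmeas : ∀ i, AEStronglyMeasurable (fun x => lam i * (a i x * ψ x)) volume := fun i =>
      (((ham i).mul ψ.continuous.measurable).const_mul _).aestronglyMeasurable
    have hfin : ∑' i, ∫⁻ x, ‖lam i * (a i x * ψ x)‖ₑ ≠ ∞ := by
      rw [← lintegral_tsum fun i => (hmeas i).enorm]
      exact (hle.trans_lt (hfinψ ψ _ hG)).ne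
    have hsum := hasSum_integral_of_summable_integral_norm (μ := volume)
      (F := fun i x => lam i * (a i x * ψ x))
      (fun i => ⟨hmeas i, lt_of_le_of_lt (ENNReal.le_tsum (f := fun i =>
        ∫⁻ x, ‖lam i * (a i x * ψ x)‖ₑ) i) (lt_top_iff_ne_top.2 hfin)⟩) (by
        simp_rw [integral_norm_eq_lintegral_enorm (hmeas _)]
        exact ENNReal.summable_toReal hfin)
    simp_rw [integral_const_mul] at hsum
    refine (congrArg (HasSum _) ?_).mp hsum
    refine integral_congr_ae ?_
    filter_upwards [ae_all_iff.2 hla, hgu, hGfin] with x h1 h2 h3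
    rw [← (hasSum_wgt_mul h3.ne h2).tsum_eq, ← tsum_mul_right]
    exact tsum_congr fun i => by rw [← mul_assoc, h1 i]
  · exact ENNReal.tsum_le_tsum fun i => (hlam' i).le

/-- The atomic norm of a function depends only on its absolute value. -/
theorem predualNormAux_eq_pn (h : p.HolderConjugate p') (hs : 0 ≤ s) (hsn : s ≤ n / p)
    (hsϱ : n / p' + ϱ = -s) {g : Rn n → ℂ} (hgm : Measurable g) :
    predualNormAux p' ϱ g = pn p' s (fun x => ‖g x‖ₑ) := by
  refine le_antisymm (le_pn fun u hu hgu => ?_)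
    (le_iInf fun lam => le_iInf fun a => le_iInf fun hr =>
      pn_le_of_isAtomicRep h hs hsn hsϱ hr)
  rcases eq_or_ne (∑' i, two (-(i.1 * s)) * lpNorm p' (Q i) (u i)) ∞ with htop | htop
  · rw [htop]; exact le_top
  obtain ⟨lam, a, hr, hle⟩ := exists_isAtomicRep h hs hsn hsϱ hgm hu hgu htop
  exact (iInf₂_le_of_le (f := fun lam a => ⨅ _ : IsAtomicRep p' ϱ g lam a, ∑' i, ‖lam i‖ₑ) lam a
    (iInf_le_of_le hr le_rfl)).trans hle

end

section

variable {n : ℕ} {p p' q q' r ϱ s : ℝ}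

/-! ### Test functions and approximation in `L_p` -/

theorem tendsto_two_neg : Tendsto (fun k : ℕ => two (-(k : ℝ))) atTop (𝓝 0) := by
  have := tsum_two_lt_top one_pos
  simp only [mul_one] at this
  exact ENNReal.tendsto_atTop_zero_of_tsum_ne_top this.ne

theorem le_of_forall_two {a b C : ℝ≥0∞} (hC : C ≠ ∞) (h : ∀ k : ℕ, a ≤ b + C * two (-k)) :
    a ≤ b := by
  have h2 : Tendsto (fun k : ℕ => b + C * two (-(k : ℝ))) atTop (𝓝 (b + C * 0)) :=
    (ENNReal.Tendsto.const_mul tendsto_two_neg (Or.inr hC)).const_add b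
  rw [mul_zero, add_zero] at h2
  exact ge_of_tendsto' h2 h

/-- The test function given by a smooth function with compact support. -/
def mkD (f : Rn n → ℂ) (hf : ContDiff ℝ (⊤ : ℕ∞) f) (hc : HasCompactSupport f) : D n :=
  ⟨f, hf, hc, fun _ _ => trivial⟩

/-- The `L_p` norm of a complex function, as an instance of `nrm`. -/
noncomputable def Np (p : ℝ) (f : Rn n → ℂ) : ℝ≥0∞ := nrm p volume (fun x => ‖f x‖ₑ)

theorem Np_eq_eLpNorm (hp : 0 < p) (f : Rn n → ℂ) :
    Np p f = eLpNorm f (ENNReal.ofReal p) volume := (eLpNorm_eq_nrm hp f).symm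

theorem Np_congr {f g : Rn n → ℂ} (h : f =ᵐ[volume] g) : Np p f = Np p g :=
  nrm_congr_ae (by filter_upwards [h] with x hx; rw [hx])

theorem Np_mono_ae (hp : 0 < p) {f g : Rn n → ℂ} (h : ∀ᵐ x, ‖f x‖ₑ ≤ ‖g x‖ₑ) :
    Np p f ≤ Np p g :=
  nrm_mono_ae hp h

theorem Np_triangle (hp : 1 ≤ p) {f g h : Rn n → ℂ} (hf : Measurable f) (hg : Measurable g)
    (hh : Measurable h) :
    Np p (fun x => f x - h x) ≤ Np p (fun x => f x - g x) + Np p (fun x => g x - h x) := by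
  refine (nrm_mono (zero_lt_one.trans_le hp) fun x => ?_).trans
    (nrm_add_le hp (hf.sub hg).enorm.aemeasurable (hg.sub hh).enorm.aemeasurable)
  calc ‖f x - h x‖ₑ = ‖(f x - g x) + (g x - h x)‖ₑ := by congr 1; ring
    _ ≤ _ := enorm_add_le _ _

theorem Np_sub_comm (f g : Rn n → ℂ) :
    Np p (fun x => f x - g x) = Np p (fun x => g x - f x) := by
  unfold Np
  congr 1; funext x
  rw [← enorm_neg, neg_sub]

theorem D_measurable (φ : D n) : Measurable (φ : Rn n → ℂ) := φ.continuous.measurable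

theorem Cb_measurable (u : Cb n) : Measurable (u : Rn n → ℂ) := u.continuous.measurable

theorem Fn_measurable (f : Fn n) : Measurable (f : Rn n → ℂ) := f.stronglyMeasurable.measurable

theorem coe_ofD (φ : D n) : (ofD φ : Rn n → ℂ) =ᵐ[volume] φ := AEEqFun.coeFn_mk _ _

theorem coe_ofC (u : Cb n) : (ofC u : Rn n → ℂ) =ᵐ[volume] u := AEEqFun.coeFn_mk _ _

theorem Np_D_lt_top (hp : 0 < p) (φ : D n) : Np p φ < ∞ := by
  rw [Np_eq_eLpNorm hp]
  exact (φ.continuous.memLp_of_hasCompactSupport φ.hasCompactSupport).2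

theorem exists_D_approx (hp : 1 ≤ p) {f : Rn n → ℂ} (hfm : Measurable f) (hf : Np p f < ∞)
    {ε : ℝ≥0∞} (hε : 0 < ε) : ∃ φ : D n, Np p (fun x => f x - φ x) ≤ ε := by
  have hp0 : 0 < p := zero_lt_one.trans_le hp
  rw [Np_eq_eLpNorm hp0] at hf
  obtain ⟨δ, hδ, hδε⟩ : ∃ δ : ℝ, 0 < δ ∧ ENNReal.ofReal δ ≤ ε := by
    rcases eq_or_ne ε ∞ with rfl | h
    · exact ⟨1, one_pos, le_top⟩
    · exact ⟨ε.toReal, ENNReal.toReal_pos hε.ne' h, (ENNReal.ofReal_toReal h).le⟩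
  obtain ⟨g, hg1, hg2, hg3⟩ := MemLp.exist_eLpNorm_sub_le (p := ENNReal.ofReal p)
    ENNReal.ofReal_ne_top (by simpa using hp) ⟨hfm.aestronglyMeasurable, hf⟩ hδ
  refine ⟨mkD g hg2 hg1, ?_⟩
  rw [Np_eq_eLpNorm hp0]
  exact hg3.trans hδε

/-- Approximation of an `L_p` function that vanishes near a dyadic cube by test functions that
vanish near that cube. -/
theorem exists_D_approx_away (hn : 0 < n) (hp : 1 ≤ p) (i : Idx n) {f : Rn n → ℂ}
    (hfm : Measurable f) (hf : Np p f < ∞) (hf0 : ∀ᵐ x, x ∈ kball i 2 → f x = 0)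
    {ε : ℝ≥0∞} (hε : 0 < ε) :
    ∃ φ : D n, (∀ z ∈ kball i 1, φ z = 0) ∧ Np p (fun x => f x - φ x) ≤ ε := by
  obtain ⟨φ, hφ⟩ := exists_D_approx hp hfm hf hε
  have hr := rad_pos hn i
  let χ : ContDiffBump (ctr i) := ⟨2 ^ 1 * rad i, 2 ^ 2 * rad i, by positivity, by linarith⟩
  have hψ : ContDiff ℝ (⊤ : ℕ∞) fun x => ((1 - χ x : ℝ) : ℂ) * φ x :=
    (Complex.ofRealCLM.contDiff.comp (contDiff_const.sub χ.contDiff)).mul φ.contDiff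
  refine ⟨mkD _ hψ (φ.hasCompactSupport.mul_left), fun z hz => ?_, le_trans ?_ hφ⟩
  · change ((1 - χ z : ℝ) : ℂ) * φ z = 0
    rw [χ.one_of_mem_closedBall (Metric.ball_subset_closedBall hz)]
    simp
  · refine Np_mono_ae (zero_lt_one.trans_le hp) ?_
    filter_upwards [hf0] with x hx
    change ‖f x - ((1 - χ x : ℝ) : ℂ) * φ x‖ₑ ≤ _
    have e : f x - ((1 - χ x : ℝ) : ℂ) * φ x = ((1 - χ x : ℝ) : ℂ) * (f x - φ x) := by
      by_cases hxb : x ∈ kball i 2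
      · rw [hx hxb]; ring
      · rw [χ.zero_of_le_dist (by simpa [kball] using hxb)]
        simp
    rw [e, enorm_mul]
    refine mul_le_of_le_one_left' ?_
    rw [← ofReal_norm, Complex.norm_real, Real.norm_of_nonneg (by linarith [χ.le_one (x := x)])]
    simpa using χ.nonneg

theorem exists_seq_D (hp : 1 ≤ p) {f : Rn n → ℂ} (hfm : Measurable f) (hf : Np p f < ∞) :
    ∃ φ : ℕ → D n, ∀ k : ℕ, Np p (fun x => f x - φ k x) ≤ two (-k) :=
  ⟨_, fun k => (exists_D_approx hp hfm hf (pos_iff_ne_zero.2 (two_ne_zero' (-k)))).choose_spec⟩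

/-- Geometric convergence in `L_p` implies convergence almost everywhere. -/
theorem ae_tendsto_of_Np_le (hp : 1 ≤ p) {g : Rn n → ℂ} {h : ℕ → Rn n → ℂ} (hg : Measurable g)
    (hh : ∀ k, Measurable (h k)) {C : ℝ≥0∞} (hC : C ≠ ∞)
    (hle : ∀ k : ℕ, Np p (fun x => g x - h k x) ≤ C * two (-k)) :
    ∀ᵐ x, Tendsto (fun k => h k x) atTop (𝓝 (g x)) := by
  have hp0 : 0 < p := zero_lt_one.trans_le hp
  have hm : ∀ k, Measurable fun x => ‖g x - h k x‖ₑ := fun k => (hg.sub (hh k)).enorm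
  have hfin : nrm p volume (fun x => ∑' k, ‖g x - h k x‖ₑ) ≠ ∞ := by
    refine ((nrm_tsum_le hp hm).trans_lt ?_).ne
    refine (ENNReal.tsum_le_tsum hle).trans_lt ?_
    rw [ENNReal.tsum_mul_left]
    refine ENNReal.mul_lt_top hC.lt_top ?_
    simpa using tsum_two_lt_top one_pos
  filter_upwards [ae_lt_top_of_nrm_ne_top hp0 (Measurable.tsum hm) hfin] with x hx
  have h0 := ENNReal.tendsto_atTop_zero_of_tsum_ne_top hx.ne
  rw [tendsto_iff_edist_tendsto_0]
  refine h0.congr fun k => ?_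
  rw [edist_comm, edist_eq_enorm_sub]

/-! ### The extension to `L_p` -/

/-- The properties of a sequence of operators on test functions that are used: sublinearity, the
size condition in terms of the kernels of the dyadic cubes, the vector-valued `L_p` bound, and the
decay at infinity. -/
structure Adm (p q : ℝ) (T : ℕ → D n → Cb n) (C₁ C₂ : ℝ≥0∞) : Prop where
  sub : ∀ j φ ψ y, ‖T j φ y - T j ψ y‖ ≤ ‖T j (φ - ψ) y‖
  zero : ∀ j, T j 0 = 0
  size : ∀ j (φ : D n) (i : Idx n), ∀ y ∈ Q i, (∀ z ∈ kball i 1, φ z = 0) →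
    ‖T j φ y‖ₑ ≤ C₁ * ∫⁻ z, ‖φ z‖ₑ * ker i z
  bdd : ∀ f : ℕ → D n, nrm p volume (fun x => lq q fun j => ‖T j (f j) x‖ₑ) ≤
    C₂ * nrm p volume (fun x => lq q fun j => ‖f j x‖ₑ)
  decay : ∀ j (φ : D n), Tendsto (T j φ) (cocompact (Rn n)) (𝓝 0)
  C₁_ne_top : C₁ ≠ ∞
  C₂_ne_top : C₂ ≠ ∞

/-- The value at `f` of the extension of `T` to `L_p`, for an operator with norm at most `C`: the
function `g` with `‖g - T φ‖ ≤ C ‖f - φ‖` for all test functions `φ`. -/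
noncomputable def lpExt (p : ℝ) (C : ℝ≥0∞) (T : D n → Cb n) (f : Fn n) : Fn n :=
  open scoped Classical in
  if h : ∃ g : Fn n, ∀ φ : D n,
    Np p (fun x => g x - T φ x) ≤ C * Np p (fun x => f x - φ x) then h.choose else 0

section Ext

variable {T : ℕ → D n → Cb n} {C₁ C₂ : ℝ≥0∞}

theorem coe_D_sub (φ ψ : D n) (x : Rn n) : (φ - ψ) x = φ x - ψ x := rfl

theorem Adm.Np_le (hT : Adm p q T C₁ C₂) (hq : 0 < q) (j : ℕ) (φ : D n) :
    Np p (T j φ) ≤ C₂ * Np p φ := by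
  classical
  have h := hT.bdd (fun k => if k = j then φ else 0)
  have e1 : (fun x => lq q fun k => ‖T k (if k = j then φ else 0) x‖ₑ) =
      fun x => ‖T j φ x‖ₑ := by
    funext x
    rw [lq_single hq _ j fun k hk => by simp [hk, hT.zero]]
    simp
  have e2 : (fun x => lq q fun k => ‖(if k = j then φ else 0 : D n) x‖ₑ) = fun x => ‖φ x‖ₑ := by
    funext x
    rw [lq_single hq _ j fun k hk => by simp [hk]]
    simp
  rwa [e1, e2] at h

theorem Adm.Np_sub_le (hT : Adm p q T C₁ C₂) (hp : 0 < p) (hq : 0 < q) (j : ℕ) (φ ψ : D n) :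
    Np p (fun x => T j φ x - T j ψ x) ≤ C₂ * Np p (fun x => φ x - ψ x) := by
  refine le_trans ?_ (hT.Np_le hq j (φ - ψ))
  exact Np_mono_ae hp (.of_forall fun x => enorm_le_iff_norm_le.2 (hT.sub j φ ψ x))

/-- The value of the extension at `f` is the limit in `L_p` of the images of test functions tending to
`f`, and it is tested against all test functions at once. -/
theorem Adm.exists_ext (hT : Adm p q T C₁ C₂) (hp : 1 ≤ p) (hq : 0 < q) (j : ℕ) {f : Rn n → ℂ}
    (hfm : Measurable f) (hf : Np p f < ∞) :
    ∃ g : Fn n, ∀ φ : D n,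
      Np p (fun x => g x - T j φ x) ≤ C₂ * Np p (fun x => f x - φ x) := by
  have hp0 : 0 < p := zero_lt_one.trans_le hp
  have hC := hT.C₂_ne_top
  obtain ⟨φ, hφ⟩ := exists_seq_D hp hfm hf
  have hφ' : ∀ k (ψ : D n), Np p (fun x => φ k x - ψ x) ≤
      two (-k) + Np p (fun x => f x - ψ x) := fun k ψ => by
    refine (Np_triangle hp (D_measurable _) hfm (D_measurable _)).trans ?_
    rw [Np_sub_comm]
    gcongr
    exact hφ k
  have hmono : ∀ {N m : ℕ}, N ≤ m → two (-(m : ℝ)) ≤ two (-(N : ℝ)) := fun h =>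
    ENNReal.rpow_le_rpow_of_exponent_le (by norm_num) (by
      simpa using h)
  set B : ℕ → ℝ≥0∞ := fun N => (C₂ * 2 + 1) * two (-N) with hB
  have hcau : ∀ N m l : ℕ, N ≤ m → N ≤ l →
      eLpNorm ((T j (φ m) : Rn n → ℂ) - (T j (φ l) : Rn n → ℂ)) (ENNReal.ofReal p) volume < B N := by
    intro N m l hm hl
    have h1 : Np p (fun x => T j (φ m) x - T j (φ l) x) ≤ C₂ * 2 * two (-N) := by
      refine (hT.Np_sub_le hp0 hq j _ _).trans ?_
      rw [mul_assoc, two_mul]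
      gcongr
      exact (hφ' m (φ l)).trans (add_le_add (hmono hm) ((hφ l).trans (hmono hl)))
    rw [Np_eq_eLpNorm hp0] at h1
    refine lt_of_le_of_lt h1 ?_
    rw [hB]
    simp only [add_mul, one_mul]
    exact ENNReal.lt_add_right (ENNReal.mul_ne_top (ENNReal.mul_ne_top hC (by norm_num))
      (two_ne_top _)) (two_ne_zero' _)
  have hBsum : ∑' N, B N ≠ ∞ := by
    rw [hB, ENNReal.tsum_mul_left]
    refine ENNReal.mul_ne_top (ENNReal.add_ne_top.2 ⟨ENNReal.mul_ne_top hC (by norm_num),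
      ENNReal.one_ne_top⟩) ?_
    have := tsum_two_lt_top one_pos
    simpa using this.ne
  have hmem : ∀ k, MemLp (T j (φ k)) (ENNReal.ofReal p) (volume : Measure (Rn n)) := fun k =>
    ⟨(Cb_measurable _).aestronglyMeasurable, by
      rw [← Np_eq_eLpNorm hp0]
      exact (hT.Np_le hq j _).trans_lt (ENNReal.mul_lt_top hC.lt_top (Np_D_lt_top hp0 _))⟩
  obtain ⟨g, hg, hlim⟩ := Lp.cauchy_complete_eLpNorm (f := fun k => (T j (φ k) : Rn n → ℂ))
    (by simpa using hp) hmem hBsum hcau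
  refine ⟨AEEqFun.mk g hg.1, fun ψ => ?_⟩
  have hgm := Fn_measurable (AEEqFun.mk g hg.1)
  have hge : (AEEqFun.mk g hg.1 : Rn n → ℂ) =ᵐ[volume] g := AEEqFun.coeFn_mk _ _
  have hlim' : Tendsto (fun k => Np p (fun x => (AEEqFun.mk g hg.1 : Rn n → ℂ) x - T j (φ k) x) +
      C₂ * (two (-k) + Np p (fun x => f x - ψ x))) atTop
      (𝓝 (0 + C₂ * (0 + Np p (fun x => f x - ψ x)))) := by
    refine Tendsto.add ?_ (ENNReal.Tendsto.const_mul (Tendsto.add ?_ tendsto_const_nhds)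
      (Or.inr hC))
    · refine hlim.congr fun k => ?_
      rw [← Np_eq_eLpNorm hp0, Np_sub_comm]
      refine Np_congr ?_
      filter_upwards [hge] with x hx
      simp [hx]
    · exact tendsto_two_neg
  rw [zero_add, zero_add] at hlim'
  refine ge_of_tendsto' hlim' fun k => ?_
  refine (Np_triangle hp hgm (Cb_measurable (T j (φ k))) (Cb_measurable _)).trans ?_
  gcongr
  exact (hT.Np_sub_le hp0 hq j _ _).trans (mul_le_mul_right (hφ' k ψ) _)

theorem Adm.lpExt_spec (hT : Adm p q T C₁ C₂) (hp : 1 ≤ p) (hq : 0 < q) (j : ℕ) {f : Fn n}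
    (hf : Np p f < ∞) (φ : D n) :
    Np p (fun x => lpExt p C₂ (T j) f x - T j φ x) ≤ C₂ * Np p (fun x => f x - φ x) := by
  have h := hT.exists_ext hp hq j (Fn_measurable f) hf
  rw [lpExt, dif_pos h]
  exact h.choose_spec φ

theorem Adm.ae_tendsto_lpExt (hT : Adm p q T C₁ C₂) (hp : 1 ≤ p) (hq : 0 < q) (j : ℕ) {f : Fn n}
    (hf : Np p f < ∞) {φ : ℕ → D n} {C : ℝ≥0∞} (hC : C ≠ ∞)
    (hφ : ∀ k : ℕ, Np p (fun x => f x - φ k x) ≤ C * two (-k)) :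
    ∀ᵐ x, Tendsto (fun k => T j (φ k) x) atTop (𝓝 (lpExt p C₂ (T j) f x)) := by
  refine ae_tendsto_of_Np_le hp (Fn_measurable _) (fun k => Cb_measurable _)
    (ENNReal.mul_ne_top hT.C₂_ne_top hC) fun k => ?_
  refine (hT.lpExt_spec hp hq j hf (φ k)).trans ?_
  rw [mul_assoc]
  exact mul_le_mul_right (hφ k) _

theorem Adm.lpExt_ofD (hT : Adm p q T C₁ C₂) (hp : 1 ≤ p) (hq : 0 < q) (j : ℕ) {f : Fn n}
    {φ : D n} (hf : (f : Rn n → ℂ) =ᵐ[volume] φ) :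
    (lpExt p C₂ (T j) f : Rn n → ℂ) =ᵐ[volume] T j φ := by
  have hp0 : 0 < p := zero_lt_one.trans_le hp
  have hfp : Np p f < ∞ := by rw [Np_congr hf]; exact Np_D_lt_top hp0 φ
  have h := hT.lpExt_spec hp hq j hfp φ
  have h0 : Np p (fun x => f x - φ x) = 0 := by
    rw [Np_congr (g := fun _ => 0) (by filter_upwards [hf] with x hx; simp [hx])]
    simp [Np, nrm_zero hp0]
  rw [h0, mul_zero, nonpos_iff_eq_zero] at h
  have := ae_eq_zero_of_nrm_eq_zero hp0 ((Fn_measurable _).sub (Cb_measurable _)).enorm h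
  filter_upwards [this] with x hx
  simpa [sub_eq_zero] using hx

/-- A combination of two functions is approximated by the combination of the approximations. -/
theorem Np_comb_le (hp : 1 ≤ p) {f g h : Rn n → ℂ} (hf : Measurable f) (hg : Measurable g)
    (a b : ℂ) (hh : ∀ᵐ x, h x = a * f x + b * g x) {φ ψ χ : D n} (hχ : ∀ x, χ x = a * φ x + b * ψ x)
    {c : ℝ≥0∞} (h1 : Np p (fun x => f x - φ x) ≤ c) (h2 : Np p (fun x => g x - ψ x) ≤ c) :
    Np p (fun x => h x - χ x) ≤ (‖a‖ₑ + ‖b‖ₑ) * c := by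
  have hp0 : 0 < p := zero_lt_one.trans_le hp
  have hm1 : Measurable fun x => ‖f x - φ x‖ₑ := (hf.sub (D_measurable _)).enorm
  have hm2 : Measurable fun x => ‖g x - ψ x‖ₑ := (hg.sub (D_measurable _)).enorm
  calc Np p (fun x => h x - χ x)
      ≤ nrm p volume (fun x => ‖a‖ₑ * ‖f x - φ x‖ₑ + ‖b‖ₑ * ‖g x - ψ x‖ₑ) := by
        refine nrm_mono_ae hp0 ?_
        filter_upwards [hh] with x hx
        rw [hx, hχ, ← enorm_mul, ← enorm_mul]
        refine le_trans (le_of_eq ?_) (enorm_add_le _ _)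
        congr 1
        ring
    _ ≤ ‖a‖ₑ * c + ‖b‖ₑ * c := by
        refine (nrm_add_le hp (hm1.const_mul _).aemeasurable (hm2.const_mul _).aemeasurable).trans ?_
        rw [nrm_const_mul hp0 _ hm1, nrm_const_mul hp0 _ hm2]
        exact add_le_add (mul_le_mul_right h1 _) (mul_le_mul_right h2 _)
    _ = _ := (add_mul _ _ _).symm

theorem Adm.enorm_lpExt_sub_le (hT : Adm p q T C₁ C₂) (hp : 1 ≤ p) (hq : 0 < q) (j : ℕ)
    {f g h : Fn n} (hf : Np p f < ∞) (hg : Np p g < ∞) (hh : Np p h < ∞)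
    (hfg : ∀ᵐ x, h x = f x - g x) :
    ∀ᵐ x, ‖lpExt p C₂ (T j) f x - lpExt p C₂ (T j) g x‖ₑ ≤ ‖lpExt p C₂ (T j) h x‖ₑ := by
  obtain ⟨φ, hφ⟩ := exists_seq_D hp (Fn_measurable f) hf
  obtain ⟨ψ, hψ⟩ := exists_seq_D hp (Fn_measurable g) hg
  have h3 : ∀ k : ℕ, Np p (fun x => h x - (φ k - ψ k) x) ≤ (‖(1 : ℂ)‖ₑ + ‖(-1 : ℂ)‖ₑ) * two (-k) :=
    fun k => Np_comb_le hp (Fn_measurable f) (Fn_measurable g) 1 (-1)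
      (by filter_upwards [hfg] with x hx; rw [hx]; ring)
      (fun x => by rw [coe_D_sub]; ring) (hφ k) (hψ k)
  filter_upwards [hT.ae_tendsto_lpExt hp hq j hf ENNReal.one_ne_top
      (fun k => (hφ k).trans_eq (one_mul _).symm),
    hT.ae_tendsto_lpExt hp hq j hg ENNReal.one_ne_top
      (fun k => (hψ k).trans_eq (one_mul _).symm),
    hT.ae_tendsto_lpExt hp hq j hh (by simp) h3] with x h1 h2 h3
  exact le_of_tendsto_of_tendsto' (h1.sub h2).enorm h3.enorm fun k =>
    enorm_le_iff_norm_le.2 (hT.sub j _ _ x)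

theorem Adm.lpExt_linear (hT : Adm p q T C₁ C₂) (hp : 1 ≤ p) (hq : 0 < q) (j : ℕ)
    (hlin : IsLinearMap ℂ (T j))
    {f g h : Fn n} (hf : Np p f < ∞) (hg : Np p g < ∞) (hh : Np p h < ∞) (a b : ℂ)
    (hfg : ∀ᵐ x, h x = a * f x + b * g x) :
    ∀ᵐ x, lpExt p C₂ (T j) h x = a * lpExt p C₂ (T j) f x + b * lpExt p C₂ (T j) g x := by
  obtain ⟨φ, hφ⟩ := exists_seq_D hp (Fn_measurable f) hf
  obtain ⟨ψ, hψ⟩ := exists_seq_D hp (Fn_measurable g) hg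
  have h3 : ∀ k : ℕ, Np p (fun x => h x - (a • φ k + b • ψ k) x) ≤
      (‖a‖ₑ + ‖b‖ₑ) * two (-k) :=
    fun k => Np_comb_le hp (Fn_measurable f) (Fn_measurable g) a b hfg
      (fun x => rfl) (hφ k) (hψ k)
  filter_upwards [hT.ae_tendsto_lpExt hp hq j hf ENNReal.one_ne_top
      (fun k => (hφ k).trans_eq (one_mul _).symm),
    hT.ae_tendsto_lpExt hp hq j hg ENNReal.one_ne_top
      (fun k => (hψ k).trans_eq (one_mul _).symm),
    hT.ae_tendsto_lpExt hp hq j hh (by simp) h3] with x h1 h2 h3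
  refine tendsto_nhds_unique h3 (((h1.const_mul a).add (h2.const_mul b)).congr fun k => ?_)
  rw [hlin.map_add, hlin.map_smul, hlin.map_smul]
  rfl

/-- The size condition for the extension to `L_p`. -/
theorem Adm.enorm_lpExt_le (hT : Adm p q T C₁ C₂) (hn : 0 < n) (h : p.HolderConjugate p')
    (hq : 0 < q) (j : ℕ) (i : Idx n) {f : Fn n} (hf : Np p f < ∞)
    (hf0 : ∀ᵐ x, x ∈ kball i 2 → f x = 0) :
    ∀ᵐ y, y ∈ Q i → ‖lpExt p C₂ (T j) f y‖ₑ ≤ C₁ * ∫⁻ z, ‖f z‖ₑ * ker i z := by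
  have hp := h.lt.le
  have hkfin := nrm_ker_lt_top hn h i
  choose φ hφ0 hφ using fun k : ℕ => exists_D_approx_away hn hp i (Fn_measurable f) hf hf0
    (pos_iff_ne_zero.2 (two_ne_zero' (-k)))
  filter_upwards [hT.ae_tendsto_lpExt hp hq j hf ENNReal.one_ne_top
      (fun k => (hφ k).trans_eq (one_mul _).symm)] with y hy hyi
  -- the integrals for `φ_k` converge since the kernel belongs to `L_{p'}`
  have hint : ∀ k : ℕ, ∫⁻ z, ‖φ k z‖ₑ * ker i z ≤
      (∫⁻ z, ‖f z‖ₑ * ker i z) + two (-k) * nrm p' volume (ker i) := fun k => by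
    calc ∫⁻ z, ‖φ k z‖ₑ * ker i z
        ≤ ∫⁻ z, (‖f z‖ₑ * ker i z + ‖f z - φ k z‖ₑ * ker i z) := by
          refine lintegral_mono fun z => ?_
          rw [← add_mul]
          gcongr
          calc ‖φ k z‖ₑ = ‖f z - (f z - φ k z)‖ₑ := by congr 1; ring
            _ ≤ _ := enorm_sub_le
      _ = (∫⁻ z, ‖f z‖ₑ * ker i z) + ∫⁻ z, ‖f z - φ k z‖ₑ * ker i z :=
          lintegral_add_left (f := fun z => ‖f z‖ₑ * ker i z)
            ((Fn_measurable f).enorm.mul (measurable_ker i)) _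
      _ ≤ _ := by
          gcongr
          refine (nrm_holder h ((Fn_measurable f).sub (D_measurable _)).enorm.aemeasurable
            (measurable_ker i).aemeasurable).trans ?_
          gcongr
          exact hφ k
  have hlim : Tendsto (fun k : ℕ => C₁ * ((∫⁻ z, ‖f z‖ₑ * ker i z) +
      two (-k) * nrm p' volume (ker i))) atTop
      (𝓝 (C₁ * ((∫⁻ z, ‖f z‖ₑ * ker i z) + 0 * nrm p' volume (ker i)))) := by
    refine ENNReal.Tendsto.const_mul (Tendsto.add tendsto_const_nhds
      (ENNReal.Tendsto.mul_const tendsto_two_neg (Or.inr hkfin.ne))) (Or.inr hT.C₁_ne_top)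
  rw [zero_mul, add_zero] at hlim
  refine le_of_tendsto_of_tendsto' hy.enorm hlim fun k => ?_
  exact (hT.size j (φ k) i y hyi (hφ0 k)).trans (mul_le_mul_right (hint k) _)

theorem lq_trunc_le_add (hq : 1 ≤ q) (N : ℕ) {a b d : ℕ → ℝ≥0∞} (h : ∀ j, a j ≤ b j + d j) :
    lq q (trunc N a) ≤ lq q (trunc N b) + ∑ j ∈ Finset.range N, d j := by
  refine (lq_mono (zero_lt_one.trans_le hq) (b := fun j => trunc N b j + trunc N d j)
    fun j => ?_).trans ((lq_add_le hq _ _).trans ?_)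
  · unfold trunc
    split_ifs
    exacts [h j, by simp]
  · gcongr
    exact lq_trunc_le_sum hq N d

theorem measurable_trunc {F : ℕ → Rn n → ℝ≥0∞} (hF : ∀ j, Measurable (F j)) (N j : ℕ) :
    Measurable fun x => trunc N (fun j => F j x) j := by
  unfold trunc
  split_ifs
  exacts [hF j, measurable_const]

/-- The vector-valued bound for the extension to `L_p`. -/
theorem Adm.nrm_lq_lpExt_le (hT : Adm p q T C₁ C₂) (hp : 1 ≤ p) (hq : 1 ≤ q) {f : ℕ → Fn n}
    (hf : ∀ j, Np p (f j) < ∞) :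
    nrm p volume (fun x => lq q fun j => ‖lpExt p C₂ (T j) (f j) x‖ₑ) ≤
      C₂ * nrm p volume (fun x => lq q fun j => ‖f j x‖ₑ) := by
  have hp0 : 0 < p := zero_lt_one.trans_le hp
  have hq0 : 0 < q := zero_lt_one.trans_le hq
  have hC := hT.C₂_ne_top
  have hSm : ∀ j, Measurable fun x => ‖lpExt p C₂ (T j) (f j) x‖ₑ := fun j =>
    (Fn_measurable _).enorm
  have hfm : ∀ j, Measurable fun x => ‖f j x‖ₑ := fun j => (Fn_measurable _).enorm
  -- by Fatou's lemma it suffices to treat the first `N` components, for which an approximation by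
  -- test functions in each component separately is an approximation in the vector-valued norm
  refine nrm_le_of_le_liminf hp0 (u := atTop)
    (F := fun N x => lq q (trunc N fun j => ‖lpExt p C₂ (T j) (f j) x‖ₑ))
    (fun N => measurable_lq fun j => measurable_trunc hSm N j)
    (.of_forall fun x => lq_le_iSup_trunc hq0 _) fun N => ?_
  choose φ hφ using fun j => exists_seq_D hp (Fn_measurable (f j)) (hf j)
  refine le_of_forall_two (C := C₂ * N + C₂ * N) (by finiteness) fun k => ?_
  have hTm : ∀ j, Measurable fun x => ‖T j (φ j k) x‖ₑ := fun j => (Cb_measurable _).enorm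
  have hφm : ∀ j, Measurable fun x => ‖φ j k x‖ₑ := fun j => (D_measurable _).enorm
  have hSTm : ∀ j, Measurable fun x => ‖lpExt p C₂ (T j) (f j) x - T j (φ j k) x‖ₑ := fun j =>
    ((Fn_measurable _).sub (Cb_measurable _)).enorm
  have hfφm : ∀ j, Measurable fun x => ‖f j x - φ j k x‖ₑ := fun j =>
    ((Fn_measurable _).sub (D_measurable _)).enorm
  have h1 : nrm p volume (fun x => lq q (trunc N fun j => ‖lpExt p C₂ (T j) (f j) x‖ₑ)) ≤
      nrm p volume (fun x => lq q (trunc N fun j => ‖T j (φ j k) x‖ₑ)) + C₂ * N * two (-k) := by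
    refine (nrm_mono hp0 fun x => lq_trunc_le_add hq N (b := fun j => ‖T j (φ j k) x‖ₑ)
      (d := fun j => ‖lpExt p C₂ (T j) (f j) x - T j (φ j k) x‖ₑ) fun j => ?_).trans ?_
    · calc _ = ‖T j (φ j k) x + (lpExt p C₂ (T j) (f j) x - T j (φ j k) x)‖ₑ := by congr 1; ring
        _ ≤ _ := enorm_add_le _ _
    · refine (nrm_add_le hp (measurable_lq fun j => measurable_trunc hTm N j).aemeasurable
        (Finset.measurable_fun_sum _ fun j _ => hSTm j).aemeasurable).trans ?_
      gcongr
      refine (nrm_sum_le hp _ fun j => (hSTm j).aemeasurable).trans ?_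
      refine (Finset.sum_le_card_nsmul _ _ (C₂ * two (-k)) fun j _ => ?_).trans_eq ?_
      · exact (hT.lpExt_spec hp hq0 j (hf j) (φ j k)).trans (mul_le_mul_right (hφ j k) _)
      · rw [Finset.card_range, nsmul_eq_mul]; ring
  have h2 : nrm p volume (fun x => lq q (trunc N fun j => ‖T j (φ j k) x‖ₑ)) ≤
      C₂ * nrm p volume (fun x => lq q (trunc N fun j => ‖φ j k x‖ₑ)) := by
    have hb := hT.bdd (fun j => trunc N (fun j => φ j k) j)
    refine (le_of_eq ?_).trans (hb.trans_eq ?_)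
    · congr 1; funext x; congr 1; funext j
      unfold trunc
      split_ifs <;> simp [hT.zero]
    · congr 2; funext x; congr 1; funext j
      unfold trunc
      split_ifs <;> simp
  have h3 : nrm p volume (fun x => lq q (trunc N fun j => ‖φ j k x‖ₑ)) ≤
      nrm p volume (fun x => lq q fun j => ‖f j x‖ₑ) + N * two (-k) := by
    refine (nrm_mono hp0 fun x => lq_trunc_le_add hq N (b := fun j => ‖f j x‖ₑ)
      (d := fun j => ‖f j x - φ j k x‖ₑ) fun j => ?_).trans ?_
    · calc _ = ‖f j x - (f j x - φ j k x)‖ₑ := by congr 1; ring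
        _ ≤ _ := enorm_sub_le
    · refine (nrm_add_le hp (measurable_lq fun j => measurable_trunc hfm N j).aemeasurable
        (Finset.measurable_fun_sum _ fun j _ => hfφm j).aemeasurable).trans ?_
      refine add_le_add (nrm_mono hp0 fun x => lq_mono hq0 fun j => trunc_le N _ j) ?_
      refine (nrm_sum_le hp _ fun j => (hfφm j).aemeasurable).trans ?_
      refine (Finset.sum_le_card_nsmul _ _ (two (-k)) fun j _ => hφ j k).trans_eq ?_
      rw [Finset.card_range, nsmul_eq_mul]
  calc _ ≤ _ := h1
    _ ≤ C₂ * (nrm p volume (fun x => lq q fun j => ‖f j x‖ₑ) + N * two (-k)) +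
        C₂ * N * two (-k) := by
      gcongr
      exact h2.trans (mul_le_mul_right h3 _)
    _ = _ := by ring

end Ext

end

section

variable {n : ℕ} {p p' q q' r ϱ s : ℝ}

/-! ### Morrey estimates for the extension to `L_p` -/

section MorreyExt

variable {T : ℕ → D n → Cb n} {C₁ C₂ : ℝ≥0∞}

/-- The class of `1_A f`. -/
noncomputable def cut {A : Set (Rn n)} (hA : MeasurableSet A) (f : Fn n) : Fn n :=
  AEEqFun.mk (A.indicator f) (f.stronglyMeasurable.indicator hA).aestronglyMeasurable

theorem coe_cut {A : Set (Rn n)} (hA : MeasurableSet A) (f : Fn n) :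
    (cut hA f : Rn n → ℂ) =ᵐ[volume] A.indicator f := AEEqFun.coeFn_mk _ _

theorem coe_sub (f g : Fn n) : ∀ᵐ x, (f - g : Fn n) x = f x - g x := AEEqFun.coeFn_sub f g

theorem enorm_indicator_eq (A : Set (Rn n)) (f : Rn n → ℂ) (x : Rn n) :
    ‖A.indicator f x‖ₑ = A.indicator (fun x => ‖f x‖ₑ) x := by
  by_cases hx : x ∈ A <;> simp [hx]

theorem Np_cut (hp : 0 < p) {A : Set (Rn n)} (hA : MeasurableSet A) (f : Fn n) :
    Np p (cut hA f) = lpNorm p A (fun x => ‖f x‖ₑ) := by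
  rw [Np_congr (coe_cut hA f), Np, lpNorm_eq_nrm, nrm_restrict hp hA]
  simp_rw [enorm_indicator_eq]

theorem lpNorm_mono_set (hp : 0 < p) {A B : Set (Rn n)} (h : A ⊆ B) (F : Rn n → ℝ≥0∞) :
    lpNorm p A F ≤ lpNorm p B F :=
  nrm_mono_measure hp (Measure.restrict_mono h le_rfl) F

theorem lpNorm_le_Np (hp : 0 < p) (A : Set (Rn n)) (f : Rn n → ℂ) :
    lpNorm p A (fun x => ‖f x‖ₑ) ≤ Np p f :=
  nrm_mono_measure hp Measure.restrict_le_self _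

theorem Np_coe_sub_le (hp : 1 ≤ p) (f g : Fn n) : Np p (f - g : Fn n) ≤ Np p f + Np p g := by
  rw [Np_congr (g := fun x => f x - g x) (coe_sub f g)]
  refine (nrm_mono (zero_lt_one.trans_le hp) fun x => ?_).trans (nrm_add_le hp
    (Fn_measurable f).enorm.aemeasurable (Fn_measurable g).enorm.aemeasurable)
  exact enorm_sub_le

/-- The constant in the Morrey estimates: the contribution of the part near a cube plus that of the
far part. -/
noncomputable def morreyC (n : ℕ) (p p' s : ℝ) (C₁ C₂ : ℝ≥0∞) : ℝ≥0∞ :=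
  C₂ * two ((n + 3) * s) + volC n ^ (1 / p) * (C₁ * kerC n p' s (n / p - s))

theorem morreyC_ne_top (h : p.HolderConjugate p') (hsn : s < n / p) (h₁ : C₁ ≠ ∞) (h₂ : C₂ ≠ ∞) :
    morreyC n p p' s C₁ C₂ ≠ ∞ := by
  have hp0 : 0 < p := h.pos
  refine ENNReal.add_ne_top.2 ⟨ENNReal.mul_ne_top h₂ (two_ne_top _), ENNReal.mul_ne_top ?_
    (ENNReal.mul_ne_top h₁ (kerC_lt_top h.symm.pos (by linarith)).ne)⟩
  exact ENNReal.rpow_ne_top_of_nonneg (by positivity) volC_ne_top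

/-- The vector-valued Morrey bound on `L_p` functions: near a cube by the `L_p` bound, away from it
by the size condition. -/
theorem Adm.mn_lq_lpExt_le (hT : Adm p q T C₁ C₂) (hn : 0 < n) (h : p.HolderConjugate p')
    (hqq : q.HolderConjugate q') {f : ℕ → Fn n}
    (hf : ∀ j, Np p (f j) < ∞) :
    mn p s (fun x => lq q fun j => ‖lpExt p C₂ (T j) (f j) x‖ₑ) ≤
      morreyC n p p' s C₁ C₂ * mn p s (fun x => lq q fun j => ‖f j x‖ₑ) := by
  have hp := h.lt.le
  have hp0 : 0 < p := h.pos
  have hq := hqq.lt.le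
  have hq0 : 0 < q := hqq.pos
  set N := mn p s (fun x => lq q fun j => ‖f j x‖ₑ) with hN
  rcases eq_or_ne N ∞ with htop | htop
  · rcases eq_or_ne (morreyC n p p' s C₁ C₂) 0 with h0 | h0
    · -- a vanishing constant forces the extension to vanish
      have hC₂ : C₂ = 0 := by
        have := (add_eq_zero.1 h0).1
        rcases mul_eq_zero.1 this with h1 | h1
        · exact h1
        · exact absurd h1 (two_ne_zero' _)
      have hz := hT.nrm_lq_lpExt_le hp hq hf
      rw [hC₂, zero_mul, nonpos_iff_eq_zero] at hz
      have hm : Measurable fun x => lq q fun j => ‖lpExt p 0 (T j) (f j) x‖ₑ :=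
        measurable_lq fun j => (Fn_measurable _).enorm
      have := ae_eq_zero_of_nrm_eq_zero hp0 hm hz
      rw [hC₂, mn_congr_ae hp0 (G := fun _ => 0) this]
      have : mn p s (fun _ : Rn n => (0 : ℝ≥0∞)) = 0 := by
        simp [mn, lpNorm_eq_nrm, nrm_zero hp0]
      rw [this]
      exact zero_le
    · rw [htop, ENNReal.mul_top h0]
      exact le_top
  have hSm : ∀ j, Measurable fun x => ‖lpExt p C₂ (T j) (f j) x‖ₑ := fun j =>
    (Fn_measurable _).enorm
  have hfm : ∀ j, Measurable fun x => ‖f j x‖ₑ := fun j => (Fn_measurable _).enorm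
  rw [mn_le_iff]
  intro i
  have hB := measurableSet_kball i 2
  -- the part `g` of the sequence near the cube and the remainder `d`
  set g : ℕ → Fn n := fun j => cut hB (f j) with hg
  set d : ℕ → Fn n := fun j => f j - g j with hd
  have hgp : ∀ j, Np p (g j) < ∞ := fun j => by
    rw [hg, Np_cut hp0]
    exact (lpNorm_le_Np hp0 _ _).trans_lt (hf j)
  have hdp : ∀ j, Np p (d j) < ∞ := fun j =>
    (Np_coe_sub_le hp _ _).trans_lt (ENNReal.add_lt_top.2 ⟨hf j, hgp j⟩)
  have hd0 : ∀ j, ∀ᵐ x, x ∈ kball i 2 → d j x = 0 := fun j => by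
    filter_upwards [coe_sub (f j) (g j), coe_cut hB (f j)] with x h1 h2 hx
    rw [hd, h1, hg, h2, indicator_of_mem hx, sub_self]
  have hdle : ∀ j, ∀ᵐ x, ‖d j x‖ₑ ≤ ‖f j x‖ₑ := fun j => by
    filter_upwards [coe_sub (f j) (g j), coe_cut hB (f j)] with x h1 h2
    rw [hd, h1, hg, h2]
    by_cases hx : x ∈ kball i 2 <;> simp [hx]
  set I : ℕ → ℝ≥0∞ := fun j => C₁ * ∫⁻ z, ‖d j z‖ₑ * ker i z with hI
  have hptw : ∀ᵐ x, x ∈ Q i → (lq q fun j => ‖lpExt p C₂ (T j) (f j) x‖ₑ) ≤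
      (lq q fun j => ‖lpExt p C₂ (T j) (g j) x‖ₑ) + lq q I := by
    filter_upwards [ae_all_iff.2 fun j => hT.enorm_lpExt_sub_le hp hq0 j (hf j) (hgp j) (hdp j)
      (coe_sub (f j) (g j)), ae_all_iff.2 fun j => hT.enorm_lpExt_le hn h hq0 j i (hdp j) (hd0 j)]
      with x h1 h2 hx
    refine (lq_mono hq0 fun j => ?_).trans (lq_add_le hq _ _)
    calc ‖lpExt p C₂ (T j) (f j) x‖ₑ = ‖lpExt p C₂ (T j) (g j) x +
          (lpExt p C₂ (T j) (f j) x - lpExt p C₂ (T j) (g j) x)‖ₑ := by congr 1; ring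
      _ ≤ _ := enorm_add_le _ _
      _ ≤ _ := by gcongr; exact (h1 j).trans (h2 j hx)
  -- the near part lives in the cube `enl i 2` of generation `i.1 - 2 - (n + 1)`
  have hnear : nrm p volume (fun x => lq q fun j => ‖lpExt p C₂ (T j) (g j) x‖ₑ) ≤
      C₂ * (two (-((i.1 - 2 - (n + 1)) * s)) * N) := by
    refine (hT.nrm_lq_lpExt_le hp hq hgp).trans ?_
    gcongr
    calc nrm p volume (fun x => lq q fun j => ‖g j x‖ₑ)
        = lpNorm p (kball i 2) (fun x => lq q fun j => ‖f j x‖ₑ) := by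
          rw [lpNorm_eq_nrm, nrm_restrict hp0 hB]
          refine nrm_congr_ae ?_
          filter_upwards [ae_all_iff.2 fun j => coe_cut hB (f j)] with x hx
          simp_rw [hg, hx]
          by_cases hxb : x ∈ kball i 2
          · simp [hxb]
          · simp only [hxb, not_false_eq_true, indicator_of_notMem, enorm_zero]
            exact nrm_zero hq0
      _ ≤ lpNorm p (Q (enl i 2)) (fun x => lq q fun j => ‖f j x‖ₑ) :=
          lpNorm_mono_set hp0 (kball_subset_enl i 2) _
      _ ≤ _ := by
          refine (lpNorm_Q_le_mn (s := s) _ _).trans_eq ?_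
          rw [enl_fst]
          norm_cast
  -- Minkowski's inequality moves the `ℓ_q` norm under the integral, which is then a pairing of the
  -- Morrey space with its predual
  have hfar : lq q I ≤ C₁ * (N * (kerC n p' s (n / p - s) * two (i.1 * (n / p - s)))) := by
    rw [hI, lq_const_mul hq0]
    gcongr
    refine (lq_lintegral_le hqq fun j =>
      (Fn_measurable (d j)).enorm.mul (measurable_ker i)).trans ?_
    calc ∫⁻ z, lq q (fun j => ‖d j z‖ₑ * ker i z)
        ≤ ∫⁻ z, (lq q fun j => ‖f j z‖ₑ) * ker i z := by
          refine lintegral_mono_ae ?_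
          filter_upwards [ae_all_iff.2 hdle] with z hz
          rw [lq_mul_const hq0]
          gcongr
          exact lq_mono hq0 hz
      _ ≤ N * pn p' s (ker i) := lintegral_mul_le_mn_mul_pn h (measurable_lq hfm) htop
      _ ≤ _ := by
          gcongr
          exact pn_ker_le h i
  have hcube : lpNorm p (Q i) (fun x => lq q fun j => ‖lpExt p C₂ (T j) (f j) x‖ₑ) ≤
      C₂ * (two (-((i.1 - 2 - (n + 1)) * s)) * N) +
      C₁ * (N * (kerC n p' s (n / p - s) * two (i.1 * (n / p - s)))) *
        (volC n ^ (1 / p) * two (-(i.1 * (n * (1 / p))))) := by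
    have hm : Measurable fun x => lq q fun j => ‖lpExt p C₂ (T j) (g j) x‖ₑ :=
      measurable_lq fun j => (Fn_measurable _).enorm
    refine (nrm_mono_ae hp0 ((ae_restrict_iff' (measurableSet_Q i)).2 hptw)).trans ?_
    refine (nrm_add_le hp hm.aemeasurable aemeasurable_const).trans ?_
    refine add_le_add ((nrm_mono_measure hp0 Measure.restrict_le_self _).trans hnear) ?_
    rw [nrm_const hp0, Measure.restrict_apply_univ]
    exact mul_le_mul' hfar (volume_Q_rpow_le (by positivity) i)
  refine (mul_le_mul_right hcube _).trans_eq ?_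
  have e1 : two (i.1 * s) * two (-((i.1 - 2 - (n + 1)) * s)) = two ((n + 3) * s) := by
    rw [← two_add]; congr 1; ring
  have e2 : two (i.1 * s) * (two (i.1 * (n / p - s)) * two (-(i.1 * (n * (1 / p))))) = 1 := by
    rw [← two_add, ← two_add, ← two_zero]; congr 1; ring
  calc _ = C₂ * (two (i.1 * s) * two (-((i.1 - 2 - (n + 1)) * s))) * N +
        (two (i.1 * s) * (two (i.1 * (n / p - s)) * two (-(i.1 * (n * (1 / p)))))) *
          (C₁ * N * kerC n p' s (n / p - s) * volC n ^ (1 / p)) := by ring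
    _ = _ := by rw [e1, e2, morreyC]; ring

/-! ### The extension to the Morrey space -/

/-- The class of `1_{B(0,2^K)} f`. -/
noncomputable def cutB (K : ℕ) (f : Fn n) : Fn n :=
  cut (A := Metric.ball 0 (2 ^ K)) Metric.isOpen_ball.measurableSet f

theorem coe_cutB (K : ℕ) (f : Fn n) :
    (cutB K f : Rn n → ℂ) =ᵐ[volume] (Metric.ball 0 (2 ^ K)).indicator f := coe_cut _ _

theorem Np_cutB_lt_top (hp : 0 < p) {f : Fn n} (hf : mn p s (fun x => ‖f x‖ₑ) < ∞) (K : ℕ) :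
    Np p (cutB K f) < ∞ := by
  obtain ⟨i, hi⟩ := exists_ball_subset_Q (n := n) (2 ^ K)
  rw [cutB, Np_cut hp]
  refine (lpNorm_mono_set hp (Metric.ball_subset_closedBall.trans hi) _).trans_lt ?_
  exact (lpNorm_Q_le_mn (s := s) _ _).trans_lt (ENNReal.mul_lt_top (two_lt_top _) hf)

/-- The extension of `T` to the Morrey space: the limit almost everywhere of the values at
`1_{B(0,2^K)} f` of the extension to `L_p`. -/
noncomputable def mext (p : ℝ) (C : ℝ≥0∞) (T : D n → Cb n) (f : Fn n) : Fn n :=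
  open scoped Classical in
  if h : ∃ g : Fn n, ∀ᵐ x, Tendsto (fun K => lpExt p C T (cutB K f) x) atTop (𝓝 (g x))
  then h.choose else 0

/-- The increments of the truncations have disjoint supports. -/
theorem tsum_enorm_cutB_le (f : Fn n) :
    ∀ᵐ x, ∑' K, ‖(cutB (K + 1) f - cutB K f : Fn n) x‖ₑ ≤ ‖f x‖ₑ := by
  filter_upwards [ae_all_iff.2 fun K => coe_sub (cutB (K + 1) f) (cutB K f),
    ae_all_iff.2 fun K => coe_cutB K f] with x h1 h2
  simp_rw [h1, h2]
  refine ENNReal.tsum_le_of_sum_range_le fun N => ?_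
  have key : ∑ K ∈ Finset.range N, ‖(Metric.ball 0 (2 ^ (K + 1))).indicator f x -
      (Metric.ball 0 (2 ^ K)).indicator f x‖ₑ ≤ ‖(Metric.ball 0 (2 ^ N)).indicator f x‖ₑ := by
    induction N with
    | zero => simp
    | succ N ih =>
      rw [Finset.sum_range_succ]
      by_cases hN : x ∈ Metric.ball (0 : Rn n) (2 ^ N)
      · have hN' : x ∈ Metric.ball (0 : Rn n) (2 ^ (N + 1)) :=
          Metric.ball_subset_ball (pow_le_pow_right₀ one_le_two (Nat.le_succ N)) hN
        simp only [indicator_of_mem hN, indicator_of_mem hN', sub_self, enorm_zero, add_zero]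
        rwa [indicator_of_mem hN] at ih
      · rw [indicator_of_notMem hN, enorm_zero, nonpos_iff_eq_zero] at ih
        rw [ih, zero_add, indicator_of_notMem hN, sub_zero]
  refine key.trans ?_
  rw [enorm_indicator_eq]
  exact indicator_le_self' (fun _ _ => zero_le) x

/-- The images of the truncations converge almost everywhere on each cube: all but finitely many
increments vanish near the cube, and their images there are summable by the size condition. -/
theorem Adm.exists_mext (hT : Adm p q T C₁ C₂) (hn : 0 < n) (h : p.HolderConjugate p')
    (hq : 0 < q) (hsn : s < n / p) (j : ℕ) {f : Fn n} (hf : mn p s (fun x => ‖f x‖ₑ) < ∞) :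
    ∃ g : Fn n, ∀ᵐ x, Tendsto (fun K => lpExt p C₂ (T j) (cutB K f) x) atTop (𝓝 (g x)) := by
  have hp := h.lt.le
  have hp0 : 0 < p := h.pos
  suffices hex : ∀ᵐ x, ∃ l, Tendsto (fun K => lpExt p C₂ (T j) (cutB K f) x) atTop (𝓝 l) by
    obtain ⟨g, hg, hlim⟩ := exists_stronglyMeasurable_limit_of_tendsto_ae
      (fun K => (Fn_measurable (lpExt p C₂ (T j) (cutB K f))).aestronglyMeasurable) hex
    refine ⟨AEEqFun.mk g hg.aestronglyMeasurable, ?_⟩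
    filter_upwards [hlim, AEEqFun.coeFn_mk g hg.aestronglyMeasurable] with x h1 h2
    rwa [h2]
  refine ae_of_ae_Q fun i => ?_
  set c : ℕ → Fn n := fun K => cutB (K + 1) f - cutB K f with hc
  have hKp := Np_cutB_lt_top hp0 hf
  have hcp : ∀ K, Np p (c K) < ∞ := fun K =>
    (Np_coe_sub_le hp _ _).trans_lt (ENNReal.add_lt_top.2 ⟨hKp _, hKp _⟩)
  obtain ⟨K₀, hK₀⟩ := pow_unbounded_of_one_lt (‖ctr i‖ + 2 ^ 2 * rad i) (one_lt_two : (1 : ℝ) < 2)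
  -- the increments vanish near the cube from the index `K₀` on
  have hc0 : ∀ K, ∀ᵐ x, x ∈ kball i 2 → c (K + K₀) x = 0 := fun K => by
    have hsub : ∀ m, K₀ ≤ m → kball i 2 ⊆ Metric.ball (0 : Rn n) (2 ^ m) := fun m hm =>
      Metric.ball_subset_ball' (by
        rw [dist_zero_right]
        have := pow_le_pow_right₀ (one_le_two : (1 : ℝ) ≤ 2) hm
        linarith)
    filter_upwards [coe_sub (cutB (K + K₀ + 1) f) (cutB (K + K₀) f), coe_cutB (K + K₀) f,
      coe_cutB (K + K₀ + 1) f] with x h1 h2 h3 hx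
    rw [hc, h1, h2, h3, indicator_of_mem (hsub _ (by omega) hx),
      indicator_of_mem (hsub _ (by omega) hx), sub_self]
  have hsum : ∑' K, C₁ * ∫⁻ z, ‖c (K + K₀) z‖ₑ * ker i z ≠ ∞ := by
    rw [ENNReal.tsum_mul_left]
    refine ENNReal.mul_ne_top hT.C₁_ne_top (ne_of_lt ?_)
    have hm : ∀ K, Measurable fun z => ‖c (K + K₀) z‖ₑ * ker i z := fun K =>
      (Fn_measurable _).enorm.mul (measurable_ker i)
    rw [← lintegral_tsum fun K => (hm K).aemeasurable]
    calc ∫⁻ z, ∑' K, ‖c (K + K₀) z‖ₑ * ker i z ≤ ∫⁻ z, ‖f z‖ₑ * ker i z := by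
          refine lintegral_mono_ae ?_
          filter_upwards [tsum_enorm_cutB_le f] with z hz
          rw [ENNReal.tsum_mul_right]
          gcongr
          refine le_trans ?_ hz
          exact ENNReal.tsum_comp_le_tsum_of_injective (add_left_injective K₀)
            (fun K => ‖c K z‖ₑ)
      _ ≤ _ := lintegral_mul_le_mn_mul_pn (s := s) h (Fn_measurable f).enorm hf.ne
      _ < ∞ := ENNReal.mul_lt_top hf ((pn_ker_le h i).trans_lt
          (ENNReal.mul_lt_top (kerC_lt_top h.symm.pos (by linarith)) (two_lt_top _)))
  filter_upwards [ae_all_iff.2 fun K => hT.enorm_lpExt_le hn h hq j i (hcp (K + K₀)) (hc0 K),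
    ae_all_iff.2 fun K => hT.enorm_lpExt_sub_le hp hq j (hKp (K + 1)) (hKp K) (hcp K)
      (coe_sub (cutB (K + 1) f) (cutB K f))] with x h1 h2 hx
  have hcau : CauchySeq fun K => lpExt p C₂ (T j) (cutB (K + K₀) f) x := by
    refine cauchySeq_of_edist_le_of_tsum_ne_top _ (fun K => ?_) hsum
    rw [edist_comm, edist_eq_enorm_sub, show K.succ + K₀ = K + K₀ + 1 by omega]
    exact (h2 (K + K₀)).trans (h1 K hx)
  obtain ⟨l, hl⟩ := cauchySeq_tendsto_of_complete hcau
  exact ⟨l, (tendsto_add_atTop_iff_nat K₀).1 hl⟩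

theorem Adm.mext_spec (hT : Adm p q T C₁ C₂) (hn : 0 < n) (h : p.HolderConjugate p')
    (hq : 0 < q) (hsn : s < n / p) (j : ℕ) {f : Fn n} (hf : mn p s (fun x => ‖f x‖ₑ) < ∞) :
    ∀ᵐ x, Tendsto (fun K => lpExt p C₂ (T j) (cutB K f) x) atTop
      (𝓝 (mext p C₂ (T j) f x)) := by
  have hex := hT.exists_mext hn h hq hsn j hf
  rw [mext, dif_pos hex]
  exact hex.choose_spec

theorem Adm.mext_ofD (hT : Adm p q T C₁ C₂) (hn : 0 < n) (h : p.HolderConjugate p')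
    (hq : 0 < q) (hsn : s < n / p) (j : ℕ) (φ : D n)
    (hf : mn p s (fun x => ‖ofD φ x‖ₑ) < ∞) : mext p C₂ (T j) (ofD φ) = ofC (T j φ) := by
  refine AEEqFun.ext ?_
  obtain ⟨R, hR⟩ := φ.hasCompactSupport.isCompact.isBounded.subset_closedBall 0
  obtain ⟨K₀, hK₀⟩ := pow_unbounded_of_one_lt R (one_lt_two : (1 : ℝ) < 2)
  have hK : ∀ K, K₀ ≤ K → (cutB K (ofD φ) : Rn n → ℂ) =ᵐ[volume] φ := fun K hK => by
    filter_upwards [coe_cutB K (ofD φ), coe_ofD φ] with x h1 h2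
    rw [h1]
    by_cases hx : x ∈ Metric.ball (0 : Rn n) (2 ^ K)
    · rw [indicator_of_mem hx, h2]
    · rw [indicator_of_notMem hx]
      refine (image_eq_zero_of_notMem_tsupport fun hx' => hx ?_).symm
      refine Metric.closedBall_subset_ball ?_ (hR hx')
      exact hK₀.trans_le (pow_le_pow_right₀ one_le_two hK)
  filter_upwards [hT.mext_spec hn h hq hsn j hf, coe_ofC (T j φ), ae_all_iff.2 fun K =>
    hT.lpExt_ofD h.lt.le hq j (hK (K + K₀) (by omega))] with x h1 h2 h3
  rw [h2]
  refine tendsto_nhds_unique ((tendsto_add_atTop_iff_nat K₀).2 h1) ?_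
  simp_rw [h3]
  exact tendsto_const_nhds

theorem Adm.mext_linear (hT : Adm p q T C₁ C₂) (hn : 0 < n) (h : p.HolderConjugate p')
    (hq : 0 < q) (hsn : s < n / p) (j : ℕ) (hlin : IsLinearMap ℂ (T j)) {f g k : Fn n}
    (hf : mn p s (fun x => ‖f x‖ₑ) < ∞) (hg : mn p s (fun x => ‖g x‖ₑ) < ∞)
    (hk : mn p s (fun x => ‖k x‖ₑ) < ∞) (a b : ℂ) (hfg : ∀ᵐ x, k x = a * f x + b * g x) :
    ∀ᵐ x, mext p C₂ (T j) k x = a * mext p C₂ (T j) f x + b * mext p C₂ (T j) g x := by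
  have hp0 : 0 < p := h.pos
  have hcut : ∀ K, ∀ᵐ x, cutB K k x = a * cutB K f x + b * cutB K g x := fun K => by
    filter_upwards [coe_cutB K f, coe_cutB K g, coe_cutB K k, hfg] with x h1 h2 h3 h4
    rw [h1, h2, h3]
    by_cases hx : x ∈ Metric.ball (0 : Rn n) (2 ^ K) <;> simp [hx, h4]
  filter_upwards [hT.mext_spec hn h hq hsn j hf, hT.mext_spec hn h hq hsn j hg,
    hT.mext_spec hn h hq hsn j hk, ae_all_iff.2 fun K => hT.lpExt_linear h.lt.le hq j hlin
      (Np_cutB_lt_top hp0 hf K) (Np_cutB_lt_top hp0 hg K) (Np_cutB_lt_top hp0 hk K) a b (hcut K)]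
    with x h1 h2 h3 h4
  exact tendsto_nhds_unique h3 (((h1.const_mul a).add (h2.const_mul b)).congr fun K => (h4 K).symm)

/-- The extension is Lipschitz continuous with respect to the vector-valued Morrey norm. -/
theorem Adm.mn_lq_mext_sub_le (hT : Adm p q T C₁ C₂) (hn : 0 < n) (h : p.HolderConjugate p')
    (hqq : q.HolderConjugate q') (hsn : s < n / p) {f g : ℕ → Fn n}
    (hf : ∀ j, mn p s (fun x => ‖f j x‖ₑ) < ∞) (hg : ∀ j, mn p s (fun x => ‖g j x‖ₑ) < ∞) :
    mn p s (fun x => lq q fun j => ‖mext p C₂ (T j) (f j) x - mext p C₂ (T j) (g j) x‖ₑ) ≤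
      morreyC n p p' s C₁ C₂ * mn p s (fun x => lq q fun j => ‖f j x - g j x‖ₑ) := by
  have hp := h.lt.le
  have hp0 : 0 < p := h.pos
  have hq0 : 0 < q := hqq.pos
  set d : ℕ → ℕ → Fn n := fun K j => cutB K (f j) - cutB K (g j) with hd
  have hfp := fun j => Np_cutB_lt_top hp0 (hf j)
  have hgp := fun j => Np_cutB_lt_top hp0 (hg j)
  have hdp : ∀ K j, Np p (d K j) < ∞ := fun K j =>
    (Np_coe_sub_le hp _ _).trans_lt (ENNReal.add_lt_top.2 ⟨hfp j K, hgp j K⟩)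
  have hm : ∀ K j, Measurable fun x => ‖lpExt p C₂ (T j) (d K j) x‖ₑ := fun K j =>
    (Fn_measurable _).enorm
  refine mn_le_of_le_liminf hp0
    (F := fun K x => lq q fun j => ‖lpExt p C₂ (T j) (d K j) x‖ₑ)
    (fun K => measurable_lq (hm K)) ?_ fun K => ?_
  · filter_upwards [ae_all_iff.2 fun j => hT.mext_spec hn h hq0 hsn j (hf j),
      ae_all_iff.2 fun j => hT.mext_spec hn h hq0 hsn j (hg j),
      ae_all_iff.2 fun j => ae_all_iff.2 fun K => hT.enorm_lpExt_sub_le hp hq0 j (hfp j K)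
        (hgp j K) (hdp K j) (coe_sub _ _)] with x h1 h2 h3
    refine le_trans (lq_mono hq0 fun j => ?_)
      (nrm_liminf_le (μ := Measure.count) hq0 (u := atTop)
        (F := fun K j => ‖lpExt p C₂ (T j) (d K j) x‖ₑ) fun K => .of_discrete)
    rw [← (((h1 j).sub (h2 j)).enorm).liminf_eq]
    exact liminf_le_liminf (.of_forall (h3 j))
  · refine (hT.mn_lq_lpExt_le hn h hqq (hdp K)).trans ?_
    gcongr
    refine mn_mono_ae hp0 ?_
    filter_upwards [ae_all_iff.2 fun j => coe_cutB K (f j),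
      ae_all_iff.2 fun j => coe_cutB K (g j),
      ae_all_iff.2 fun j => coe_sub (cutB K (f j)) (cutB K (g j))] with x h1 h2 h3
    refine lq_mono hq0 fun j => ?_
    rw [hd, h3 j, h1 j, h2 j]
    by_cases hx : x ∈ Metric.ball (0 : Rn n) (2 ^ K) <;> simp [hx]

end MorreyExt

end

section

variable {n : ℕ} {p p' q q' r ϱ s : ℝ}

/-! ### Admissible operators -/

theorem exists_two_lt {C ε : ℝ≥0∞} (hC : C ≠ ∞) (hε : 0 < ε) : ∃ k : ℕ, C * two (-k) < ε := by
  have h : Tendsto (fun k : ℕ => C * two (-(k : ℝ))) atTop (𝓝 (C * 0)) :=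
    ENNReal.Tendsto.const_mul tendsto_two_neg (Or.inr hC)
  rw [mul_zero] at h
  exact (h.eventually_lt_const hε).exists

/-- In the sublinear case `T φ ≤ T (φ - ψ) + T ψ`, and the roles of `φ` and `ψ` may be exchanged since
`T` is even. -/
theorem norm_sub_le_of_linear_or_sublinear {T : D n → Cb n}
    (h : IsLinearMap ℂ T ∨ IsSublinear T) (φ ψ : D n) (y : Rn n) :
    ‖T φ y - T ψ y‖ ≤ ‖T (φ - ψ) y‖ := by
  rcases h with h | h
  · rw [h.map_sub]
    rfl
  · have e1 : φ = (φ - ψ) + ψ := by abel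
    have e2 : ψ = (ψ - φ) + φ := by abel
    have h1 := h.add_le (φ - ψ) ψ y
    have h2 := h.add_le (ψ - φ) φ y
    rw [← e1] at h1
    rw [← e2, ← neg_sub φ ψ, h.neg] at h2
    have h3 : T φ y - T ψ y = (((T φ y).re - (T ψ y).re : ℝ) : ℂ) := by
      apply Complex.ext <;> simp [h.real]
    rw [h3, Complex.norm_real, Real.norm_eq_abs]
    refine (abs_le.2 ⟨?_, ?_⟩).trans (Complex.re_le_norm _) <;> linarith

theorem enorm_le_of_size {T : D n → Cb n} {c₁ : ℝ}
    (hsize : ∀ (f : D n) (y : Rn n), y ∉ tsupport f →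
      ‖T f y‖ ≤ c₁ * ∫ z, ‖f z‖ / ‖y - z‖ ^ n) (f : D n) {y : Rn n} (hy : y ∉ tsupport f) :
    ‖T f y‖ₑ ≤ ENNReal.ofReal |c₁| * ∫⁻ z, ‖f z‖ₑ * ENNReal.ofReal (1 / ‖y - z‖ ^ n) := by
  have h0 : 0 ≤ ∫ z, ‖f z‖ / ‖y - z‖ ^ n := integral_nonneg fun z => by positivity
  rw [← ofReal_norm]
  refine (ENNReal.ofReal_le_ofReal ((hsize f y hy).trans
    (mul_le_mul_of_nonneg_right (le_abs_self c₁) h0))).trans ?_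
  rw [ENNReal.ofReal_mul (abs_nonneg _)]
  gcongr
  calc ENNReal.ofReal (∫ z, ‖f z‖ / ‖y - z‖ ^ n) ≤ ‖∫ z, ‖f z‖ / ‖y - z‖ ^ n‖ₑ := by
        rw [← ofReal_norm]
        exact ENNReal.ofReal_le_ofReal (le_abs_self _)
    _ ≤ ∫⁻ z, ‖‖f z‖ / ‖y - z‖ ^ n‖ₑ := enorm_integral_le_lintegral_enorm _
    _ = _ := by
        refine lintegral_congr fun z => ?_
        rw [← ofReal_norm, Real.norm_of_nonneg (by positivity), div_eq_mul_one_div,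
          ENNReal.ofReal_mul (norm_nonneg _), ofReal_norm]

/-- The size condition makes the image of a test function decay like `|y|^{-n}`. -/
theorem tendsto_zero_of_size (hn : 0 < n) {T : D n → Cb n} {c₁ : ℝ}
    (hsize : ∀ (f : D n) (y : Rn n), y ∉ tsupport f →
      ‖T f y‖ ≤ c₁ * ∫ z, ‖f z‖ / ‖y - z‖ ^ n) (f : D n) :
    Tendsto (T f) (cocompact (Rn n)) (𝓝 0) := by
  obtain ⟨R, hR0, hR⟩ := f.hasCompactSupport.isCompact.isBounded.subset_closedBall_lt 0 0
  have hint : Integrable fun z => ‖f z‖ :=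
    (f.continuous.integrable_of_hasCompactSupport f.hasCompactSupport).norm
  set A := |c₁| * (2 ^ n * ∫ z, ‖f z‖) with hA
  have hbound : ∀ y : Rn n, 2 * R < ‖y‖ → ‖T f y‖ ≤ A * (‖y‖ ^ n)⁻¹ := by
    intro y hy
    have hy0 : 0 < ‖y‖ := by linarith
    have hyt : y ∉ tsupport f := fun h => by
      have := hR h
      rw [Metric.mem_closedBall, dist_zero_right] at this
      linarith
    have h0 : 0 ≤ ∫ z, ‖f z‖ / ‖y - z‖ ^ n := integral_nonneg fun z => by positivity
    refine (hsize f y hyt).trans ((mul_le_mul_of_nonneg_right (le_abs_self c₁) h0).trans ?_)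
    rw [hA, mul_assoc]
    gcongr
    calc ∫ z, ‖f z‖ / ‖y - z‖ ^ n ≤ ∫ z, ‖f z‖ * (2 ^ n * (‖y‖ ^ n)⁻¹) := by
          refine integral_mono_of_nonneg (.of_forall fun z => by positivity)
            (hint.mul_const _) (.of_forall fun z => ?_)
          by_cases hz : z ∈ tsupport f
          · have hzR := hR hz
            rw [Metric.mem_closedBall, dist_zero_right] at hzR
            have h1 : ‖y‖ / 2 ≤ ‖y - z‖ := by
              have := norm_sub_norm_le y z
              linarith
            change ‖f z‖ / ‖y - z‖ ^ n ≤ ‖f z‖ * (2 ^ n * (‖y‖ ^ n)⁻¹)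
            calc ‖f z‖ / ‖y - z‖ ^ n ≤ ‖f z‖ / (‖y‖ / 2) ^ n := by gcongr
              _ = _ := by rw [div_pow]; field_simp
          · simp [image_eq_zero_of_notMem_tsupport hz]
      _ = _ := by rw [integral_mul_const]; ring
  have hlim : Tendsto (fun y : Rn n => A * (‖y‖ ^ n)⁻¹) (cocompact (Rn n)) (𝓝 (A * 0)) :=
    ((tendsto_inv_atTop_zero.comp ((tendsto_pow_atTop hn.ne').comp
      (tendsto_norm_cocompact_atTop (E := Rn n))))).const_mul A
  rw [mul_zero] at hlim
  refine squeeze_zero_norm' ?_ hlim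
  filter_upwards [(tendsto_norm_cocompact_atTop (E := Rn n)).eventually_gt_atTop (2 * R)] with y hy
  exact hbound y hy

theorem exists_adm (hn : 0 < n) (T : ℕ → D n → Cb n)
    (hlin : ∀ j, IsLinearMap ℂ (T j) ∨ IsSublinear (T j))
    (hsize : ∃ c₁ : ℝ, ∀ (j : ℕ) (f : D n) (y : Rn n), y ∉ tsupport f →
      ‖T j f y‖ ≤ c₁ * ∫ z, ‖f z‖ / ‖y - z‖ ^ n)
    (hbdd : ∃ c₂ : ℝ≥0, ∀ f : ℕ → D n,
      lpNorm p univ (lqNorm q (fun j => T j (f j))) ≤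
        c₂ * lpNorm p univ (lqNorm q (fun j => f j))) :
    ∃ C₁ C₂ : ℝ≥0∞, Adm p q T C₁ C₂ := by
  obtain ⟨c₁, hc₁⟩ := hsize
  obtain ⟨c₂, hc₂⟩ := hbdd
  refine ⟨ENNReal.ofReal |c₁| * 2 ^ n, c₂, ⟨fun j => norm_sub_le_of_linear_or_sublinear (hlin j),
    fun j => ?_, fun j φ i y hy hφ => ?_, fun f => ?_, fun j φ => ?_, ?_, ENNReal.coe_ne_top⟩⟩
  · rcases hlin j with h | h
    exacts [h.map_zero, h.zero]
  · have hyt : y ∉ tsupport φ := fun hyt => by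
      have h1 : tsupport φ ⊆ (kball i 1)ᶜ :=
        closure_minimal (fun z hz hzk => hz (hφ z hzk)) Metric.isOpen_ball.isClosed_compl
      exact h1 hyt (Q_subset_kball hn i le_rfl hy)
    refine (enorm_le_of_size (hc₁ j) φ hyt).trans ?_
    rw [mul_assoc, ← lintegral_const_mul' _ _ (by finiteness : (2 : ℝ≥0∞) ^ n ≠ ∞)]
    refine mul_le_mul_right (lintegral_mono fun z => ?_) _
    rw [mul_left_comm]
    by_cases hz : z ∈ kball i 1
    · simp [hφ z hz]
    · gcongr
      exact inv_norm_pow_le_ker hn i hy hz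
  · have := hc₂ f
    simp_rw [lpNorm_univ] at this
    have e : ∀ g : ℕ → Rn n → ℂ, lqNorm q g = fun x => lq q fun j => ‖g j x‖ₑ := fun g =>
      funext (lqNorm_eq_lq q g)
    rwa [e, e] at this
  · exact tendsto_zero_of_size hn (hc₁ j) φ
  · exact ENNReal.mul_ne_top ENNReal.ofReal_ne_top (by finiteness)

/-! ### The Morrey spaces and the closure of the test functions -/

theorem morreyNorm_eq (f : Fn n) : morreyNorm p r f = mn p (n / p + r) (fun x => ‖f x‖ₑ) :=
  morreyNormAux_eq_mn _ _ _

theorem vecMorreyNorm_eq (f : ℕ → Fn n) :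
    vecMorreyNorm p r q f = mn p (n / p + r) (fun x => lq q fun j => ‖f j x‖ₑ) := by
  rw [vecMorreyNorm, morreyNormAux_eq_mn]
  congr 1
  exact funext (lqNorm_eq_lq q _)

theorem morreyNorm_sub_eq (hp : 0 < p) (f g : Fn n) :
    morreyNorm p r (f - g) = mn p (n / p + r) (fun x => ‖f x - g x‖ₑ) := by
  rw [morreyNorm_eq]
  refine mn_congr_ae hp ?_
  filter_upwards [coe_sub f g] with x hx
  rw [hx]

theorem vecMorreyNorm_sub_eq (hp : 0 < p) (f g : ℕ → Fn n) :
    vecMorreyNorm p r q (fun j => f j - g j) =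
      mn p (n / p + r) (fun x => lq q fun j => ‖f j x - g j x‖ₑ) := by
  rw [vecMorreyNorm_eq]
  refine mn_congr_ae hp ?_
  filter_upwards [ae_all_iff.2 fun j => coe_sub (f j) (g j)] with x hx
  simp_rw [hx]

theorem enorm_sub_triangle (a b c : ℂ) : ‖a - c‖ₑ ≤ ‖a - b‖ₑ + ‖b - c‖ₑ := by
  calc ‖a - c‖ₑ = ‖(a - b) + (b - c)‖ₑ := by congr 1; ring
    _ ≤ _ := enorm_add_le _ _

theorem vecMorreyNorm_triangle (hp : 1 ≤ p) (hq : 1 ≤ q) (f g h : ℕ → Fn n) :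
    vecMorreyNorm p r q (fun j => f j - h j) ≤
      vecMorreyNorm p r q (fun j => f j - g j) + vecMorreyNorm p r q (fun j => g j - h j) := by
  have hp0 : 0 < p := zero_lt_one.trans_le hp
  have hq0 : 0 < q := zero_lt_one.trans_le hq
  simp_rw [vecMorreyNorm_sub_eq hp0]
  refine (mn_mono hp0 fun x => ?_).trans (mn_add_le hp
    (measurable_lq fun j => ((Fn_measurable (f j)).sub (Fn_measurable (g j))).enorm)
    (measurable_lq fun j => ((Fn_measurable (g j)).sub (Fn_measurable (h j))).enorm))
  exact (lq_mono hq0 fun j => enorm_sub_triangle _ _ _).trans (lq_add_le hq _ _)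

theorem morreyNorm_triangle (hp : 1 ≤ p) (f g h : Fn n) :
    morreyNorm p r (f - h) ≤ morreyNorm p r (f - g) + morreyNorm p r (g - h) := by
  have hp0 : 0 < p := zero_lt_one.trans_le hp
  simp_rw [morreyNorm_sub_eq hp0]
  exact (mn_mono hp0 fun x => enorm_sub_triangle _ _ _).trans (mn_add_le hp
    ((Fn_measurable f).sub (Fn_measurable g)).enorm ((Fn_measurable g).sub (Fn_measurable h)).enorm)

theorem morreyNorm_sub_comm (hp : 0 < p) (f g : Fn n) :
    morreyNorm p r (f - g) = morreyNorm p r (g - f) := by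
  simp_rw [morreyNorm_sub_eq hp]
  congr 1; funext x
  rw [← enorm_neg, neg_sub]

theorem morreyNorm_le_vecMorreyNorm (hp : 0 < p) (hq : 0 < q) (f : ℕ → Fn n) (j : ℕ) :
    morreyNorm p r (f j) ≤ vecMorreyNorm p r q f := by
  rw [morreyNorm_eq, vecMorreyNorm_eq]
  exact mn_mono hp fun x => le_lq hq (fun j => ‖f j x‖ₑ) j

theorem eq_of_morreyNorm_sub_eq_zero (hp : 0 < p) {f g : Fn n} (h : morreyNorm p r (f - g) = 0) :
    f = g := by
  rw [morreyNorm_sub_eq hp] at h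
  refine AEEqFun.ext ?_
  filter_upwards [ae_eq_zero_of_mn hp ((Fn_measurable f).sub (Fn_measurable g)).enorm h] with x hx
  simpa [sub_eq_zero] using hx

theorem mn_ofD_lt_top (hp : 1 ≤ p) (hs : 0 ≤ s) (hsn : s ≤ n / p) (φ : D n) :
    mn p s (fun x => ‖ofD φ x‖ₑ) < ∞ := by
  have hp0 : 0 < p := zero_lt_one.trans_le hp
  obtain ⟨C, hC⟩ := φ.continuous.bounded_above_of_compact_support φ.hasCompactSupport
  rw [mn_congr_ae hp0 (G := fun x => ‖φ x‖ₑ) (by filter_upwards [coe_ofD φ] with x hx; rw [hx])]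
  refine (mn_le_of_bdd hp hs hsn (M := ENNReal.ofReal C) fun x => ?_).trans_lt ?_
  · rw [← ofReal_norm]
    exact ENNReal.ofReal_le_ofReal (hC x)
  · exact ENNReal.add_lt_top.2 ⟨ENNReal.mul_lt_top ENNReal.ofReal_lt_top
      (ENNReal.rpow_lt_top_of_nonneg (by positivity) volC_ne_top), Np_D_lt_top hp0 φ⟩

/-- A continuous `L_p` function that vanishes at infinity belongs to the closure of the test
functions in the Morrey space. -/
theorem exists_D_mn_lt (hp : 1 ≤ p) (hs : 0 ≤ s) (hsn : s ≤ n / p) {u : Rn n → ℂ}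
    (hu : Continuous u) (hup : Np p u < ∞) (hu0 : Tendsto u (cocompact (Rn n)) (𝓝 0))
    {ε : ℝ≥0∞} (hε : 0 < ε) : ∃ φ : D n, mn p s (fun x => ‖u x - φ x‖ₑ) < ε := by
  have hp0 : 0 < p := zero_lt_one.trans_le hp
  have hV : volC n ^ (1 / p) ≠ ∞ := ENNReal.rpow_ne_top_of_nonneg (by positivity) volC_ne_top
  obtain ⟨k, hk⟩ := exists_two_lt (C := volC n ^ (1 / p) + 2) (by finiteness) hε
  -- the test function `φ₀` controls the `L_p` norm of `u` near infinity
  obtain ⟨φ₀, hφ₀⟩ := exists_D_approx hp hu.measurable hup (pos_iff_ne_zero.2 (two_ne_zero' (-k)))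
  have hsmall : ∀ᶠ x in cocompact (Rn n), ‖u x‖ < (2 : ℝ) ^ (-(k : ℝ)) := by
    have := hu0.norm
    rw [norm_zero] at this
    exact this.eventually_lt_const (by positivity)
  obtain ⟨K, hK, hKs⟩ := mem_cocompact.1 hsmall
  obtain ⟨R, hR0, hR⟩ := (hK.isBounded.union
    φ₀.hasCompactSupport.isCompact.isBounded).subset_closedBall_lt 0 0
  -- the cut-off part of `u` is smoothed uniformly inside a cube, and the remainder is small both in
  -- `L_∞` and in `L_p`
  let χ : ContDiffBump (0 : Rn n) := ⟨R, R + 1, hR0, by linarith⟩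
  have hχc : HasCompactSupport fun x => ((χ x : ℝ) : ℂ) * u x :=
    (χ.hasCompactSupport.comp_left (g := Complex.ofReal) (by simp)).mul_right
  have hcont : Continuous fun x => ((χ x : ℝ) : ℂ) * u x :=
    (Complex.continuous_ofReal.comp χ.continuous).mul hu
  obtain ⟨i, hi⟩ := exists_ball_subset_Q (n := n) (R + 1)
  have hQ := mn_indicator_one_ne_top (s := s) hp hs hsn i
  obtain ⟨m, hm⟩ := exists_two_lt hQ (pos_iff_ne_zero.2 (two_ne_zero' (-k)))
  obtain ⟨g, hg1, hg2, hg3⟩ := hcont.exists_contDiff_approx ⊤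
    (ε := fun _ => (2 : ℝ) ^ (-(m : ℝ))) (by fun_prop) (fun _ => by positivity)
  have hgc : HasCompactSupport g := hχc.mono hg3
  refine ⟨mkD g hg1 hgc, lt_of_le_of_lt ?_ hk⟩
  have hsuppQ : ∀ x, x ∉ Q i → χ x = 0 := fun x hx => χ.zero_of_le_dist (by
    by_contra hcon
    exact hx (hi (Metric.mem_closedBall.2 (not_le.1 hcon).le)))
  have h1 : mn p s (fun x => ‖u x - ((χ x : ℝ) : ℂ) * u x‖ₑ) ≤
      two (-k) * volC n ^ (1 / p) + two (-k) := by
    have e : ∀ x, ‖u x - ((χ x : ℝ) : ℂ) * u x‖ₑ ≤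
        ‖(Metric.closedBall (0 : Rn n) R)ᶜ.indicator u x‖ₑ := fun x => by
      by_cases hx : x ∈ Metric.closedBall (0 : Rn n) R
      · rw [χ.one_of_mem_closedBall hx]; simp
      · rw [indicator_of_mem hx, ← one_sub_mul, enorm_mul]
        refine mul_le_of_le_one_left' ?_
        rw [← Complex.ofReal_one, ← Complex.ofReal_sub, ← ofReal_norm, Complex.norm_real,
          Real.norm_of_nonneg (by linarith [χ.le_one (x := x)])]
        simpa using χ.nonneg
    refine (mn_le_of_bdd hp hs hsn (M := two (-k)) fun x => (e x).trans ?_).trans ?_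
    · by_cases hx : x ∈ Metric.closedBall (0 : Rn n) R
      · simp [hx]
      · rw [indicator_of_mem hx, ← ofReal_norm, ← ofReal_two_rpow]
        exact ENNReal.ofReal_le_ofReal (le_of_lt (hKs fun hxK => hx (hR (Or.inl hxK))))
    · gcongr
      refine le_trans (Np_mono_ae hp0 (.of_forall fun x => (e x).trans ?_)) hφ₀
      by_cases hx : x ∈ Metric.closedBall (0 : Rn n) R
      · simp [hx]
      · rw [indicator_of_mem hx,
          image_eq_zero_of_notMem_tsupport fun hxt => hx (hR (Or.inr hxt)), sub_zero]
  have h2 : mn p s (fun x => ‖((χ x : ℝ) : ℂ) * u x - g x‖ₑ) ≤ two (-k) := by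
    refine le_trans (mn_mono hp0 (G := fun x => two (-m) * (Q i).indicator (fun _ => 1) x)
      fun x => ?_) ?_
    · by_cases hx : x ∈ Q i
      · rw [indicator_of_mem hx, mul_one, ← ofReal_norm, ← ofReal_two_rpow]
        refine ENNReal.ofReal_le_ofReal ?_
        rw [norm_sub_rev, ← dist_eq_norm]
        exact (hg2 x).le
      · have hz : ((χ x : ℝ) : ℂ) * u x = 0 := by rw [hsuppQ x hx]; simp
        have hgz : g x = 0 := by
          by_contra hcon
          exact hg3 hcon hz
        rw [hz, hgz]
        simp
    · rw [mn_const_mul hp0 _ (measurable_const.indicator (measurableSet_Q i)), mul_comm]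
      exact hm.le
  have hgm : Measurable g := hg1.continuous.measurable
  calc mn p s (fun x => ‖u x - g x‖ₑ)
      ≤ mn p s (fun x => ‖u x - ((χ x : ℝ) : ℂ) * u x‖ₑ + ‖((χ x : ℝ) : ℂ) * u x - g x‖ₑ) :=
        mn_mono hp0 fun x => enorm_sub_triangle _ _ _
    _ ≤ (two (-k) * volC n ^ (1 / p) + two (-k)) + two (-k) :=
        (mn_add_le hp (hu.measurable.sub hcont.measurable).enorm
          (hcont.measurable.sub hgm).enorm).trans (add_le_add h1 h2)
    _ = _ := by ring

/-! ### Lipschitz continuous operators -/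

theorem isContOn_of_lipschitz {X : Type*} [AddGroup X] {N : X → ℝ≥0∞} {S : Set X} {A : X → X}
    {C : ℝ≥0∞} (hC : C ≠ ∞) (h : ∀ f ∈ S, ∀ g ∈ S, N (A g - A f) ≤ C * N (g - f)) :
    IsContOn N S A := by
  intro f hf ε hε
  refine ⟨ε / (C + 1), ENNReal.div_pos hε.ne' (by finiteness), fun g hg hlt => ?_⟩
  refine (h f hf g hg).trans_lt ?_
  rw [ENNReal.lt_div_iff_mul_lt (Or.inl (by simp)) (Or.inl (by finiteness)), mul_comm] at hlt
  refine lt_of_le_of_lt ?_ hlt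
  gcongr
  exact le_self_add

theorem isBddOn_of_le {X : Type*} {N : X → ℝ≥0∞} {S : Set X} {A : X → X} {C : ℝ≥0∞}
    (hC : C ≠ ∞) (hA : MapsTo A S S) (h : ∀ f ∈ S, N (A f) ≤ C * N f) : IsBddOn N S A :=
  ⟨hA, C.toNNReal, fun f hf => by rw [ENNReal.coe_toNNReal hC]; exact h f hf⟩

/-! ### The extension acting in the Morrey spaces -/

section Parts

variable {T : ℕ → D n → Cb n} {C₁ C₂ : ℝ≥0∞}

/-- The standing assumptions: an admissible sequence of operators, and the ranges of the
parameters. -/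
structure Setting (n : ℕ) (p p' q q' r : ℝ) (T : ℕ → D n → Cb n) (C₁ C₂ : ℝ≥0∞) : Prop where
  adm : Adm p q T C₁ C₂
  hn : 0 < n
  hp : p.HolderConjugate p'
  hq : q.HolderConjugate q'
  hr : -(n / p) < r
  hr0 : r < 0

namespace Setting

theorem s_nonneg (S : Setting n p p' q q' r T C₁ C₂) : 0 ≤ n / p + r := by linarith [S.hr]

theorem s_lt (S : Setting n p p' q q' r T C₁ C₂) : n / p + r < n / p := by linarith [S.hr0]

/-- The constant of the Lipschitz estimates. -/
noncomputable def const (_ : Setting n p p' q q' r T C₁ C₂) : ℝ≥0∞ :=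
  morreyC n p p' (n / p + r) C₁ C₂

theorem const_ne_top (S : Setting n p p' q q' r T C₁ C₂) : S.const ≠ ∞ :=
  morreyC_ne_top S.hp S.s_lt S.adm.C₁_ne_top S.adm.C₂_ne_top

theorem ofD_mem_morrey (S : Setting n p p' q q' r T C₁ C₂) (φ : D n) : ofD φ ∈ morrey n p r := by
  change morreyNorm p r (ofD φ) < ∞
  rw [morreyNorm_eq]
  exact mn_ofD_lt_top S.hp.lt.le S.s_nonneg S.s_lt.le φ

theorem ofD_mem_morreyCirc (S : Setting n p p' q q' r T C₁ C₂) (φ : D n) :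
    ofD φ ∈ morreyCirc n p r := by
  refine ⟨S.ofD_mem_morrey φ, fun ε hε => ⟨φ, ?_⟩⟩
  rw [morreyNorm_sub_eq S.hp.pos]
  simp only [sub_self, enorm_zero]
  simpa [mn, lpNorm_eq_nrm, nrm_zero S.hp.pos] using hε

theorem extends_mext (S : Setting n p p' q q' r T C₁ C₂) (j : ℕ) :
    Extends (T j) (mext p C₂ (T j)) := fun φ =>
  S.adm.mext_ofD S.hn S.hp S.hq.pos S.s_lt j φ
    (mn_ofD_lt_top S.hp.lt.le S.s_nonneg S.s_lt.le φ)

theorem vec_lipschitz (S : Setting n p p' q q' r T C₁ C₂) {f g : ℕ → Fn n}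
    (hf : ∀ j, f j ∈ morrey n p r) (hg : ∀ j, g j ∈ morrey n p r) :
    vecMorreyNorm p r q (fun j => mext p C₂ (T j) (f j) - mext p C₂ (T j) (g j)) ≤
      S.const * vecMorreyNorm p r q (fun j => f j - g j) := by
  rw [vecMorreyNorm_sub_eq S.hp.pos, vecMorreyNorm_sub_eq S.hp.pos]
  refine S.adm.mn_lq_mext_sub_le S.hn S.hp S.hq S.s_lt (fun j => ?_) fun j => ?_
  · rw [← morreyNorm_eq]; exact hf j
  · rw [← morreyNorm_eq]; exact hg j

theorem zero_mem_morrey (S : Setting n p p' q q' r T C₁ C₂) : (0 : Fn n) ∈ morrey n p r := by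
  have h : ofD (0 : D n) = (0 : Fn n) := rfl
  rw [← h]
  exact S.ofD_mem_morrey 0

theorem mext_zero (S : Setting n p p' q q' r T C₁ C₂) (j : ℕ) :
    mext p C₂ (T j) 0 = 0 := by
  have h := S.extends_mext j 0
  rw [S.adm.zero] at h
  exact h

theorem lipschitz (S : Setting n p p' q q' r T C₁ C₂) (j : ℕ) {f g : Fn n}
    (hf : f ∈ morrey n p r) (hg : g ∈ morrey n p r) :
    morreyNorm p r (mext p C₂ (T j) f - mext p C₂ (T j) g) ≤
      S.const * morreyNorm p r (f - g) := by
  classical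
  -- the vector-valued bound is applied to sequences with a single nonzero component
  have h := S.vec_lipschitz (f := fun k => if k = j then f else 0)
    (g := fun k => if k = j then g else 0)
    (fun k => by split_ifs; exacts [hf, S.zero_mem_morrey])
    (fun k => by split_ifs; exacts [hg, S.zero_mem_morrey])
  have h1 := morreyNorm_le_vecMorreyNorm (r := r) S.hp.pos S.hq.pos (fun k =>
    mext p C₂ (T k) (if k = j then f else 0) - mext p C₂ (T k) (if k = j then g else 0)) j
  simp only [if_true] at h1
  refine h1.trans (h.trans_eq ?_)
  rw [vecMorreyNorm_sub_eq S.hp.pos, morreyNorm_sub_eq S.hp.pos]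
  congr 2
  funext x
  rw [lq_single S.hq.pos _ j fun k hk => by simp [hk]]
  simp

theorem mext_bound (S : Setting n p p' q q' r T C₁ C₂) (j : ℕ) {f : Fn n}
    (hf : f ∈ morrey n p r) :
    morreyNorm p r (mext p C₂ (T j) f) ≤ S.const * morreyNorm p r f := by
  have h := S.lipschitz j hf S.zero_mem_morrey
  rwa [S.mext_zero, sub_zero, sub_zero] at h

theorem vec_bound (S : Setting n p p' q q' r T C₁ C₂) {f : ℕ → Fn n}
    (hf : ∀ j, f j ∈ morrey n p r) :
    vecMorreyNorm p r q (fun j => mext p C₂ (T j) (f j)) ≤ S.const * vecMorreyNorm p r q f := by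
  have h := S.vec_lipschitz hf (g := fun _ => 0) fun _ => S.zero_mem_morrey
  simpa only [S.mext_zero, sub_zero] using h

theorem mapsTo_morrey (S : Setting n p p' q q' r T C₁ C₂) (j : ℕ) :
    MapsTo (mext p C₂ (T j)) (morrey n p r) (morrey n p r) := fun _ hf =>
  (S.mext_bound j hf).trans_lt (ENNReal.mul_lt_top S.const_ne_top.lt_top hf)

theorem mapsTo_vecMorrey (S : Setting n p p' q q' r T C₁ C₂) :
    MapsTo (fun f j => mext p C₂ (T j) (f j)) (vecMorrey n p r q) (vecMorrey n p r q) :=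
  fun _ hf => ⟨fun j => S.mapsTo_morrey j (hf.1 j), (S.vec_bound hf.1).trans_lt
    (ENNReal.mul_lt_top S.const_ne_top.lt_top hf.2)⟩

theorem exists_D_ofC (S : Setting n p p' q q' r T C₁ C₂) (j : ℕ) (φ : D n) {ε : ℝ≥0∞}
    (hε : 0 < ε) : ∃ ψ : D n, morreyNorm p r (ofC (T j φ) - ofD ψ) < ε := by
  have hfin : Np p (T j φ) < ∞ := (S.adm.Np_le S.hq.pos j φ).trans_lt
    (ENNReal.mul_lt_top S.adm.C₂_ne_top.lt_top (Np_D_lt_top S.hp.pos φ))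
  obtain ⟨ψ, hψ⟩ := exists_D_mn_lt S.hp.lt.le S.s_nonneg S.s_lt.le (T j φ).continuous hfin
    (S.adm.decay j φ) hε
  refine ⟨ψ, lt_of_le_of_lt (le_of_eq ?_) hψ⟩
  rw [morreyNorm_sub_eq S.hp.pos]
  refine mn_congr_ae S.hp.pos ?_
  filter_upwards [coe_ofC (T j φ), coe_ofD ψ] with x h1 h2
  rw [h1, h2]

theorem mapsTo_morreyCirc (S : Setting n p p' q q' r T C₁ C₂) (j : ℕ) :
    MapsTo (mext p C₂ (T j)) (morreyCirc n p r) (morreyCirc n p r) := by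
  intro f hf
  refine ⟨S.mapsTo_morrey j hf.1, fun ε hε => ?_⟩
  obtain ⟨k, hk⟩ := exists_two_lt (C := S.const + 1)
    (ENNReal.add_ne_top.2 ⟨S.const_ne_top, ENNReal.one_ne_top⟩) hε
  have h0 := pos_iff_ne_zero.2 (two_ne_zero' (-(k : ℝ)))
  obtain ⟨φ, hφ⟩ := hf.2 _ h0
  obtain ⟨ψ, hψ⟩ := S.exists_D_ofC j φ h0
  refine ⟨ψ, lt_of_le_of_lt ?_ hk⟩
  refine (morreyNorm_triangle S.hp.lt.le _ (ofC (T j φ)) _).trans ?_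
  rw [add_mul, one_mul]
  refine add_le_add ?_ hψ.le
  rw [← S.extends_mext j φ]
  exact (S.lipschitz j hf.1 (S.ofD_mem_morrey φ)).trans (mul_le_mul_right hφ.le _)

theorem eqOn_of_isContOn (S : Setting n p p' q q' r T C₁ C₂) (j : ℕ) {B : Fn n → Fn n}
    (hB : Extends (T j) B) (hBc : IsContOn (morreyNorm p r) (morreyCirc n p r) B) :
    EqOn B (mext p C₂ (T j)) (morreyCirc n p r) := by
  intro f hf
  refine eq_of_morreyNorm_sub_eq_zero (r := r) S.hp.pos (le_antisymm ?_ zero_le)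
  refine le_of_forall_two (C := 1 + S.const)
    (ENNReal.add_ne_top.2 ⟨ENNReal.one_ne_top, S.const_ne_top⟩) fun k => ?_
  rw [zero_add]
  have h0 := pos_iff_ne_zero.2 (two_ne_zero' (-(k : ℝ)))
  obtain ⟨δ, hδ, hcont⟩ := hBc f hf _ h0
  obtain ⟨φ, hφ⟩ := hf.2 _ (lt_min hδ h0)
  have hφ' := hφ
  rw [morreyNorm_sub_comm S.hp.pos] at hφ'
  refine (morreyNorm_triangle S.hp.lt.le _ (ofC (T j φ)) _).trans ?_
  rw [add_mul, one_mul]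
  refine add_le_add ?_ ?_
  · rw [← hB φ, morreyNorm_sub_comm S.hp.pos]
    exact (hcont _ (S.ofD_mem_morreyCirc φ) (hφ'.trans_le (min_le_left _ _))).le
  · rw [← S.extends_mext j φ]
    refine (S.lipschitz j (S.ofD_mem_morrey φ) hf.1).trans (mul_le_mul_right ?_ _)
    exact (hφ'.trans_le (min_le_right _ _)).le

theorem mapsTo_vecMorreyCirc (S : Setting n p p' q q' r T C₁ C₂) :
    MapsTo (fun f j => mext p C₂ (T j) (f j)) (vecMorreyCirc n p r q) (vecMorreyCirc n p r q) := by
  rintro f ⟨hf, φ, hφ0, hφ⟩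
  have hp := S.hp.lt.le
  have hq := S.hq.lt.le
  refine ⟨S.mapsTo_vecMorrey hf, ?_⟩
  -- the `j`-th component of the `k`-th approximation is approximated up to `2^{-k}/(k+1)`
  choose ψ hψ using fun k j : ℕ => S.exists_D_ofC j (φ k j) (ε := two (-k) / (k + 1 : ℕ))
    (ENNReal.div_pos (two_ne_zero' _) (ENNReal.natCast_ne_top _))
  refine ⟨fun k => trunc (k + 1) (ψ k), fun k j hkj => trunc_of_le (by omega) _, ?_⟩
  have hlim : Tendsto (fun k => S.const * vecMorreyNorm p r q (fun j => f j - ofD (φ k j)) +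
      two (-(k : ℝ))) atTop (𝓝 (S.const * 0 + 0)) :=
    (ENNReal.Tendsto.const_mul hφ (Or.inr S.const_ne_top)).add tendsto_two_neg
  rw [mul_zero, add_zero] at hlim
  refine tendsto_of_tendsto_of_tendsto_of_le_of_le tendsto_const_nhds hlim
    (fun _ => zero_le) fun k => ?_
  refine (vecMorreyNorm_triangle hp hq _ (fun j => ofC (T j (φ k j))) _).trans (add_le_add ?_ ?_)
  · simp_rw [← S.extends_mext _ _]
    exact S.vec_lipschitz hf.1 fun j => S.ofD_mem_morrey _
  · have hm : ∀ j, Measurable fun x => ‖(ofC (T j (φ k j)) - ofD (ψ k j) : Fn n) x‖ₑ :=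
      fun j => (Fn_measurable _).enorm
    rw [vecMorreyNorm_eq]
    calc _ ≤ mn p (n / p + r) (fun x => ∑ j ∈ Finset.range (k + 1),
          ‖(ofC (T j (φ k j)) - ofD (ψ k j) : Fn n) x‖ₑ) := by
          refine mn_mono_ae S.hp.pos ?_
          have hz : ∀ᵐ x, (0 : Fn n) x = 0 := AEEqFun.coeFn_zero
          filter_upwards [hz] with x hx
          refine le_trans (le_of_eq ?_) (lq_trunc_le_sum hq (k + 1) _)
          congr 1
          funext j
          by_cases hj : j < k + 1
          · rw [trunc_of_lt hj, trunc_of_lt hj]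
          · rw [trunc_of_le (not_lt.1 hj), trunc_of_le (not_lt.1 hj), hφ0 k j (by omega),
              S.adm.zero]
            have : (ofC (0 : Cb n) - ofD (0 : D n) : Fn n) = 0 := by
              have h1 : ofC (0 : Cb n) = (0 : Fn n) := rfl
              have h2 : ofD (0 : D n) = (0 : Fn n) := rfl
              rw [h1, h2, sub_zero]
            rw [this, hx, enorm_zero]
      _ ≤ ∑ j ∈ Finset.range (k + 1), two (-k) / (k + 1 : ℕ) := by
          refine (mn_sum_le hp _ hm).trans (Finset.sum_le_sum fun j _ => ?_)
          rw [← morreyNorm_eq]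
          exact (hψ k j).le
      _ = two (-k) := by
          rw [Finset.sum_const, Finset.card_range, nsmul_eq_mul]
          exact ENNReal.mul_div_cancel (by simp) (ENNReal.natCast_ne_top _)

theorem coe_lin (a b : ℂ) (f g : Fn n) : ∀ᵐ x, (a • f + b • g : Fn n) x = a * f x + b * g x := by
  filter_upwards [AEEqFun.coeFn_add (a • f) (b • g), AEEqFun.coeFn_smul a f,
    AEEqFun.coeFn_smul b g] with x h1 h2 h3
  rw [h1, Pi.add_apply, h2, h3]
  rfl

theorem lin_mem_morrey (S : Setting n p p' q q' r T C₁ C₂) {f g : Fn n} (hf : f ∈ morrey n p r)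
    (hg : g ∈ morrey n p r) (a b : ℂ) : a • f + b • g ∈ morrey n p r := by
  have hp0 := S.hp.pos
  change morreyNorm p r _ < ∞
  change morreyNorm p r f < ∞ at hf
  change morreyNorm p r g < ∞ at hg
  rw [morreyNorm_eq] at *
  have hfm := (Fn_measurable f).enorm
  have hgm := (Fn_measurable g).enorm
  refine lt_of_le_of_lt (mn_mono_ae hp0 (G := fun x => ‖a‖ₑ * ‖f x‖ₑ + ‖b‖ₑ * ‖g x‖ₑ) ?_) ?_
  · filter_upwards [coe_lin a b f g] with x hx
    rw [hx, ← enorm_mul, ← enorm_mul]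
    exact enorm_add_le _ _
  · refine (mn_add_le S.hp.lt.le (hfm.const_mul _) (hgm.const_mul _)).trans_lt ?_
    rw [mn_const_mul hp0 _ hfm, mn_const_mul hp0 _ hgm]
    exact ENNReal.add_lt_top.2 ⟨ENNReal.mul_lt_top enorm_lt_top hf,
      ENNReal.mul_lt_top enorm_lt_top hg⟩

theorem isLinearOn_morrey (S : Setting n p p' q q' r T C₁ C₂) (j : ℕ)
    (hlin : IsLinearMap ℂ (T j)) : IsLinearOn (morrey n p r) (mext p C₂ (T j)) := by
  intro f hf g hg a b
  have hk := S.lin_mem_morrey hf hg a b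
  change morreyNorm p r _ < ∞ at hf hg hk
  rw [morreyNorm_eq] at hf hg hk
  refine AEEqFun.ext ?_
  filter_upwards [S.adm.mext_linear S.hn S.hp S.hq.pos S.s_lt j hlin hf hg hk a b
    (coe_lin a b f g), coe_lin a b (mext p C₂ (T j) f) (mext p C₂ (T j) g)] with x h1 h2
  rw [h1, h2]

end Setting

end Parts

end

section

/-! ### Norms in `L_{p'}(ℓ_{q'})` by duality -/

/-- A number `w` with `w z = |z|`, of absolute value `1` unless `z = 0`. -/
noncomputable def phase (z : ℂ) : ℂ := (starRingEnd ℂ) z / (‖z‖ : ℝ)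

theorem phase_mul (z : ℂ) : phase z * z = (‖z‖ : ℝ) := by
  rcases eq_or_ne z 0 with h0 | h0
  · simp [h0]
  · have hn0 : (‖z‖ : ℂ) ≠ 0 := by exact_mod_cast norm_ne_zero_iff.2 h0
    rw [phase, div_mul_eq_mul_div, div_eq_iff hn0, mul_comm, Complex.mul_conj,
      Complex.normSq_eq_norm_sq]
    push_cast; ring

theorem norm_phase {z : ℂ} (hz : z ≠ 0) : ‖phase z‖ = 1 := by
  rw [phase, norm_div, RCLike.norm_conj, Complex.norm_real, norm_norm,
    div_self (norm_ne_zero_iff.2 hz)]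

theorem norm_phase_le (z : ℂ) : ‖phase z‖ ≤ 1 := by
  rcases eq_or_ne z 0 with h0 | h0
  · simp [h0, phase]
  · exact (norm_phase h0).le

theorem measurable_phase : Measurable phase :=
  Complex.continuous_conj.measurable.div (Complex.measurable_ofReal.comp measurable_norm)

section Duality

variable {α : Type*} [MeasurableSpace α] {μ : Measure α} {p p' q q' : ℝ}

theorem rpow_le_of_le_mul_rpow (h : p.HolderConjugate p') {X C : ℝ≥0∞} (hX : X ≠ ∞)
    (hle : X ≤ C * X ^ (1 / p)) : X ^ (1 / p') ≤ C := by
  rcases eq_or_ne X 0 with h0 | h0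
  · rw [h0, ENNReal.zero_rpow_of_pos (one_div_pos.2 h.symm.pos)]
    exact zero_le
  · have e : X = X ^ (1 / p') * X ^ (1 / p) := by
      rw [← ENNReal.rpow_add _ _ h0 hX, one_div, one_div, h.symm.inv_add_inv_eq_one,
        ENNReal.rpow_one]
    have hX1 : X ^ (1 / p) ≠ 0 := by simp [ENNReal.rpow_eq_zero_iff, h0, hX]
    have hX2 : X ^ (1 / p) ≠ ∞ :=
      ENNReal.rpow_ne_top_of_nonneg (one_div_pos.2 h.pos).le hX
    conv_lhs at hle => rw [e]
    exact (ENNReal.mul_le_mul_iff_left hX1 hX2).1 hle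

theorem integrable_mul_of_nrm (h : p.HolderConjugate p') {f g : α → ℂ} (hf : Measurable f)
    (hg : Measurable g) (hfp : nrm p μ (fun x => ‖f x‖ₑ) < ∞)
    (hgp : nrm p' μ (fun x => ‖g x‖ₑ) < ∞) : Integrable (fun x => f x * g x) μ := by
  refine ⟨(hf.mul hg).aestronglyMeasurable, lt_of_le_of_lt ?_ (ENNReal.mul_lt_top hfp hgp)⟩
  refine le_trans (le_of_eq (lintegral_congr fun x => enorm_mul _ _)) ?_
  exact nrm_holder h hf.enorm.aemeasurable hg.enorm.aemeasurable

theorem enorm_integral_mul_le (h : p.HolderConjugate p') {f g : α → ℂ} (hf : Measurable f)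
    (hg : Measurable g) : ‖∫ x, f x * g x ∂μ‖ₑ ≤
      nrm p μ (fun x => ‖f x‖ₑ) * nrm p' μ (fun x => ‖g x‖ₑ) := by
  refine (enorm_integral_le_lintegral_enorm _).trans ?_
  refine le_trans (le_of_eq (lintegral_congr fun x => enorm_mul _ _)) ?_
  exact nrm_holder h hf.enorm.aemeasurable hg.enorm.aemeasurable

/-- The exponents of the extremal sequence in Hölder's inequality for `L_p(ℓ_q)`. -/
theorem lq_weight (hp : 1 < p') (hqq : q.HolderConjugate q') {a : ℕ → ℝ≥0∞}
    (ha : lq q' a ≠ ∞) :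
    lq q (fun j => a j ^ (q' - 1) * lq q' a ^ (p' - q')) = lq q' a ^ (p' - 1) ∧
      ∑' j, a j ^ (q' - 1) * lq q' a ^ (p' - q') * a j = lq q' a ^ p' := by
  have hq0 := hqq.pos
  have hq'0 := hqq.symm.pos
  have hq1 := hqq.symm.sub_one_pos
  rcases eq_or_ne (lq q' a) 0 with h0 | h0
  · have ha0 : ∀ j, a j = 0 := fun j => le_antisymm ((le_lq hq'0 a j).trans_eq h0) zero_le
    simp only [ha0, ENNReal.zero_rpow_of_pos hq1, zero_mul, mul_zero, tsum_zero, h0]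
    rw [ENNReal.zero_rpow_of_pos (by linarith), ENNReal.zero_rpow_of_pos (by linarith)]
    refine ⟨?_, rfl⟩
    rw [lq_single hq0 _ 0 fun _ _ => rfl]
  · constructor
    · rw [lq_mul_const hq0, lq_eq]
      simp_rw [← ENNReal.rpow_mul, hqq.symm.sub_one_mul_conj]
      rw [← lq_rpow hq'0, ← ENNReal.rpow_mul, ← ENNReal.rpow_add _ _ h0 ha]
      congr 1
      have := hqq.inv_add_inv_eq_one
      have h1 : q' * (1 / q) = q' - 1 := by
        have h2 : 1 / q = 1 - 1 / q' := by rw [one_div, one_div]; linarith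
        rw [h2]; field_simp
      rw [h1]; ring
    · have e : ∀ j, a j ^ (q' - 1) * lq q' a ^ (p' - q') * a j =
          a j ^ q' * lq q' a ^ (p' - q') := fun j => by
        rw [mul_right_comm]
        congr 1
        conv_lhs => rw [← ENNReal.rpow_one (a j), ← ENNReal.rpow_mul, one_mul]
        rw [← ENNReal.rpow_add_of_nonneg _ _ hq1.le zero_le_one]
        congr 1; ring
      simp_rw [e]
      rw [ENNReal.tsum_mul_right, ← lq_rpow hq'0, ← ENNReal.rpow_add _ _ h0 ha]
      congr 1; ring

/-- The norm in `L_{p'}(ℓ_{q'})` is determined by the pairing with finite sequences of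
`L_p(ℓ_q)`. -/
theorem nrm_lq_le_of_pairing (hpp : p.HolderConjugate p') (hqq : q.HolderConjugate q')
    {h : ℕ → α → ℂ} (hm : ∀ j, Measurable (h j))
    (hfin : ∀ j, nrm p' μ (fun x => ‖h j x‖ₑ) < ∞) {C : ℝ≥0∞}
    (hC : ∀ (N : ℕ) (f : ℕ → α → ℂ), (∀ j, Measurable (f j)) →
      (∀ j, nrm p μ (fun x => ‖f j x‖ₑ) < ∞) →
      ‖∑ j ∈ Finset.range N, ∫ x, f j x * h j x ∂μ‖ₑ ≤
        C * nrm p μ (fun x => lq q fun j => ‖f j x‖ₑ)) :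
    nrm p' μ (fun x => lq q' fun j => ‖h j x‖ₑ) ≤ C := by
  have hp0 := hpp.pos
  have hp'0 := hpp.symm.pos
  have hq0 := hqq.pos
  have hq'0 := hqq.symm.pos
  have hq1 := hqq.symm.sub_one_pos
  have hme : ∀ j, Measurable fun x => ‖h j x‖ₑ := fun j => (hm j).enorm
  have htm : ∀ N j, Measurable fun x => trunc N (fun j => ‖h j x‖ₑ) j := fun N j => by
    rcases lt_or_ge j N with hj | hj
    · simpa only [trunc_of_lt hj] using hme j
    · simpa only [trunc_of_le hj] using measurable_const
  refine nrm_le_of_le_liminf hp'0 (u := atTop)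
    (F := fun N x => lq q' (trunc N fun j => ‖h j x‖ₑ)) (fun N => measurable_lq (htm N))
    (.of_forall fun x => lq_le_iSup_trunc hq'0 _) fun N => ?_
  set H : α → ℝ≥0∞ := fun x => lq q' (trunc N fun j => ‖h j x‖ₑ) with hH
  have hHm : Measurable H := measurable_lq (htm N)
  have hHtop : ∀ x, H x ≠ ∞ := fun x =>
    ((lq_trunc_le_sum hqq.symm.lt.le N _).trans_lt
      (ENNReal.sum_lt_top.2 fun j _ => enorm_lt_top)).ne
  have hHfin : nrm p' μ H < ∞ := by
    refine (nrm_mono hp'0 fun x => lq_trunc_le_sum hqq.symm.lt.le N _).trans_lt ?_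
    refine (nrm_sum_le hpp.symm.lt.le _ fun j => (hme j).aemeasurable).trans_lt ?_
    exact ENNReal.sum_lt_top.2 fun j _ => hfin j
  -- the extremal sequence of Hölder's inequality
  set w : ℕ → α → ℝ≥0∞ := fun j x =>
    trunc N (fun j => ‖h j x‖ₑ) j ^ (q' - 1) * H x ^ (p' - q') with hw
  have hwm : ∀ j, Measurable (w j) := fun j =>
    ((htm N j).pow_const _).mul (hHm.pow_const _)
  have hwt := fun x => lq_weight (p' := p') hpp.symm.lt hqq (hHtop x)
  have hwtop : ∀ j x, w j x ≠ ∞ := fun j x => by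
    refine ne_top_of_le_ne_top ?_ (le_lq hq0 (fun j => w j x) j)
    rw [(hwt x).1]
    exact ENNReal.rpow_ne_top_of_nonneg hpp.symm.sub_one_pos.le (hHtop x)
  set f : ℕ → α → ℂ := fun j x => ((w j x).toReal : ℝ) * phase (h j x) with hf
  have hfm : ∀ j, Measurable (f j) := fun j =>
    (Complex.measurable_ofReal.comp (hwm j).ennreal_toReal).mul (measurable_phase.comp (hm j))
  have hfle : ∀ j x, ‖f j x‖ₑ ≤ w j x := fun j x => by
    rw [hf, ← ofReal_norm, norm_mul, Complex.norm_real, Real.norm_of_nonneg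
      ENNReal.toReal_nonneg]
    refine (ENNReal.ofReal_le_ofReal (mul_le_of_le_one_right ENNReal.toReal_nonneg
      (norm_phase_le _))).trans ENNReal.ofReal_toReal_le
  set X := ∫⁻ x, H x ^ p' ∂μ with hX
  have hXtop : X ≠ ∞ := by
    rw [hX, ← nrm_rpow hp'0]
    exact ENNReal.rpow_ne_top_of_nonneg hp'0.le hHfin.ne
  have hfX : nrm p μ (fun x => lq q fun j => ‖f j x‖ₑ) ≤ X ^ (1 / p) := by
    refine (nrm_mono hp0 (G := fun x => H x ^ (p' - 1)) fun x => ?_).trans_eq ?_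
    · exact (lq_mono hq0 fun j => hfle j x).trans_eq (hwt x).1
    · rw [nrm]
      simp_rw [← ENNReal.rpow_mul, hpp.symm.sub_one_mul_conj]
      rw [hX]
  have hffin : ∀ j, nrm p μ (fun x => ‖f j x‖ₑ) < ∞ := fun j =>
    (nrm_mono hp0 fun x => le_lq hq0 (fun j => ‖f j x‖ₑ) j).trans_lt
      (hfX.trans_lt (ENNReal.rpow_lt_top_of_nonneg (one_div_pos.2 hp0).le hXtop))
  have hsum : ∑ j ∈ Finset.range N, ∫ x, f j x * h j x ∂μ = (X.toReal : ℂ) := by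
    rw [← integral_finsetSum _ fun j _ =>
      integrable_mul_of_nrm hpp (hfm j) (hm j) (hffin j) (hfin j)]
    have e : ∀ x, ∑ j ∈ Finset.range N, f j x * h j x = ((H x ^ p').toReal : ℂ) := fun x => by
      have h1 : ∀ j ∈ Finset.range N, f j x * h j x =
          (((w j x) * trunc N (fun j => ‖h j x‖ₑ) j).toReal : ℂ) := fun j hj => by
        rw [ENNReal.toReal_mul (a := w j x), trunc_of_lt (Finset.mem_range.1 hj), toReal_enorm,
          Complex.ofReal_mul, ← phase_mul, ← mul_assoc]
      rw [Finset.sum_congr rfl h1, ← (hwt x).2, tsum_eq_sum (s := Finset.range N),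
        ENNReal.toReal_sum]
      · push_cast; rfl
      · intro j hj
        refine ENNReal.mul_ne_top (hwtop j x) ?_
        rw [trunc_of_lt (Finset.mem_range.1 hj)]
        exact enorm_ne_top
      · intro j hj
        rw [trunc_of_le (by simpa using hj), mul_zero]
    simp_rw [e]
    rw [integral_complex_ofReal, integral_toReal (hHm.pow_const _).aemeasurable
      (.of_forall fun x => ENNReal.rpow_lt_top_of_nonneg hp'0.le (hHtop x))]
  have hmain := (hC N f hfm hffin).trans (mul_le_mul_right hfX C)
  rw [hsum, ← ofReal_norm, Complex.norm_real, Real.norm_of_nonneg ENNReal.toReal_nonneg,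
    ENNReal.ofReal_toReal hXtop] at hmain
  exact rpow_le_of_le_mul_rpow hpp hXtop hmain

/-- A pointwise bound for a function from the bounds of its pairings. -/
theorem enorm_le_of_pairing [SigmaFinite μ] (hpp : p.HolderConjugate p') {h : α → ℂ}
    (hm : Measurable h) (hfin : nrm p' μ (fun x => ‖h x‖ₑ) < ∞) {K : α → ℝ≥0∞}
    {A : Set α} (hA : MeasurableSet A)
    (hle : ∀ f : α → ℂ, Measurable f → nrm p μ (fun x => ‖f x‖ₑ) < ∞ → (∀ x ∈ A, f x = 0) →
      ‖∫ x, f x * h x ∂μ‖ₑ ≤ ∫⁻ x, ‖f x‖ₑ * K x ∂μ) :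
    ∀ᵐ x ∂μ, x ∉ A → ‖h x‖ₑ ≤ K x := by
  have hp0 := hpp.pos
  have key : Aᶜ.indicator (fun x => ‖h x‖ₑ) ≤ᵐ[μ] K := by
    refine ae_le_of_forall_setLIntegral_le_of_sigmaFinite
      (hm.enorm.indicator hA.compl) fun E hE hμE => ?_
    set f : α → ℂ := (E ∩ Aᶜ).indicator fun x => phase (h x) with hf
    have hfm : Measurable f := (measurable_phase.comp hm).indicator (hE.inter hA.compl)
    have hf1 : ∀ x, ‖f x‖ₑ ≤ E.indicator (fun _ => 1) x := fun x => by
      by_cases hx : x ∈ E ∩ Aᶜ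
      · rw [hf, indicator_of_mem hx, indicator_of_mem hx.1, ← ofReal_norm]
        exact (ENNReal.ofReal_le_ofReal (norm_phase_le _)).trans_eq ENNReal.ofReal_one
      · rw [hf, indicator_of_notMem hx, enorm_zero]
        exact zero_le
    have hffin : nrm p μ (fun x => ‖f x‖ₑ) < ∞ := by
      refine (nrm_mono hp0 hf1).trans_lt ?_
      change nrm p μ (E.indicator fun _ => 1) < ∞
      rw [← nrm_restrict hp0 hE, nrm_const hp0, Measure.restrict_apply_univ, one_mul]
      exact ENNReal.rpow_lt_top_of_nonneg (by positivity) hμE.ne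
    have hfh : ∀ x, f x * h x =
        ((E.indicator (Aᶜ.indicator fun x => ‖h x‖ₑ) x).toReal : ℂ) := fun x => by
      rw [indicator_indicator]
      by_cases hx : x ∈ E ∩ Aᶜ
      · rw [hf, indicator_of_mem hx, indicator_of_mem hx, phase_mul, toReal_enorm]
      · rw [hf, indicator_of_notMem hx, indicator_of_notMem hx]
        simp
    have hint := integrable_mul_of_nrm hpp hfm hm hffin hfin
    have hm2 : Measurable (E.indicator (Aᶜ.indicator fun x => ‖h x‖ₑ)) :=
      (hm.enorm.indicator hA.compl).indicator hE
    have htop : ∀ x, E.indicator (Aᶜ.indicator fun x => ‖h x‖ₑ) x < ∞ := fun x => by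
      rw [indicator_indicator]
      by_cases hx : x ∈ E ∩ Aᶜ <;> simp [hx]
    have hfin2 : ∫⁻ x, E.indicator (Aᶜ.indicator fun x => ‖h x‖ₑ) x ∂μ ≠ ∞ := by
      have := hint.2
      refine ne_of_lt (lt_of_le_of_lt (le_of_eq (lintegral_congr fun x => ?_)) this)
      rw [show (fun x => f x * h x) x = f x * h x from rfl, hfh, ← ofReal_norm, Complex.norm_real, Real.norm_of_nonneg ENNReal.toReal_nonneg,
        ENNReal.ofReal_toReal (htop x).ne]
    have h1 := hle f hfm hffin fun x hx => indicator_of_notMem (fun h => h.2 hx) _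
    simp_rw [hfh] at h1
    rw [integral_complex_ofReal, integral_toReal hm2.aemeasurable (.of_forall htop),
      ← ofReal_norm, Complex.norm_real, Real.norm_of_nonneg ENNReal.toReal_nonneg,
      ENNReal.ofReal_toReal hfin2, lintegral_indicator hE] at h1
    refine h1.trans ?_
    rw [← lintegral_indicator hE]
    refine lintegral_mono fun x => ?_
    refine (mul_le_mul_left (hf1 x) _).trans ?_
    by_cases hx : x ∈ E <;> simp [hx]
  filter_upwards [key] with x hx hxA
  rwa [indicator_of_mem (show x ∈ Aᶜ from hxA)] at hx

end Duality

end

section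

variable {n : ℕ} {p p' q q' r ϱ s : ℝ} {T : ℕ → D n → Cb n} {C₁ C₂ : ℝ≥0∞}

/-! ### The dual operators -/

/-- `h` is the image of `g` under the dual of the extension of `T` to `L_p`. -/
def IsLpDual (p : ℝ) (C : ℝ≥0∞) (T : D n → Cb n) (g h : Rn n → ℂ) : Prop :=
  ∀ f : Fn n, Np p f < ∞ → ∫ x, lpExt p C T f x * g x = ∫ x, f x * h x

theorem IsLpDual.eq_mk {C : ℝ≥0∞} {T : D n → Cb n} {g h : Rn n → ℂ} (H : IsLpDual p C T g h)
    {f : Rn n → ℂ} (hf : Measurable f) (hfp : Np p f < ∞) :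
    ∫ x, f x * h x = ∫ x, lpExt p C T (AEEqFun.mk f hf.aestronglyMeasurable) x * g x := by
  rw [H _ (by rwa [Np_congr (AEEqFun.coeFn_mk f _)])]
  refine integral_congr_ae ?_
  filter_upwards [AEEqFun.coeFn_mk f hf.aestronglyMeasurable] with x hx
  rw [hx]

theorem Adm.Np_lpExt_le (hT : Adm p q T C₁ C₂) (hp : 1 ≤ p) (hq : 1 ≤ q) (j : ℕ) {f : Fn n}
    (hf : Np p f < ∞) : Np p (lpExt p C₂ (T j) f) ≤ C₂ * Np p f := by
  have h := hT.lpExt_spec hp (zero_lt_one.trans_le hq) j hf 0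
  simpa [hT.zero] using h

theorem Adm.exists_isLpDual (hT : Adm p q T C₁ C₂) (hpp : p.HolderConjugate p') (hq : 1 ≤ q)
    (j : ℕ) (hlin : IsLinearMap ℂ (T j)) {g : Rn n → ℂ} (hgm : Measurable g)
    (hg : Np p' g < ∞) :
    ∃ h : Rn n → ℂ, Measurable h ∧ Np p' h < ∞ ∧ IsLpDual p C₂ (T j) g h := by
  classical
  have hp := hpp.lt.le
  have hp0 := hpp.pos
  have hq0 := zero_lt_one.trans_le hq
  have mkp : ∀ {f : Rn n → ℂ} (hf : Measurable f), nrm p volume (fun x => ‖f x‖ₑ) < ∞ →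
      Np p (AEEqFun.mk f hf.aestronglyMeasurable : Fn n) < ∞ := fun hf h => by
    rwa [Np_congr (AEEqFun.coeFn_mk _ _)]
  have hint : ∀ f : Fn n, Np p f < ∞ → Integrable fun x => lpExt p C₂ (T j) f x * g x :=
    fun f hf => integrable_mul_of_nrm hpp (Fn_measurable _) hgm
      ((hT.Np_lpExt_le hp hq j hf).trans_lt (ENNReal.mul_lt_top hT.C₂_ne_top.lt_top hf)) hg
  set Λ : (Rn n → ℂ) → ℂ := fun f => if hf : Measurable f then
    ∫ x, lpExt p C₂ (T j) (AEEqFun.mk f hf.aestronglyMeasurable) x * g x else 0 with hΛ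
  have hΛf : ∀ {f : Rn n → ℂ} (hf : Measurable f), Λ f =
      ∫ x, lpExt p C₂ (T j) (AEEqFun.mk f hf.aestronglyMeasurable) x * g x :=
    fun hf => dif_pos hf
  have hΛl : ∀ (f₁ f₂ f : Rn n → ℂ) (a b : ℂ), Measurable f₁ → Measurable f₂ →
      nrm p volume (fun x => ‖f₁ x‖ₑ) < ∞ → nrm p volume (fun x => ‖f₂ x‖ₑ) < ∞ →
      (∀ x, f x = a * f₁ x + b * f₂ x) → Λ f = a * Λ f₁ + b * Λ f₂ := by
    intro f₁ f₂ f a b h₁ h₂ hp₁ hp₂ hf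
    obtain rfl : f = fun x => a * f₁ x + b * f₂ x := funext hf
    have hm : Measurable fun x => a * f₁ x + b * f₂ x := (h₁.const_mul a).add (h₂.const_mul b)
    have hpf : nrm p volume (fun x => ‖a * f₁ x + b * f₂ x‖ₑ) < ∞ := by
      refine (nrm_mono hp0 fun x => enorm_add_le _ _).trans_lt ((nrm_add_le hp
        (h₁.const_mul a).enorm.aemeasurable (h₂.const_mul b).enorm.aemeasurable).trans_lt ?_)
      simp only [enorm_mul]
      rw [nrm_const_mul hp0 _ h₁.enorm, nrm_const_mul hp0 _ h₂.enorm]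
      exact ENNReal.add_lt_top.2 ⟨ENNReal.mul_lt_top enorm_lt_top hp₁,
        ENNReal.mul_lt_top enorm_lt_top hp₂⟩
    rw [hΛf hm, hΛf h₁, hΛf h₂, ← integral_const_mul, ← integral_const_mul, ← integral_add
      ((hint _ (mkp h₁ hp₁)).const_mul _) ((hint _ (mkp h₂ hp₂)).const_mul _)]
    refine integral_congr_ae ?_
    filter_upwards [hT.lpExt_linear hp hq0 j hlin (mkp h₁ hp₁) (mkp h₂ hp₂) (mkp hm hpf) a b (by
      filter_upwards [AEEqFun.coeFn_mk _ hm.aestronglyMeasurable,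
        AEEqFun.coeFn_mk _ h₁.aestronglyMeasurable,
        AEEqFun.coeFn_mk _ h₂.aestronglyMeasurable] with x e e₁ e₂
      rw [e, e₁, e₂])] with x hx
    rw [hx]
    ring
  have hfun : IsLpFunctional p volume (C₂ * Np p' g) Λ := by
    refine ⟨fun f₁ f₂ h₁ h₂ hp₁ hp₂ => ?_, fun f c hf hfp => ?_, fun f hf hfp => ?_,
      ENNReal.mul_ne_top hT.C₂_ne_top hg.ne⟩
    · have := hΛl f₁ f₂ (fun x => f₁ x + f₂ x) 1 1 h₁ h₂ hp₁ hp₂ fun x => by ring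
      rwa [one_mul, one_mul] at this
    · have := hΛl f f (fun x => c * f x) c 0 hf hf hfp hfp fun x => by ring
      rwa [zero_mul, add_zero] at this
    · rw [hΛf hf]
      refine (enorm_integral_mul_le hpp (Fn_measurable _) hgm).trans ?_
      have h1 := hT.Np_lpExt_le hp hq j (mkp hf hfp)
      rw [Np_congr (AEEqFun.coeFn_mk f _)] at h1
      calc _ ≤ C₂ * Np p f * Np p' g := mul_le_mul_left h1 _
        _ = C₂ * Np p' g * Np p f := by ring
  obtain ⟨h, hm, hle, hrep⟩ := hfun.exists_repr hpp
  refine ⟨h, hm, hle.trans_lt (ENNReal.mul_lt_top hT.C₂_ne_top.lt_top hg), fun f hf => ?_⟩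
  rw [← hrep f (Fn_measurable f) hf, hΛf (Fn_measurable f)]
  rw [AEEqFun.mk_coeFn]

/-- The `L_{p'}(ℓ_{q'})` bound for the dual operators. -/
theorem Adm.nrm_lq_dual_le (hT : Adm p q T C₁ C₂) (hpp : p.HolderConjugate p')
    (hqq : q.HolderConjugate q') {g h : ℕ → Rn n → ℂ} (hgm : ∀ j, Measurable (g j))
    (hg : ∀ j, Np p' (g j) < ∞) (hm : ∀ j, Measurable (h j)) (hh : ∀ j, Np p' (h j) < ∞)
    (hgh : ∀ j, IsLpDual p C₂ (T j) (g j) (h j)) :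
    nrm p' volume (fun x => lq q' fun j => ‖h j x‖ₑ) ≤
      C₂ * nrm p' volume (fun x => lq q' fun j => ‖g j x‖ₑ) := by
  have hp := hpp.lt.le
  have hp0 := hpp.pos
  refine nrm_lq_le_of_pairing hpp hqq hm hh fun N f hf hfp => ?_
  set F : ℕ → Fn n := fun j => AEEqFun.mk (f j) (hf j).aestronglyMeasurable with hF
  have hFf : ∀ j, (F j : Rn n → ℂ) =ᵐ[volume] f j := fun j => AEEqFun.coeFn_mk _ _
  have hFp : ∀ j, Np p (F j) < ∞ := fun j => by rw [Np_congr (hFf j)]; exact hfp j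
  have hint : ∀ j, Integrable fun x => lpExt p C₂ (T j) (F j) x * g j x := fun j =>
    integrable_mul_of_nrm hpp (Fn_measurable _) (hgm j)
      ((hT.Np_lpExt_le hp hqq.lt.le j (hFp j)).trans_lt
        (ENNReal.mul_lt_top hT.C₂_ne_top.lt_top (hFp j))) (hg j)
  have hmE : ∀ j, Measurable fun x => ‖lpExt p C₂ (T j) (F j) x‖ₑ := fun j =>
    (Fn_measurable _).enorm
  have e : ∀ j ∈ Finset.range N, ∫ x, f j x * h j x = ∫ x, lpExt p C₂ (T j) (F j) x * g j x :=
    fun j _ => (hgh j).eq_mk (hf j) (hfp j)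
  rw [Finset.sum_congr rfl e, ← integral_finsetSum _ fun j _ => hint j]
  calc ‖∫ x, ∑ j ∈ Finset.range N, lpExt p C₂ (T j) (F j) x * g j x‖ₑ
      ≤ ∫⁻ x, (lq q fun j => ‖lpExt p C₂ (T j) (F j) x‖ₑ) * lq q' fun j => ‖g j x‖ₑ := by
        refine (enorm_integral_le_lintegral_enorm _).trans (lintegral_mono fun x => ?_)
        refine (enorm_sum_le _ _).trans ?_
        simp only [enorm_mul]
        exact (ENNReal.sum_le_tsum _).trans (sum_mul_le_lq hqq _ _)
    _ ≤ nrm p volume (fun x => lq q fun j => ‖lpExt p C₂ (T j) (F j) x‖ₑ) *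
          nrm p' volume (fun x => lq q' fun j => ‖g j x‖ₑ) :=
        nrm_holder hpp (measurable_lq hmE).aemeasurable
          (measurable_lq fun j => (hgm j).enorm).aemeasurable
    _ ≤ C₂ * nrm p volume (fun x => lq q fun j => ‖F j x‖ₑ) *
          nrm p' volume (fun x => lq q' fun j => ‖g j x‖ₑ) := by
        gcongr
        exact hT.nrm_lq_lpExt_le hp hqq.lt.le hFp
    _ = _ := by
        have : nrm p volume (fun x => lq q fun j => ‖F j x‖ₑ) =
            nrm p volume (fun x => lq q fun j => ‖f j x‖ₑ) := by
          refine nrm_congr_ae ?_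
          filter_upwards [ae_all_iff.2 hFf] with x hx
          simp only [hx]
        rw [this]
        ring

/-- The size estimate is inherited by the dual operators. -/
theorem Adm.enorm_dual_le (hT : Adm p q T C₁ C₂) (hn : 0 < n) (hpp : p.HolderConjugate p')
    (hqq : q.HolderConjugate q') (j : ℕ) (i : Idx n) {g h : Rn n → ℂ} (hgm : Measurable g)
    (hg0 : ∀ x, x ∉ Q i → g x = 0) (hm : Measurable h) (hh : Np p' h < ∞)
    (hgh : IsLpDual p C₂ (T j) g h) :
    ∀ᵐ z, z ∉ kball i 2 → ‖h z‖ₑ ≤ C₁ * (∫⁻ x, ‖g x‖ₑ) * ker i z := by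
  refine enorm_le_of_pairing hpp hm hh (measurableSet_kball i 2) fun f hf hfp hf0 => ?_
  rw [hgh.eq_mk hf hfp]
  set F : Fn n := AEEqFun.mk f hf.aestronglyMeasurable with hF
  have hFf : (F : Rn n → ℂ) =ᵐ[volume] f := AEEqFun.coeFn_mk _ _
  have hFp : Np p F < ∞ := by rw [Np_congr hFf]; exact hfp
  have hb := hT.enorm_lpExt_le hn hpp hqq.pos j i hFp (by
    filter_upwards [hFf] with x hx hxb
    rw [hx, hf0 x hxb])
  have e : ∫⁻ z, ‖F z‖ₑ * ker i z = ∫⁻ z, ‖f z‖ₑ * ker i z := by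
    refine lintegral_congr_ae ?_
    filter_upwards [hFf] with x hx
    rw [hx]
  calc ‖∫ x, lpExt p C₂ (T j) F x * g x‖ₑ
      ≤ ∫⁻ x, (C₁ * ∫⁻ z, ‖F z‖ₑ * ker i z) * ‖g x‖ₑ := by
        refine (enorm_integral_le_lintegral_enorm _).trans (lintegral_mono_ae ?_)
        filter_upwards [hb] with x hx
        rw [enorm_mul]
        by_cases hxi : x ∈ Q i
        · gcongr
          exact hx hxi
        · simp [hg0 x hxi]
    _ = (∫⁻ z, ‖f z‖ₑ * ker i z) * (C₁ * ∫⁻ x, ‖g x‖ₑ) := by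
        rw [lintegral_const_mul _ hgm.enorm, e]
        ring
    _ = _ := by
        have hmk : Measurable fun z => ‖f z‖ₑ * ker i z := hf.enorm.mul (measurable_ker i)
        rw [← lintegral_mul_const _ hmk]
        exact lintegral_congr fun x => by ring

/-- The constant in the predual estimates; it is positive for convenience. -/
noncomputable def predualC (n : ℕ) (p p' s : ℝ) (C₁ C₂ : ℝ≥0∞) : ℝ≥0∞ :=
  two ((n + 3) * s) * C₂ + C₁ * volC n ^ (1 / p) * kerC n p' s (n / p - s) + 1

theorem predualC_ne_top (hpp : p.HolderConjugate p') (hsn : s < n / p) (h₁ : C₁ ≠ ∞)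
    (h₂ : C₂ ≠ ∞) : predualC n p p' s C₁ C₂ ≠ ∞ := by
  have := hpp.pos
  refine ENNReal.add_ne_top.2 ⟨ENNReal.add_ne_top.2 ⟨ENNReal.mul_ne_top (two_ne_top _) h₂,
    ENNReal.mul_ne_top (ENNReal.mul_ne_top h₁ ?_) (kerC_lt_top hpp.symm.pos (by linarith)).ne⟩,
    ENNReal.one_ne_top⟩
  exact ENNReal.rpow_ne_top_of_nonneg (by positivity) volC_ne_top

/-- The predual estimate for sequences supported in a cube: near the cube it follows from the
`L_{p'}(ℓ_{q'})` bound, away from it from the size estimate. -/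
theorem Adm.pn_lq_dual_le (hT : Adm p q T C₁ C₂) (hn : 0 < n) (hpp : p.HolderConjugate p')
    (hqq : q.HolderConjugate q') (i : Idx n) {g h : ℕ → Rn n → ℂ}
    (hgm : ∀ j, Measurable (g j)) (hg0 : ∀ j x, x ∉ Q i → g j x = 0)
    (hgp : lpNorm p' (Q i) (fun x => lq q' fun j => ‖g j x‖ₑ) ≠ ∞)
    (hg : ∀ j, Np p' (g j) < ∞) (hm : ∀ j, Measurable (h j)) (hh : ∀ j, Np p' (h j) < ∞)
    (hgh : ∀ j, IsLpDual p C₂ (T j) (g j) (h j)) :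
    pn p' s (fun x => lq q' fun j => ‖h j x‖ₑ) ≤ predualC n p p' s C₁ C₂ *
      (two (-(i.1 * s)) * lpNorm p' (Q i) (fun x => lq q' fun j => ‖g j x‖ₑ)) := by
  have hp0 := hpp.pos
  have hp'0 := hpp.symm.pos
  have hq'0 := hqq.symm.pos
  set G : Rn n → ℝ≥0∞ := fun x => lq q' fun j => ‖g j x‖ₑ with hG
  set H : Rn n → ℝ≥0∞ := fun x => lq q' fun j => ‖h j x‖ₑ with hH
  have hGm : Measurable G := measurable_lq fun j => (hgm j).enorm
  have hHm : Measurable H := measurable_lq fun j => (hm j).enorm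
  have hG0 : ∀ x, x ∉ Q i → G x = 0 := fun x hx => by
    rw [hG]
    simp only [hg0 _ x hx, enorm_zero]
    exact lq_single hq'0 _ 0 fun _ _ => rfl
  have hGi : (Q i).indicator G = G := by
    funext x
    by_cases hx : x ∈ Q i
    · rw [indicator_of_mem hx]
    · rw [indicator_of_notMem hx, hG0 x hx]
  have hGN : nrm p' volume G = lpNorm p' (Q i) G := by
    rw [lpNorm_eq_nrm, nrm_restrict hp'0 (measurableSet_Q i), hGi]
  set N := lpNorm p' (Q i) G with hN
  -- the integral of `G`
  have hG1 : ∫⁻ x, G x ≤ volC n ^ (1 / p) * two (-(i.1 * (n / p))) * N := by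
    calc ∫⁻ x, G x = ∫⁻ x in Q i, 1 * G x := by
          rw [← lintegral_indicator (measurableSet_Q i)]
          simp only [one_mul, hGi]
      _ ≤ nrm p (volume.restrict (Q i)) (fun _ => 1) * nrm p' (volume.restrict (Q i)) G :=
          nrm_holder hpp aemeasurable_const hGm.aemeasurable
      _ ≤ _ := by
          rw [nrm_const hp0, one_mul, Measure.restrict_apply_univ]
          refine mul_le_mul_left ((volume_Q_rpow_le (by positivity) i).trans_eq ?_) _
          rw [mul_one_div]
  have hG1top : ∫⁻ x, G x ≠ ∞ := by
    refine ne_top_of_le_ne_top (ENNReal.mul_ne_top (ENNReal.mul_ne_top ?_ (two_ne_top _)) hgp) hG1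
    exact ENNReal.rpow_ne_top_of_nonneg (by positivity) volC_ne_top
  have hfar : ∀ᵐ z, z ∉ kball i 2 → H z ≤ C₁ * (∫⁻ x, G x) * ker i z := by
    filter_upwards [ae_all_iff.2 fun j => hT.enorm_dual_le hn hpp hqq j i (hgm j) (hg0 j) (hm j)
      (hh j) (hgh j)] with z hz hzb
    calc H z ≤ lq q' fun j => C₁ * ((∫⁻ x, ‖g j x‖ₑ) * ker i z) :=
          lq_mono hq'0 fun j => (hz j hzb).trans_eq (mul_assoc _ _ _)
      _ = C₁ * ((lq q' fun j => ∫⁻ x, ‖g j x‖ₑ) * ker i z) := by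
          rw [lq_const_mul hq'0, lq_mul_const hq'0]
      _ ≤ C₁ * ((∫⁻ x, G x) * ker i z) := by
          gcongr
          exact lq_lintegral_le hqq.symm fun j => (hgm j).enorm
      _ = _ := (mul_assoc _ _ _).symm
  have hle : ∀ᵐ z, H z ≤ (Q (enl i 2)).indicator H z + C₁ * (∫⁻ x, G x) * ker i z := by
    filter_upwards [hfar] with z hz
    by_cases hzb : z ∈ kball i 2
    · rw [indicator_of_mem (kball_subset_enl i 2 hzb)]
      exact le_self_add
    · exact (hz hzb).trans le_add_self
  refine (pn_mono_ae hle).trans ((pn_add_le hpp.symm.lt.le _ _).trans ?_)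
  have h1 : pn p' s ((Q (enl i 2)).indicator H) ≤
      two ((n + 3) * s) * C₂ * (two (-(i.1 * s)) * N) := by
    refine (pn_indicator_le hp'0 _ hHm).trans ?_
    have e : two (-((enl i 2).1 * s)) = two ((n + 3) * s) * two (-(i.1 * s)) := by
      rw [← two_add, enl_fst]
      congr 1
      push_cast; ring
    have h2 : lpNorm p' (Q (enl i 2)) H ≤ C₂ * N := by
      rw [← hGN]
      exact (nrm_mono_measure hp'0 Measure.restrict_le_self _).trans
        (hT.nrm_lq_dual_le hpp hqq hgm hg hm hh hgh)
    calc _ ≤ two ((n + 3) * s) * two (-(i.1 * s)) * (C₂ * N) := by rw [e]; gcongr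
      _ = _ := by ring
  have h2 : pn p' s (fun z => C₁ * (∫⁻ x, G x) * ker i z) ≤
      C₁ * volC n ^ (1 / p) * kerC n p' s (n / p - s) * (two (-(i.1 * s)) * N) := by
    refine (pn_const_mul_le hp'0 (ENNReal.mul_ne_top hT.C₁_ne_top hG1top) _).trans ?_
    have e : two (-(i.1 * (n / p))) * two (i.1 * (n / p - s)) = two (-(i.1 * s)) := by
      rw [← two_add]
      congr 1
      ring
    calc _ ≤ C₁ * (volC n ^ (1 / p) * two (-(i.1 * (n / p))) * N) *
          (kerC n p' s (n / p - s) * two (i.1 * (n / p - s))) := by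
          gcongr
          exact pn_ker_le hpp i
      _ = C₁ * volC n ^ (1 / p) * kerC n p' s (n / p - s) *
          ((two (-(i.1 * (n / p))) * two (i.1 * (n / p - s))) * N) := by ring
      _ = _ := by rw [e]
  calc _ ≤ _ := add_le_add h1 h2
    _ = (two ((n + 3) * s) * C₂ + C₁ * volC n ^ (1 / p) * kerC n p' s (n / p - s)) *
          (two (-(i.1 * s)) * N) := (add_mul _ _ _).symm
    _ ≤ _ := mul_le_mul_left le_self_add _

end

section

variable {n : ℕ} {p p' q q' r ϱ s : ℝ} {T : ℕ → D n → Cb n} {C₁ C₂ : ℝ≥0∞}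

/-! ### The dual operators on the predual Morrey spaces -/

theorem lq_tsum_le (hq : 1 ≤ q) {ι : Type*} [Countable ι] (a : ι → ℕ → ℝ≥0∞) :
    lq q (fun j => ∑' i, a i j) ≤ ∑' i, lq q (a i) :=
  nrm_tsum_le hq fun _ => measurable_from_top

/-- `h` is the image of `g` under the dual of `T`, tested with `D(ℝⁿ)`. -/
def IsDualPair (T : D n → Cb n) (g h : Rn n → ℂ) : Prop :=
  ∀ φ : D n, ∫ x, T φ x * g x = ∫ x, φ x * h x

theorem IsLpDual.isDualPair (hT : Adm p q T C₁ C₂) (hp : 1 ≤ p) (hq : 0 < q) {j : ℕ}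
    {g h : Rn n → ℂ} (H : IsLpDual p C₂ (T j) g h) : IsDualPair (T j) g h := fun φ => by
  have h1 := H (ofD φ) (by rw [Np_congr (coe_ofD φ)]; exact Np_D_lt_top (by linarith) φ)
  have e1 : ∫ x, lpExt p C₂ (T j) (ofD φ) x * g x = ∫ x, T j φ x * g x := by
    refine integral_congr_ae ?_
    filter_upwards [hT.lpExt_ofD hp hq j (coe_ofD φ)] with x hx
    rw [hx]
  have e2 : ∫ x, ofD φ x * h x = ∫ x, φ x * h x := by
    refine integral_congr_ae ?_
    filter_upwards [coe_ofD φ] with x hx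
    rw [hx]
  rwa [e1, e2] at h1

theorem IsDualPair.congr_right {T : D n → Cb n} {g h k : Rn n → ℂ} (H : IsDualPair T g h)
    (hk : k =ᵐ[volume] h) : IsDualPair T g k := fun φ => by
  rw [H φ]
  refine integral_congr_ae ?_
  filter_upwards [hk] with x hx
  rw [hx]

/-- The image under the dual is determined by testing with `D(ℝⁿ)`. -/
theorem IsDualPair.ae_eq {T : D n → Cb n} {g h k : Rn n → ℂ} (H : IsDualPair T g h)
    (K : IsDualPair T g k) (hh : LocallyIntegrable h) (hk : LocallyIntegrable k) :
    h =ᵐ[volume] k := by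
  refine ae_eq_of_integral_contDiff_smul_eq hh hk fun f hf hfc => ?_
  set φ : D n := mkD (fun x => (f x : ℂ)) (Complex.ofRealCLM.contDiff.comp hf)
    (hfc.comp_left (g := Complex.ofReal) (by simp)) with hφ
  have h1 := (H φ).symm.trans (K φ)
  simp only [Complex.real_smul]
  exact h1

namespace Setting

/-- Absolute convergence of the pairing of a Morrey space and its predual. -/
theorem lintegral_mul_lt_top (S : Setting n p p' q q' r T C₁ C₂) {f g : Rn n → ℂ}
    (hf : Measurable f) (hfm : mn p (n / p + r) (fun x => ‖f x‖ₑ) < ∞)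
    (hg : pn p' (n / p + r) (fun x => ‖g x‖ₑ) < ∞) : ∫⁻ x, ‖f x * g x‖ₑ < ∞ := by
  simp only [enorm_mul]
  exact (lintegral_mul_le_mn_mul_pn S.hp hf.enorm hfm.ne).trans_lt (ENNReal.mul_lt_top hfm hg)

theorem integrable_mul (S : Setting n p p' q q' r T C₁ C₂) {f g : Rn n → ℂ}
    (hf : Measurable f) (hgm : Measurable g) (hfm : mn p (n / p + r) (fun x => ‖f x‖ₑ) < ∞)
    (hg : pn p' (n / p + r) (fun x => ‖g x‖ₑ) < ∞) : Integrable fun x => f x * g x :=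
  ⟨(hf.mul hgm).aestronglyMeasurable, S.lintegral_mul_lt_top hf hfm hg⟩

theorem enorm_integral_mul_le (S : Setting n p p' q q' r T C₁ C₂) {f g : Rn n → ℂ}
    (hf : Measurable f) (hfm : mn p (n / p + r) (fun x => ‖f x‖ₑ) < ∞) :
    ‖∫ x, f x * g x‖ₑ ≤ mn p (n / p + r) (fun x => ‖f x‖ₑ) *
      pn p' (n / p + r) (fun x => ‖g x‖ₑ) := by
  refine (enorm_integral_le_lintegral_enorm _).trans ?_
  simp only [enorm_mul]
  exact lintegral_mul_le_mn_mul_pn S.hp hf.enorm hfm.ne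

theorem mn_D_lt_top (S : Setting n p p' q q' r T C₁ C₂) (φ : D n) :
    mn p (n / p + r) (fun x => ‖φ x‖ₑ) < ∞ := by
  rw [← mn_congr_ae S.hp.pos (F := fun x => ‖ofD φ x‖ₑ)]
  · exact mn_ofD_lt_top S.hp.lt.le S.s_nonneg S.s_lt.le φ
  · filter_upwards [coe_ofD φ] with x hx
    rw [hx]

theorem mn_T_lt_top (S : Setting n p p' q q' r T C₁ C₂) (j : ℕ) (φ : D n) :
    mn p (n / p + r) (fun x => ‖T j φ x‖ₑ) < ∞ := by
  have h := S.mapsTo_morrey j (S.ofD_mem_morrey φ)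
  rw [S.extends_mext j φ] at h
  change morreyNorm p r _ < ∞ at h
  rw [morreyNorm_eq] at h
  rw [← mn_congr_ae S.hp.pos (F := fun x => ‖ofC (T j φ) x‖ₑ)]
  · exact h
  · filter_upwards [coe_ofC (T j φ)] with x hx
    rw [hx]

/-- The constant of the predual estimates. -/
noncomputable def dualConst (_ : Setting n p p' q q' r T C₁ C₂) : ℝ≥0∞ :=
  predualC n p p' (n / p + r) C₁ C₂

theorem dualConst_ne_top (S : Setting n p p' q q' r T C₁ C₂) : S.dualConst ≠ ∞ :=
  predualC_ne_top S.hp S.s_lt S.adm.C₁_ne_top S.adm.C₂_ne_top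

theorem dualConst_ne_zero (S : Setting n p p' q q' r T C₁ C₂) : S.dualConst ≠ 0 :=
  (zero_lt_one.trans_le le_add_self).ne'

/-- The image under the dual operators of a sequence dominated by `∑_Q 1_Q u_Q`: the sequence is
split into pieces supported in the cubes, and the images of the pieces are added up. -/
theorem exists_dual_of_le_qsum (S : Setting n p p' q q' r T C₁ C₂)
    (hlin : ∀ j, IsLinearMap ℂ (T j)) (g : ℕ → Fn n) {u : Idx n → Rn n → ℝ≥0∞}
    (hu : ∀ i, Measurable (u i)) (hgu : ∀ᵐ x, (lq q' fun j => ‖g j x‖ₑ) ≤ qsum u x)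
    (hcost : ∑' i, two (-(i.1 * (n / p + r))) * lpNorm p' (Q i) (u i) ≠ ∞) :
    ∃ h : ℕ → Fn n, pn p' (n / p + r) (fun x => lq q' fun j => ‖h j x‖ₑ) ≤
        S.dualConst * ∑' i, two (-(i.1 * (n / p + r))) * lpNorm p' (Q i) (u i) ∧
      ∀ j, IsDualPair (T j) (g j) (h j) := by
  have hp0 := S.hp.pos
  have hp'0 := S.hp.symm.pos
  have hq'0 := S.hq.symm.pos
  set gg : Idx n → ℕ → Rn n → ℂ := fun i j x => wgt u i x * g j x with hgg
  have hggm : ∀ i j, Measurable (gg i j) := fun i j =>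
    (measurable_wgt hu i).mul (Fn_measurable _)
  have hgg0 : ∀ i j x, x ∉ Q i → gg i j x = 0 := fun i j x hx => by
    rw [hgg]; simp only [wgt_of_notMem u hx, zero_mul]
  have hlq : ∀ᵐ x, ∀ i, (lq q' fun j => ‖gg i j x‖ₑ) ≤ (Q i).indicator (u i) x := by
    filter_upwards [hgu] with x hx i
    simp only [hgg, enorm_mul]
    rw [lq_const_mul hq'0]
    exact enorm_wgt_mul_le u i x hx
  have hlqQ : ∀ i, lpNorm p' (Q i) (fun x => lq q' fun j => ‖gg i j x‖ₑ) ≤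
      lpNorm p' (Q i) (u i) := fun i => by
    refine nrm_mono_ae hp'0 (ae_restrict_of_ae ?_)
    filter_upwards [hlq] with x hx
    exact (hx i).trans (indicator_le_self _ _ _)
  have hufin : ∀ i, lpNorm p' (Q i) (u i) ≠ ∞ := fun i htop => by
    refine hcost (ENNReal.tsum_eq_top_of_eq_top ⟨i, ?_⟩)
    rw [htop, ENNReal.mul_top (two_ne_zero' _)]
  have hggp : ∀ i j, Np p' (gg i j) < ∞ := fun i j => by
    refine lt_of_le_of_lt ?_ (hufin i).lt_top
    rw [lpNorm_eq_nrm, nrm_restrict hp'0 (measurableSet_Q i)]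
    refine nrm_mono_ae hp'0 ?_
    filter_upwards [hlq] with x hx
    exact (le_lq hq'0 (fun j => ‖gg i j x‖ₑ) j).trans (hx i)
  choose hh hhm hhp hhd using fun i j =>
    S.adm.exists_isLpDual S.hp S.hq.lt.le j (hlin j) (hggm i j) (hggp i j)
  have hpn : ∀ i, pn p' (n / p + r) (fun x => lq q' fun j => ‖hh i j x‖ₑ) ≤
      S.dualConst * (two (-(i.1 * (n / p + r))) * lpNorm p' (Q i) (u i)) := fun i => by
    refine (S.adm.pn_lq_dual_le S.hn S.hp S.hq i (hggm i) (hgg0 i)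
      (ne_top_of_le_ne_top (hufin i) (hlqQ i)) (hggp i) (hhm i) (hhp i) (hhd i)).trans ?_
    exact mul_le_mul_right (mul_le_mul_right (hlqQ i) _) _
  have hpnsum : pn p' (n / p + r) (fun x => ∑' i, lq q' fun j => ‖hh i j x‖ₑ) ≤
      S.dualConst * ∑' i, two (-(i.1 * (n / p + r))) * lpNorm p' (Q i) (u i) := by
    rw [← ENNReal.tsum_mul_left]
    exact (pn_tsum_le S.hp.symm.lt.le _).trans (ENNReal.tsum_le_tsum hpn)
  have hpntop := hpnsum.trans_lt (ENNReal.mul_lt_top S.dualConst_ne_top.lt_top hcost.lt_top)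
  have hm : ∀ j, Measurable fun x => ∑' i, hh i j x := fun j => Measurable.tsum fun i => hhm i j
  set h : ℕ → Fn n := fun j => AEEqFun.mk _ (hm j).aestronglyMeasurable with hh'
  have hcoe : ∀ j, (h j : Rn n → ℂ) =ᵐ[volume] fun x => ∑' i, hh i j x := fun j =>
    AEEqFun.coeFn_mk _ _
  refine ⟨h, (pn_mono_ae ?_).trans hpnsum, fun j => IsDualPair.congr_right (fun φ => ?_)
    (hcoe j)⟩
  · filter_upwards [ae_all_iff.2 hcoe] with x hx
    refine (lq_mono hq'0 fun j => ?_).trans (lq_tsum_le S.hq.symm.lt.le _)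
    rw [hx j]
    exact enorm_tsum_le_tsum_enorm
  · have hTm := Cb_measurable (T j φ)
    have hφm := D_measurable φ
    have hφh : ∀ i, Measurable fun x => φ x * hh i j x := fun i => hφm.mul (hhm i j)
    have hTg : ∀ i, Measurable fun x => T j φ x * gg i j x := fun i => hTm.mul (hggm i j)
    -- both sums of integrals converge absolutely
    have h1 : ∑' i, ∫⁻ x, ‖φ x * hh i j x‖ₑ ≠ ∞ := by
      rw [← lintegral_tsum fun i => (hφh i).enorm.aemeasurable]
      simp only [enorm_mul, ENNReal.tsum_mul_left]
      refine ne_of_lt (lt_of_le_of_lt (lintegral_mono fun x => mul_le_mul_right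
        (ENNReal.tsum_le_tsum fun i => le_lq hq'0 (fun j => ‖hh i j x‖ₑ) j) _) ?_)
      exact (lintegral_mul_le_mn_mul_pn S.hp hφm.enorm (S.mn_D_lt_top φ).ne).trans_lt
        (ENNReal.mul_lt_top (S.mn_D_lt_top φ) hpntop)
    have h2 : ∑' i, ∫⁻ x, ‖T j φ x * gg i j x‖ₑ ≠ ∞ := by
      rw [← lintegral_tsum fun i => (hTg i).enorm.aemeasurable]
      simp only [enorm_mul, ENNReal.tsum_mul_left]
      refine ne_of_lt (lt_of_le_of_lt (lintegral_mono_ae (g := fun x => ‖T j φ x‖ₑ * qsum u x)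
        ?_) ?_)
      · filter_upwards [hlq] with x hx
        exact mul_le_mul_right (ENNReal.tsum_le_tsum fun i =>
          (le_lq hq'0 (fun j => ‖gg i j x‖ₑ) j).trans (hx i)) _
      · exact (lintegral_mul_le_mn_mul_pn S.hp hTm.enorm (S.mn_T_lt_top j φ).ne).trans_lt
          (ENNReal.mul_lt_top (S.mn_T_lt_top j φ) ((pn_qsum_le hu).trans_lt hcost.lt_top))
    have hq : ∀ᵐ x, qsum u x < ∞ := ae_lt_top_of_pn S.hp S.s_nonneg S.s_lt.le
      (measurable_qsum hu) ((pn_qsum_le hu).trans_lt hcost.lt_top)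
    calc ∫ x, T j φ x * g j x = ∫ x, ∑' i, T j φ x * gg i j x := by
          refine integral_congr_ae ?_
          filter_upwards [hq, hgu] with x hx hx2
          rw [tsum_mul_left, (hasSum_wgt_mul hx.ne
            ((le_lq hq'0 (fun j => ‖g j x‖ₑ) j).trans hx2)).tsum_eq]
      _ = ∑' i, ∫ x, T j φ x * gg i j x :=
          integral_tsum (fun i => (hTg i).aestronglyMeasurable) h2
      _ = ∑' i, ∫ x, φ x * hh i j x := tsum_congr fun i =>
          (hhd i j).isDualPair S.adm S.hp.lt.le S.hq.pos φ
      _ = ∫ x, ∑' i, φ x * hh i j x :=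
          (integral_tsum (fun i => (hφh i).aestronglyMeasurable) h1).symm
      _ = ∫ x, φ x * ∑' i, hh i j x := by simp only [tsum_mul_left]

theorem locallyIntegrable (S : Setting n p p' q q' r T C₁ C₂) (g : Fn n)
    (hg : pn p' (n / p + r) (fun x => ‖g x‖ₑ) < ∞) : LocallyIntegrable (g : Rn n → ℂ) :=
  locallyIntegrable_of_pn S.hp S.s_nonneg S.s_lt.le g.aestronglyMeasurable hg

end Setting

/-- The dual operator of `T` on the predual Morrey space. -/
noncomputable def dualOp (p' s : ℝ) (T : D n → Cb n) (g : Fn n) : Fn n :=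
  open scoped Classical in
  if h : ∃ h : Fn n, pn p' s (fun x => ‖h x‖ₑ) < ∞ ∧ IsDualPair T g h then h.choose else 0

namespace Setting

/-- The dual operator is characterized by testing with `D(ℝⁿ)`. -/
theorem dualOp_eq (S : Setting n p p' q q' r T C₁ C₂) (j : ℕ) {g h : Fn n}
    (hh : pn p' (n / p + r) (fun x => ‖h x‖ₑ) < ∞) (hgh : IsDualPair (T j) g h) :
    dualOp p' (n / p + r) (T j) g = h := by
  have hex : ∃ h : Fn n, pn p' (n / p + r) (fun x => ‖h x‖ₑ) < ∞ ∧ IsDualPair (T j) g h :=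
    ⟨h, hh, hgh⟩
  rw [dualOp, dif_pos hex]
  exact AEEqFun.ext (hex.choose_spec.2.ae_eq hgh (S.locallyIntegrable _ hex.choose_spec.1)
    (S.locallyIntegrable _ hh))

theorem dualOp_vec (S : Setting n p p' q q' r T C₁ C₂) (hlin : ∀ j, IsLinearMap ℂ (T j))
    {g : ℕ → Fn n} (hg : pn p' (n / p + r) (fun x => lq q' fun j => ‖g j x‖ₑ) < ∞) :
    pn p' (n / p + r) (fun x => lq q' fun j => ‖dualOp p' (n / p + r) (T j) (g j) x‖ₑ) ≤
        S.dualConst * pn p' (n / p + r) (fun x => lq q' fun j => ‖g j x‖ₑ) ∧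
      ∀ j, IsDualPair (T j) (g j) (dualOp p' (n / p + r) (T j) (g j)) := by
  have key : ∀ u : Idx n → Rn n → ℝ≥0∞, (∀ i, Measurable (u i)) →
      (∀ᵐ x, (lq q' fun j => ‖g j x‖ₑ) ≤ qsum u x) →
      ∑' i, two (-(i.1 * (n / p + r))) * lpNorm p' (Q i) (u i) ≠ ∞ →
      pn p' (n / p + r) (fun x => lq q' fun j => ‖dualOp p' (n / p + r) (T j) (g j) x‖ₑ) ≤
        S.dualConst * ∑' i, two (-(i.1 * (n / p + r))) * lpNorm p' (Q i) (u i) ∧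
      ∀ j, IsDualPair (T j) (g j) (dualOp p' (n / p + r) (T j) (g j)) := by
    intro u hu hgu hcost
    obtain ⟨h, hle, hd⟩ := S.exists_dual_of_le_qsum hlin g hu hgu hcost
    have htop := hle.trans_lt (ENNReal.mul_lt_top S.dualConst_ne_top.lt_top hcost.lt_top)
    have e : ∀ j, dualOp p' (n / p + r) (T j) (g j) = h j := fun j => by
      refine S.dualOp_eq j ((pn_mono fun x => ?_).trans_lt htop) (hd j)
      exact le_lq S.hq.symm.pos (fun j => ‖h j x‖ₑ) j
    simp only [e]
    exact ⟨hle, hd⟩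
  constructor
  · rw [mul_comm, ← ENNReal.div_le_iff_le_mul (Or.inl S.dualConst_ne_zero)
      (Or.inl S.dualConst_ne_top)]
    refine le_pn fun u hu hgu => ?_
    rcases eq_or_ne (∑' i, two (-(i.1 * (n / p + r))) * lpNorm p' (Q i) (u i)) ∞ with hc | hc
    · rw [hc]; exact le_top
    · rw [ENNReal.div_le_iff_le_mul (Or.inl S.dualConst_ne_zero) (Or.inl S.dualConst_ne_top),
        mul_comm]
      exact (key u hu hgu hc).1
  · obtain ⟨u, hu, hgu, hc⟩ := exists_of_pn_lt hg
    exact (key u hu hgu hc.ne).2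

theorem dualOp_spec (S : Setting n p p' q q' r T C₁ C₂) (hlin : ∀ j, IsLinearMap ℂ (T j))
    (j : ℕ) {g : Fn n} (hg : pn p' (n / p + r) (fun x => ‖g x‖ₑ) < ∞) :
    pn p' (n / p + r) (fun x => ‖dualOp p' (n / p + r) (T j) g x‖ₑ) ≤
        S.dualConst * pn p' (n / p + r) (fun x => ‖g x‖ₑ) ∧
      IsDualPair (T j) g (dualOp p' (n / p + r) (T j) g) := by
  classical
  have hq'0 := S.hq.symm.pos
  -- the vector-valued result is applied to a sequence with a single nonzero component
  set G : ℕ → Fn n := fun k => if k = j then g else 0 with hG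
  have hGj : G j = g := if_pos rfl
  have e : pn p' (n / p + r) (fun x => lq q' fun k => ‖G k x‖ₑ) =
      pn p' (n / p + r) (fun x => ‖g x‖ₑ) := by
    refine pn_congr_ae ?_
    filter_upwards [AEEqFun.coeFn_zero (α := Rn n) (β := ℂ) (μ := volume)] with x hx
    rw [lq_single hq'0 _ j fun k hk => ?_, hGj]
    rw [hG]
    simp only [if_neg hk]
    rw [hx]
    simp
  have h := S.dualOp_vec hlin (g := G) (by rwa [e])
  rw [e] at h
  have h2 := h.2 j
  rw [hGj] at h2
  refine ⟨(pn_mono fun x => ?_).trans h.1, h2⟩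
  have := le_lq hq'0 (fun k => ‖dualOp p' (n / p + r) (T k) (G k) x‖ₑ) j
  simpa only [hGj] using this

end Setting

end

section

variable {n : ℕ} {p p' q q' r ϱ s : ℝ} {T : ℕ → D n → Cb n} {C₁ C₂ : ℝ≥0∞}

/-! ### Test functions are dense in the predual Morrey spaces -/

theorem pn_le_of_support (hp : 0 < p') {f : Rn n → ℂ} (hf : Measurable f) (i : Idx n)
    (h0 : ∀ x, x ∉ Q i → f x = 0) :
    pn p' s (fun x => ‖f x‖ₑ) ≤ two (-(i.1 * s)) * Np p' f := by
  have e : (fun x => ‖f x‖ₑ) = (Q i).indicator fun x => ‖f x‖ₑ := by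
    funext x
    by_cases hx : x ∈ Q i
    · rw [indicator_of_mem hx]
    · rw [indicator_of_notMem hx, h0 x hx, enorm_zero]
  rw [e]
  refine (pn_indicator_le hp i hf.enorm).trans ?_
  gcongr
  exact lpNorm_le_Np hp _ _

theorem exists_Q_support (φ : D n) : ∃ i : Idx n, ∀ x, x ∉ Q i → φ x = 0 := by
  obtain ⟨R, hR⟩ := φ.hasCompactSupport.isBounded.subset_closedBall (0 : Rn n)
  obtain ⟨i, hi⟩ := exists_ball_subset_Q (n := n) R
  exact ⟨i, fun x hx => image_eq_zero_of_notMem_tsupport fun h => hx (hi (hR h))⟩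

theorem pn_D_lt_top (hp : 0 < p') (φ : D n) : pn p' s (fun x => ‖φ x‖ₑ) < ∞ := by
  obtain ⟨i, hi⟩ := exists_Q_support φ
  exact (pn_le_of_support hp (D_measurable φ) i hi).trans_lt
    (ENNReal.mul_lt_top (two_lt_top _) (Np_D_lt_top hp φ))

theorem exists_D_pn_le_of_bounded (hp : 1 ≤ p') {f : Rn n → ℂ} (hf : Measurable f)
    (hfp : Np p' f < ∞) {A : Set (Rn n)} (hA : Bornology.IsBounded A)
    (hf0 : ∀ x, x ∉ A → f x = 0) {ε : ℝ≥0∞} (hε : 0 < ε) :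
    ∃ φ : D n, pn p' s (fun x => ‖f x - φ x‖ₑ) ≤ ε := by
  have hp0 : 0 < p' := zero_lt_one.trans_le hp
  obtain ⟨R₀, hR₀⟩ := hA.subset_closedBall (0 : Rn n)
  set R := max R₀ 1 with hR
  have hR1 : 1 ≤ R := le_max_right _ _
  obtain ⟨i, hi⟩ := exists_ball_subset_Q (n := n) (2 * R)
  obtain ⟨φ, hφ⟩ := exists_D_approx hp hf hfp (ε := two (i.1 * s) * ε)
    (ENNReal.mul_pos (two_ne_zero' _) hε.ne')
  let χ : ContDiffBump (0 : Rn n) := ⟨R, 2 * R, by linarith, by linarith⟩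
  have hψ : ContDiff ℝ (⊤ : ℕ∞) fun x => ((χ x : ℝ) : ℂ) * φ x :=
    (Complex.ofRealCLM.contDiff.comp χ.contDiff).mul φ.contDiff
  set ψ : D n := mkD _ hψ φ.hasCompactSupport.mul_left with hψ'
  have hψx : ∀ x, ψ x = ((χ x : ℝ) : ℂ) * φ x := fun x => rfl
  have e : ∀ x, f x - ψ x = ((χ x : ℝ) : ℂ) * (f x - φ x) := fun x => by
    by_cases hx : x ∈ A
    · rw [hψx, χ.one_of_mem_closedBall (Metric.closedBall_subset_closedBall (le_max_left _ _)
        (hR₀ hx))]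
      simp
    · rw [hψx, hf0 x hx]; ring
  refine ⟨ψ, ?_⟩
  refine (pn_le_of_support hp0 (hf.sub (D_measurable ψ)) i fun x hx => ?_).trans ?_
  · change f x - ψ x = 0
    rw [e, χ.zero_of_le_dist, Complex.ofReal_zero, zero_mul]
    by_contra! hlt
    exact hx (hi hlt.le)
  · have h1 : Np p' (fun x => f x - ψ x) ≤ two (i.1 * s) * ε := by
      refine (Np_mono_ae hp0 (.of_forall fun x => ?_)).trans hφ
      rw [e, enorm_mul]
      refine mul_le_of_le_one_left' ?_
      rw [← ofReal_norm, Complex.norm_real, Real.norm_of_nonneg χ.nonneg]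
      simpa using χ.le_one
    calc _ ≤ two (-(i.1 * s)) * (two (i.1 * s) * ε) := by gcongr; exact h1
      _ = ε := by rw [← mul_assoc, two_neg_mul_self, one_mul]

theorem exists_D_pn_le (h : p.HolderConjugate p') (hs : 0 ≤ s) (hsn : s ≤ n / p) (g : Fn n)
    (hg : pn p' s (fun x => ‖g x‖ₑ) < ∞) {ε : ℝ≥0∞} (hε : 0 < ε) :
    ∃ φ : D n, pn p' s (fun x => ‖g x - φ x‖ₑ) ≤ ε := by
  classical
  have hp' := h.symm.lt.le
  have hp'0 := h.symm.pos
  obtain ⟨u, hu, hgu, hcost⟩ := exists_of_pn_lt hg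
  have hq : ∀ᵐ x, qsum u x < ∞ := ae_lt_top_of_pn h hs hsn (measurable_qsum hu)
    ((pn_qsum_le hu).trans_lt hcost)
  -- a finite part of the decomposition with small remainder
  obtain ⟨t, ht⟩ := ((ENNReal.tendsto_tsum_compl_atTop_zero hcost.ne).eventually_lt_const
    (ENNReal.half_pos hε.ne')).exists
  set f : Rn n → ℂ := fun x => ∑ i ∈ t, wgt u i x * g x with hf
  have hpm : ∀ i, Measurable fun x => wgt u i x * g x := fun i =>
    (measurable_wgt hu i).mul (Fn_measurable g)
  have hfm : Measurable f := Finset.measurable_sum t fun i _ => hpm i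
  have hpu : ∀ i, ∀ᵐ x, ‖wgt u i x * g x‖ₑ ≤ (Q i).indicator (u i) x := fun i => by
    filter_upwards [hgu] with x hx
    rw [enorm_mul]
    exact enorm_wgt_mul_le u i x hx
  have hpp : ∀ i, Np p' (fun x => wgt u i x * g x) < ∞ := fun i => by
    refine (nrm_mono_ae hp'0 (hpu i)).trans_lt ?_
    rw [← nrm_restrict hp'0 (measurableSet_Q i), ← lpNorm_eq_nrm]
    by_contra! htop
    refine hcost.ne (ENNReal.tsum_eq_top_of_eq_top ⟨i, ?_⟩)
    rw [top_le_iff.1 htop, ENNReal.mul_top (two_ne_zero' _)]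
  have hfp : Np p' f < ∞ := by
    refine (nrm_mono hp'0 fun x => enorm_sum_le _ _).trans_lt ?_
    refine (nrm_sum_le hp' t fun i => (hpm i).enorm.aemeasurable).trans_lt ?_
    exact ENNReal.sum_lt_top.2 fun i _ => hpp i
  have hbdd : Bornology.IsBounded (⋃ i ∈ t, Q i) :=
    (Bornology.isBounded_biUnion_finset t).2 fun i _ =>
      Metric.isBounded_closedBall.subset (Q_subset_closedBall i)
  obtain ⟨φ, hφ⟩ := exists_D_pn_le_of_bounded (s := s) hp' hfm hfp hbdd (fun x hx => by
    refine Finset.sum_eq_zero fun i hi => ?_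
    rw [wgt_of_notMem u fun hxi => hx (mem_biUnion (Finset.mem_coe.2 hi) hxi), zero_mul])
    (ENNReal.half_pos hε.ne')
  have hrem : pn p' s (fun x => ‖g x - f x‖ₑ) ≤ ε / 2 := by
    refine le_trans (pn_le (fun i => if i ∈ t then 0 else u i) (fun i => ?_) ?_) (le_trans ?_ ht.le)
    · by_cases hi : i ∈ t
      · simp only [hi, if_true]; exact measurable_const
      · simpa only [hi, if_false] using hu i
    · filter_upwards [hq, hgu, ae_all_iff.2 hpu] with x hx hx2 hx3
      have h1 := hasSum_wgt_mul hx.ne hx2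
      have h2 : HasSum (fun i => if i ∈ t then wgt u i x * g x else 0) (f x) := by
        have := hasSum_sum_of_ne_finset_zero (s := t) (L := .unconditional _)
          (f := fun i => if i ∈ t then wgt u i x * g x else 0) fun i hi => if_neg hi
        rwa [Finset.sum_congr rfl fun i hi => if_pos hi] at this
      rw [← (h1.sub h2).tsum_eq]
      refine enorm_tsum_le_tsum_enorm.trans (ENNReal.tsum_le_tsum fun i => ?_)
      by_cases hi : i ∈ t
      · simp [hi]
      · simpa only [hi, if_false, sub_zero] using hx3 i
    · refine le_trans (ENNReal.tsum_le_tsum fun i => ?_) (tsum_subtype {i | i ∉ t} fun i : Idx n =>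
        two (-(i.1 * s)) * lpNorm p' (Q i) (u i)).ge
      by_cases hi : i ∈ t
      · simp only [hi, if_true, Pi.zero_def]
        rw [lpNorm_eq_nrm, nrm_zero hp'0, mul_zero]
        exact zero_le
      · rw [indicator_of_mem (show i ∈ {i | i ∉ t} from hi), if_neg hi]
  refine ⟨φ, ?_⟩
  calc pn p' s (fun x => ‖g x - φ x‖ₑ)
      ≤ pn p' s (fun x => ‖g x - f x‖ₑ + ‖f x - φ x‖ₑ) := pn_mono fun x => enorm_sub_triangle _ _ _
    _ ≤ ε / 2 + ε / 2 := (pn_add_le hp' _ _).trans (add_le_add hrem hφ)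
    _ = ε := ENNReal.add_halves ε

/-! ### The predual norms -/

namespace Setting

theorem exponent_eq (S : Setting n p p' q q' r T C₁ C₂) (hϱ : r + ϱ = -n) :
    n / p' + ϱ = -(n / p + r) := by
  have h := S.hp.inv_add_inv_eq_one
  have : n / p + n / p' = (n : ℝ) := by
    rw [div_eq_mul_inv, div_eq_mul_inv, ← mul_add, h, mul_one]
  linarith

theorem predualNorm_eq (S : Setting n p p' q q' r T C₁ C₂) (hϱ : r + ϱ = -n) (g : Fn n) :
    predualNorm p' ϱ g = pn p' (n / p + r) (fun x => ‖g x‖ₑ) :=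
  predualNormAux_eq_pn S.hp S.s_nonneg S.s_lt.le (S.exponent_eq hϱ) (Fn_measurable g)

theorem vecPredualNorm_eq (S : Setting n p p' q q' r T C₁ C₂) (hϱ : r + ϱ = -n)
    (g : ℕ → Fn n) :
    vecPredualNorm p' ϱ q' g = pn p' (n / p + r) (fun x => lq q' fun j => ‖g j x‖ₑ) := by
  have hm : Measurable fun x => lq q' fun j => ‖g j x‖ₑ :=
    measurable_lq fun j => (Fn_measurable (g j)).enorm
  have hm' : Measurable fun x => ((lq q' fun j => ‖g j x‖ₑ).toReal : ℂ) :=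
    Complex.measurable_ofReal.comp hm.ennreal_toReal
  unfold vecPredualNorm
  simp only [lqNorm_eq_lq]
  by_cases hfin : ∀ᵐ x : Rn n, (lq q' fun j => ‖g j x‖ₑ) < ∞
  · rw [iInf_pos hfin, predualNormAux_eq_pn S.hp S.s_nonneg S.s_lt.le (S.exponent_eq hϱ)
      hm']
    refine pn_congr_ae ?_
    filter_upwards [hfin] with x hx
    rw [← ofReal_norm, Complex.norm_real, Real.norm_of_nonneg ENNReal.toReal_nonneg,
      ENNReal.ofReal_toReal hx.ne]
  · rw [iInf_neg hfin]
    by_contra hne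
    exact hfin (ae_lt_top_of_pn S.hp S.s_nonneg S.s_lt.le hm (lt_top_iff_ne_top.2 (Ne.symm hne)))

theorem mem_predual_iff (S : Setting n p p' q q' r T C₁ C₂) (hϱ : r + ϱ = -n) {g : Fn n} :
    g ∈ predual n p' ϱ ↔ pn p' (n / p + r) (fun x => ‖g x‖ₑ) < ∞ := by
  rw [← S.predualNorm_eq hϱ]
  rfl

theorem mem_vecPredual_iff (S : Setting n p p' q q' r T C₁ C₂) (hϱ : r + ϱ = -n)
    {g : ℕ → Fn n} : g ∈ vecPredual n p' ϱ q' ↔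
      pn p' (n / p + r) (fun x => lq q' fun j => ‖g j x‖ₑ) < ∞ := by
  rw [← S.vecPredualNorm_eq hϱ]
  refine ⟨fun h => h.2, fun h => ⟨fun j => ?_, h⟩⟩
  rw [S.vecPredualNorm_eq hϱ] at h
  rw [S.mem_predual_iff hϱ]
  exact (pn_mono fun x => le_lq S.hq.symm.pos (fun j => ‖g j x‖ₑ) j).trans_lt h

theorem pn_lin_lt_top (S : Setting n p p' q q' r T C₁ C₂) {f g : Fn n}
    (hf : pn p' (n / p + r) (fun x => ‖f x‖ₑ) < ∞) (hg : pn p' (n / p + r) (fun x => ‖g x‖ₑ) < ∞)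
    (a b : ℂ) : pn p' (n / p + r) (fun x => ‖(a • f + b • g : Fn n) x‖ₑ) < ∞ := by
  refine lt_of_le_of_lt (pn_mono_ae (G := fun x => ‖a‖ₑ * ‖f x‖ₑ + ‖b‖ₑ * ‖g x‖ₑ) ?_) ?_
  · filter_upwards [coe_lin a b f g] with x hx
    rw [hx, ← enorm_mul, ← enorm_mul]
    exact enorm_add_le _ _
  · refine (pn_add_le S.hp.symm.lt.le _ _).trans_lt (ENNReal.add_lt_top.2 ⟨?_, ?_⟩)
    · exact (pn_const_mul_le S.hp.symm.pos enorm_ne_top _).trans_lt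
        (ENNReal.mul_lt_top enorm_lt_top hf)
    · exact (pn_const_mul_le S.hp.symm.pos enorm_ne_top _).trans_lt
        (ENNReal.mul_lt_top enorm_lt_top hg)

theorem pn_ofD_lt_top (S : Setting n p p' q q' r T C₁ C₂) (φ : D n) :
    pn p' (n / p + r) (fun x => ‖ofD φ x‖ₑ) < ∞ := by
  rw [pn_congr_ae (G := fun x => ‖φ x‖ₑ)]
  · exact pn_D_lt_top S.hp.symm.pos φ
  · filter_upwards [coe_ofD φ] with x hx
    rw [hx]

theorem integral_ofD (φ : D n) (h : Rn n → ℂ) : ∫ x, ofD φ x * h x = ∫ x, φ x * h x := by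
  refine integral_congr_ae ?_
  filter_upwards [coe_ofD φ] with x hx
  rw [hx]

theorem integral_ofC (u : Cb n) (h : Rn n → ℂ) : ∫ x, ofC u x * h x = ∫ x, u x * h x := by
  refine integral_congr_ae ?_
  filter_upwards [coe_ofC u] with x hx
  rw [hx]

/-! ### The properties of the dual operators -/

theorem isDualOperator (S : Setting n p p' q q' r T C₁ C₂) (hϱ : r + ϱ = -n)
    (hlin : ∀ j, IsLinearMap ℂ (T j)) (j : ℕ) :
    IsDualOperator (morreyCirc n p r) (predual n p' ϱ) (mext p C₂ (T j))
      (dualOp p' (n / p + r) (T j)) := by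
  have hp0 := S.hp.pos
  have mm : ∀ {f : Fn n}, f ∈ morrey n p r → mn p (n / p + r) (fun x => ‖f x‖ₑ) < ∞ :=
    fun {f} hf => by rw [← morreyNorm_eq]; exact hf
  have hB : ∀ {g : Fn n}, pn p' (n / p + r) (fun x => ‖g x‖ₑ) < ∞ →
      pn p' (n / p + r) (fun x => ‖dualOp p' (n / p + r) (T j) g x‖ₑ) < ∞ := fun hg =>
    (S.dualOp_spec hlin j hg).1.trans_lt (ENNReal.mul_lt_top S.dualConst_ne_top.lt_top hg)
  refine ⟨fun g hg => ?_, fun f hf g hg => ?_, fun f hf g hg => ?_⟩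
  · rw [S.mem_predual_iff hϱ] at *
    exact hB hg
  · rw [S.mem_predual_iff hϱ] at hg
    exact S.integrable_mul (Fn_measurable f) (Fn_measurable g) (mm hf.1) hg
  · rw [S.mem_predual_iff hϱ] at hg
    set k := dualOp p' (n / p + r) (T j) g with hk
    have hkp : pn p' (n / p + r) (fun x => ‖k x‖ₑ) < ∞ := hB hg
    have hA := S.mapsTo_morrey j
    rw [← sub_eq_zero, ← enorm_eq_zero, ← nonpos_iff_eq_zero]
    refine le_of_forall_two (C := S.const * pn p' (n / p + r) (fun x => ‖g x‖ₑ) +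
      pn p' (n / p + r) (fun x => ‖k x‖ₑ)) (ENNReal.add_ne_top.2
        ⟨ENNReal.mul_ne_top S.const_ne_top hg.ne, hkp.ne⟩) fun m => ?_
    obtain ⟨φ, hφ⟩ := hf.2 (two (-m)) (pos_iff_ne_zero.2 (two_ne_zero' _))
    have hφm := S.ofD_mem_morrey φ
    have hpair : ∫ x, mext p C₂ (T j) (ofD φ) x * g x = ∫ x, ofD φ x * k x := by
      rw [S.extends_mext j φ, integral_ofC, integral_ofD]
      exact (S.dualOp_spec hlin j hg).2 φ
    have hsub : ∀ {a b c : Fn n}, a ∈ morrey n p r → b ∈ morrey n p r →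
        pn p' (n / p + r) (fun x => ‖c x‖ₑ) < ∞ →
        ‖(∫ x, a x * c x) - ∫ x, b x * c x‖ₑ ≤
          morreyNorm p r (a - b) * pn p' (n / p + r) (fun x => ‖c x‖ₑ) := by
      intro a b c ha hb hc
      rw [← integral_sub (S.integrable_mul (Fn_measurable a) (Fn_measurable c) (mm ha) hc)
        (S.integrable_mul (Fn_measurable b) (Fn_measurable c) (mm hb) hc)]
      simp_rw [← sub_mul]
      rw [morreyNorm_sub_eq hp0]
      refine S.enorm_integral_mul_le ((Fn_measurable a).sub (Fn_measurable b)) ?_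
      refine (mn_mono hp0 fun x => enorm_sub_le).trans_lt ((mn_add_le S.hp.lt.le
        (Fn_measurable a).enorm (Fn_measurable b).enorm).trans_lt ?_)
      exact ENNReal.add_lt_top.2 ⟨mm ha, mm hb⟩
    calc ‖(∫ x, mext p C₂ (T j) f x * g x) - ∫ x, f x * k x‖ₑ
        = ‖((∫ x, mext p C₂ (T j) f x * g x) - ∫ x, mext p C₂ (T j) (ofD φ) x * g x) -
            ((∫ x, f x * k x) - ∫ x, ofD φ x * k x)‖ₑ := by rw [hpair]; congr 1; ring
      _ ≤ morreyNorm p r (mext p C₂ (T j) f - mext p C₂ (T j) (ofD φ)) *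
            pn p' (n / p + r) (fun x => ‖g x‖ₑ) +
          morreyNorm p r (f - ofD φ) * pn p' (n / p + r) (fun x => ‖k x‖ₑ) :=
          enorm_sub_le.trans (add_le_add (hsub (hA hf.1) (hA hφm) hg) (hsub hf.1 hφm hkp))
      _ ≤ S.const * two (-m) * pn p' (n / p + r) (fun x => ‖g x‖ₑ) +
          two (-m) * pn p' (n / p + r) (fun x => ‖k x‖ₑ) := by
          refine add_le_add (mul_le_mul_left ((S.lipschitz j hf.1 hφm).trans ?_) _)
            (mul_le_mul_left hφ.le _)
          exact mul_le_mul_right hφ.le _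
      _ = _ := by ring

theorem eqOn_of_isDualOperator (S : Setting n p p' q q' r T C₁ C₂) (hϱ : r + ϱ = -n) (j : ℕ)
    {B : Fn n → Fn n}
    (hB : IsDualOperator (morreyCirc n p r) (predual n p' ϱ) (mext p C₂ (T j)) B) :
    EqOn B (dualOp p' (n / p + r) (T j)) (predual n p' ϱ) := fun g hg => by
  refine (S.dualOp_eq j ((S.mem_predual_iff hϱ).1 (hB.mapsTo hg)) fun φ => ?_).symm
  have h := hB.integral_eq (ofD φ) (S.ofD_mem_morreyCirc φ) g hg
  rwa [S.extends_mext j φ, integral_ofC, integral_ofD] at h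

theorem isLinearOn_dualOp (S : Setting n p p' q q' r T C₁ C₂) (hϱ : r + ϱ = -n)
    (hlin : ∀ j, IsLinearMap ℂ (T j)) (j : ℕ) :
    IsLinearOn (predual n p' ϱ) (dualOp p' (n / p + r) (T j)) := by
  intro f hf g hg a b
  rw [S.mem_predual_iff hϱ] at hf hg
  obtain ⟨hf1, hf2⟩ := S.dualOp_spec hlin j hf
  obtain ⟨hg1, hg2⟩ := S.dualOp_spec hlin j hg
  replace hf1 := hf1.trans_lt (ENNReal.mul_lt_top S.dualConst_ne_top.lt_top hf)
  replace hg1 := hg1.trans_lt (ENNReal.mul_lt_top S.dualConst_ne_top.lt_top hg)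
  have key : ∀ {u : Rn n → ℂ} {h k : Fn n}, Measurable u →
      mn p (n / p + r) (fun x => ‖u x‖ₑ) < ∞ → pn p' (n / p + r) (fun x => ‖h x‖ₑ) < ∞ →
      pn p' (n / p + r) (fun x => ‖k x‖ₑ) < ∞ →
      ∫ x, u x * (a • h + b • k : Fn n) x = a * (∫ x, u x * h x) + b * ∫ x, u x * k x := by
    intro u h k hu hum hh hk
    rw [← integral_const_mul, ← integral_const_mul, ← integral_add
      ((S.integrable_mul hu (Fn_measurable h) hum hh).const_mul a)
      ((S.integrable_mul hu (Fn_measurable k) hum hk).const_mul b)]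
    refine integral_congr_ae ?_
    filter_upwards [coe_lin a b h k] with x hx
    rw [hx]
    ring
  refine S.dualOp_eq j (S.pn_lin_lt_top hf1 hg1 a b) fun φ => ?_
  rw [key (Cb_measurable _) (S.mn_T_lt_top j φ) hf hg,
    key (D_measurable φ) (S.mn_D_lt_top φ) hf1 hg1, hf2 φ, hg2 φ]

theorem isBddOn_dualOp (S : Setting n p p' q q' r T C₁ C₂) (hϱ : r + ϱ = -n)
    (hlin : ∀ j, IsLinearMap ℂ (T j)) (j : ℕ) :
    IsBddOn (predualNorm p' ϱ) (predual n p' ϱ) (dualOp p' (n / p + r) (T j)) := by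
  refine isBddOn_of_le S.dualConst_ne_top (S.isDualOperator hϱ hlin j).mapsTo fun g hg => ?_
  rw [S.predualNorm_eq hϱ, S.predualNorm_eq hϱ]
  exact (S.dualOp_spec hlin j ((S.mem_predual_iff hϱ).1 hg)).1

theorem isBddOn_dualOp_vec (S : Setting n p p' q q' r T C₁ C₂) (hϱ : r + ϱ = -n)
    (hlin : ∀ j, IsLinearMap ℂ (T j)) :
    IsBddOn (vecPredualNorm p' ϱ q') (vecPredual n p' ϱ q')
      (fun g j => dualOp p' (n / p + r) (T j) (g j)) := by
  refine isBddOn_of_le S.dualConst_ne_top (fun g hg => ?_) fun g hg => ?_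
  · rw [S.mem_vecPredual_iff hϱ] at *
    exact (S.dualOp_vec hlin hg).1.trans_lt (ENNReal.mul_lt_top S.dualConst_ne_top.lt_top hg)
  · rw [S.vecPredualNorm_eq hϱ, S.vecPredualNorm_eq hϱ]
    exact (S.dualOp_vec hlin ((S.mem_vecPredual_iff hϱ).1 hg)).1

/-- Formal self-adjointness says that `T_j φ` satisfies the relation characterizing the dual image of
`φ`. -/
theorem extends_dualOp (S : Setting n p p' q q' r T C₁ C₂)
    (hlin : ∀ j, IsLinearMap ℂ (T j)) (j : ℕ) (hsa : IsFormallySelfAdjoint (T j)) :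
    Extends (T j) (dualOp p' (n / p + r) (T j)) := fun φ => by
  obtain ⟨h1, h2⟩ := S.dualOp_spec hlin j (S.pn_ofD_lt_top φ)
  have h3 : IsDualPair (T j) (ofD φ) (T j φ) := fun ψ => by
    rw [← hsa ψ φ]
    refine integral_congr_ae ?_
    filter_upwards [coe_ofD φ] with x hx
    rw [hx]
  refine AEEqFun.ext ((h2.ae_eq h3 (S.locallyIntegrable _ (h1.trans_lt (ENNReal.mul_lt_top
    S.dualConst_ne_top.lt_top (S.pn_ofD_lt_top φ)))) (T j φ).continuous.locallyIntegrable).trans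
    (coe_ofC _).symm)

/-- Bounded linear operators on the predual Morrey space are determined by their values on
`D(ℝⁿ)`. -/
theorem eqOn_predual_of_extends (S : Setting n p p' q q' r T C₁ C₂) (hϱ : r + ϱ = -n)
    {T₀ : D n → Cb n} {A B : Fn n → Fn n} (hA : Extends T₀ A) (hB : Extends T₀ B)
    (hAl : IsLinearOn (predual n p' ϱ) A) (hBl : IsLinearOn (predual n p' ϱ) B)
    (hAb : IsBddOn (predualNorm p' ϱ) (predual n p' ϱ) A)
    (hBb : IsBddOn (predualNorm p' ϱ) (predual n p' ϱ) B) : EqOn B A (predual n p' ϱ) := by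
  intro g hg
  obtain ⟨-, CA, hCA⟩ := hAb
  obtain ⟨-, CB, hCB⟩ := hBb
  have hgp := (S.mem_predual_iff hϱ).1 hg
  have hp' := S.hp.symm.lt.le
  have h0 : pn p' (n / p + r) (fun x => ‖B g x - A g x‖ₑ) = 0 := by
    rw [← nonpos_iff_eq_zero]
    refine le_of_forall_two (C := (CB : ℝ≥0∞) + CA) (by finiteness) fun m => ?_
    obtain ⟨φ, hφ⟩ := exists_D_pn_le S.hp S.s_nonneg S.s_lt.le g hgp
      (pos_iff_ne_zero.2 (two_ne_zero' (-m)))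
    have hφp := S.pn_ofD_lt_top φ
    have hφm : ofD φ ∈ predual n p' ϱ := (S.mem_predual_iff hϱ).2 hφp
    set d : Fn n := (1 : ℂ) • g + (-1 : ℂ) • ofD φ with hd
    have hdp := S.pn_lin_lt_top hgp hφp 1 (-1)
    have hdm : d ∈ predual n p' ϱ := (S.mem_predual_iff hϱ).2 hdp
    have hdle : predualNorm p' ϱ d ≤ two (-m) := by
      rw [S.predualNorm_eq hϱ]
      refine (pn_mono_ae ?_).trans hφ
      filter_upwards [coe_lin 1 (-1) g (ofD φ), coe_ofD φ] with x h1 h2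
      rw [h1, h2]
      exact le_of_eq (by congr 1; ring)
    have key : ∀ {A : Fn n → Fn n}, Extends T₀ A → IsLinearOn (predual n p' ϱ) A →
        ∀ᵐ x, A d x = A g x - ofC (T₀ φ) x := fun {A} hA hl => by
      have h1 := hl g hg (ofD φ) hφm 1 (-1)
      rw [hA φ] at h1
      rw [hd, h1]
      filter_upwards [coe_lin 1 (-1) (A g) (ofC (T₀ φ))] with x hx
      rw [hx]; ring
    calc pn p' (n / p + r) (fun x => ‖B g x - A g x‖ₑ)
        ≤ pn p' (n / p + r) (fun x => ‖B d x‖ₑ + ‖A d x‖ₑ) := by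
          refine pn_mono_ae ?_
          filter_upwards [key hA hAl, key hB hBl] with x h1 h2
          refine le_trans (le_of_eq ?_) enorm_sub_le
          rw [h1, h2]
          congr 1; ring
      _ ≤ CB * two (-m) + CA * two (-m) := by
          refine (pn_add_le hp' _ _).trans (add_le_add ?_ ?_)
          · rw [← S.predualNorm_eq hϱ]
            exact (hCB d hdm).trans (mul_le_mul_right hdle _)
          · rw [← S.predualNorm_eq hϱ]
            exact (hCA d hdm).trans (mul_le_mul_right hdle _)
      _ = 0 + (CB + CA) * two (-m) := by ring
  refine AEEqFun.ext ?_
  filter_upwards [ae_eq_zero_of_pn S.hp S.s_nonneg S.s_lt.le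
    ((Fn_measurable (B g)).sub (Fn_measurable (A g))).enorm h0] with x hx
  exact sub_eq_zero.1 (enorm_eq_zero.1 hx)

end Setting

end

end MorreyOp

open MorreyOp in
theorem mainTheorem1 (n : ℕ) (p p' q q' r ϱ : ℝ)
    (hp : 1 < p) (hpp' : 1 / p + 1 / p' = 1) (hq : 1 < q) (hqq' : 1 / q + 1 / q' = 1)
    (hr : -(n / p) < r) (hr0 : r < 0) (hϱ : r + ϱ = -n)
    (T : ℕ → D n → Cb n)
    (hlin : ∀ j, IsLinearMap ℂ (T j) ∨ IsSublinear (T j))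
    (hsize : ∃ c₁ : ℝ, ∀ (j : ℕ) (f : D n) (y : Rn n), y ∉ tsupport f →
      ‖T j f y‖ ≤ c₁ * ∫ z, ‖f z‖ / ‖y - z‖ ^ n)
    (hbdd : ∃ c₂ : ℝ≥0, ∀ f : ℕ → D n,
      lpNorm p univ (lqNorm q (fun j => T j (f j))) ≤
        c₂ * lpNorm p univ (lqNorm q (fun j => f j))) :
    ∃ A : ℕ → Fn n → Fn n,
      -- the unique continuous and bounded extensions to the closure of `D(ℝⁿ)`
      ((∀ j, Extends (T j) (A j) ∧
          IsContOn (morreyNorm p r) (morreyCirc n p r) (A j) ∧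
          IsBddOn (morreyNorm p r) (morreyCirc n p r) (A j) ∧
          ∀ B : Fn n → Fn n, Extends (T j) B →
            IsContOn (morreyNorm p r) (morreyCirc n p r) B →
            IsBddOn (morreyNorm p r) (morreyCirc n p r) B →
            EqOn B (A j) (morreyCirc n p r)) ∧
        IsContOn (vecMorreyNorm p r q) (vecMorreyCirc n p r q) (fun f j => A j (f j)) ∧
        IsBddOn (vecMorreyNorm p r q) (vecMorreyCirc n p r q) (fun f j => A j (f j))) ∧
      -- in the linear case: the dual operators on the predual spaces
      ((∀ j, IsLinearMap ℂ (T j)) →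
        (∀ j, IsLinearOn (morreyCirc n p r) (A j)) ∧
        ∃ A' : ℕ → Fn n → Fn n,
          (∀ j, IsDualOperator (morreyCirc n p r) (predual n p' ϱ) (A j) (A' j) ∧
            (∀ B : Fn n → Fn n,
              IsDualOperator (morreyCirc n p r) (predual n p' ϱ) (A j) B →
              EqOn B (A' j) (predual n p' ϱ)) ∧
            IsLinearOn (predual n p' ϱ) (A' j) ∧
            IsBddOn (predualNorm p' ϱ) (predual n p' ϱ) (A' j)) ∧
          IsBddOn (vecPredualNorm p' ϱ q') (vecPredual n p' ϱ q') (fun g j => A' j (g j)) ∧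
          ((∀ j, IsFormallySelfAdjoint (T j)) →
            ∀ j, Extends (T j) (A' j) ∧
              ∀ B : Fn n → Fn n, Extends (T j) B →
                IsLinearOn (predual n p' ϱ) B →
                IsBddOn (predualNorm p' ϱ) (predual n p' ϱ) B →
                EqOn B (A' j) (predual n p' ϱ))) ∧
      -- in the linear case: linear and bounded extensions to the full Morrey spaces
      ((∀ j, IsLinearMap ℂ (T j)) →
        ∃ E : ℕ → Fn n → Fn n,
          (∀ j, Extends (T j) (E j) ∧
            IsLinearOn (morrey n p r) (E j) ∧
            IsBddOn (morreyNorm p r) (morrey n p r) (E j)) ∧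
          IsBddOn (vecMorreyNorm p r q) (vecMorrey n p r q) (fun f j => E j (f j))) := by
  -- in dimension zero the conditions on `r` would contradict each other
  have hn : 0 < n := by
    rcases Nat.eq_zero_or_pos n with rfl | h
    · simp at hr
      linarith
    · exact h
  have hpp : p.HolderConjugate p' :=
    Real.holderConjugate_iff.2 ⟨hp, by rwa [one_div, one_div] at hpp'⟩
  have hqq : q.HolderConjugate q' :=
    Real.holderConjugate_iff.2 ⟨hq, by rwa [one_div, one_div] at hqq'⟩
  obtain ⟨C₁, C₂, hT⟩ := exists_adm (p := p) (q := q) hn T hlin hsize hbdd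
  have S : Setting n p p' q q' r T C₁ C₂ := ⟨hT, hn, hpp, hqq, hr, hr0⟩
  refine ⟨fun j => mext p C₂ (T j), ⟨fun j => ⟨S.extends_mext j, ?_, ?_, fun B hB hBc _ =>
    S.eqOn_of_isContOn j hB hBc⟩, ?_, ?_⟩, fun hl => ⟨fun j f hf g hg a b =>
      S.isLinearOn_morrey j (hl j) f hf.1 g hg.1 a b, fun j => dualOp p' (n / p + r) (T j),
      fun j => ⟨S.isDualOperator hϱ hl j, fun B hB => S.eqOn_of_isDualOperator hϱ j hB,
        S.isLinearOn_dualOp hϱ hl j, S.isBddOn_dualOp hϱ hl j⟩, S.isBddOn_dualOp_vec hϱ hl,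
      fun hsa j => ⟨S.extends_dualOp hl j (hsa j), fun B hB hBl hBb =>
        S.eqOn_predual_of_extends hϱ (S.extends_dualOp hl j (hsa j)) hB
          (S.isLinearOn_dualOp hϱ hl j) hBl (S.isBddOn_dualOp hϱ hl j) hBb⟩⟩,
    fun hl => ⟨fun j => mext p C₂ (T j), fun j => ⟨S.extends_mext j, S.isLinearOn_morrey j (hl j),
      isBddOn_of_le S.const_ne_top (S.mapsTo_morrey j) fun f hf => S.mext_bound j hf⟩,
      isBddOn_of_le S.const_ne_top S.mapsTo_vecMorrey fun f hf => S.vec_bound hf.1⟩⟩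
  · exact isContOn_of_lipschitz S.const_ne_top fun f hf g hg => S.lipschitz j hg.1 hf.1
  · exact isBddOn_of_le S.const_ne_top (S.mapsTo_morreyCirc j) fun f hf => S.mext_bound j hf.1
  · exact isContOn_of_lipschitz S.const_ne_top fun f hf g hg => S.vec_lipschitz hg.1.1 hf.1.1
  · exact isBddOn_of_le S.const_ne_top S.mapsTo_vecMorreyCirc fun f hf => S.vec_bound hf.1.1
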